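/- Let $n\ge 3$ and write points of $\mathbb R^n$ as $x=(x',x_n)$ with $x'\in\mathbb R^{n-1}$. An anisotropy is a convex, positively one-homogeneous function that is positive away from the origin. Let $\tilde\sigma$ be an even anisotropy on $\mathbb R^{n-1}$, let $\mu>0$, and put $$\sigma(p)=\tilde\sigma(p')+|p_n|,\qquad \beta(p)=\tilde\sigma(p')+\mu|p_n| .$$ Let $\tilde\sigma^\circ(x')=\sup\{x'\cdot p':\tilde\sigma(p')\le 1\}$ be the convex polar of $\tilde\sigma$ and, for $0<r<R$ and $h>0$, let $$T_{r,R,h}=\{x\in\mathbb R^n: r<\tilde\sigma^\circ(x')<R,\ |x_n|<h\}.$$ For a set $E$ with unit outer normal $\nu$, a Cahn–Hoffman field on $\partial E$ is a Lipschitz vector field $z$ on $\partial E$ with $z(x)\in\partial\sigma(\nu(x))$ for $\mathcal H^{n-1}$-a.e. $x\in\partial E$ (and with surface divergence in $L^2(\partial E)$). The crystalline curvature of $\partial E$ is $\kappa_\sigma=-\operatorname{div}_{\partial E}z_{\min}$, where $z_{\min}$ minimizes $\|\operatorname{div}_{\partial E}z\|_{L^2(\partial E)}$ among all Cahn–Hoffman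 fields on $\partial E$. A family $(E_t)$ evolves by $V=\beta(\nu)\kappa_\sigma$ if at every time $t$ its normal velocity $V$ exists and equals $\beta(\nu)\kappa_\sigma$ at $\mathcal H^{n-1}$-a.e. point of $\partial E_t$. 1. Let $0<r<R$, $h>0$. The vector field $$z(x)=\Bigl(g(\tilde\sigma^\circ(x'))\,x',\ \frac{x_n}{h}\Bigr),\quad g(s)=a s^{1-n}+b,\quad a=-\frac{R^{n-2}r^{n-2}(R+r)}{R^{n-1}-r^{n-1}},\quad b=\frac{R^{n-2}+r^{n-2}}{R^{n-1}-r^{n-1}},$$ is a Cahn–Hoffman field on $\partial T_{r,R,h}$ that minimizes the $L^2$ norm of the surface divergence. Its surface divergence is ($\mathcal H^{n-1}$-a.e.) equal to $\frac{n-2}{R}+\frac1h$ on the outer surface $\{\tilde\sigma^\circ(x')=R\}$, to $-\frac{n-2}{r}+\frac1h$ on the inner surface $\{\tilde\sigma^\circ(x')=r\}$, and to $(n-1)b$ on the side facets $\{|x_n|=h\}$. 2. Let $r,R,h$ be $C^1$ functions on $[0,T)$, $T>0$, with $0<r<R$ and $h>0$. The sets $T_{r(t),R(t),h(t)}$, $0\le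 t<T$, evolve by $V=\beta(\nu)\kappa_\sigma$ if and only if on $[0,T)$ $$R'=-\frac{n-2}{R}-\frac1h,\qquad r'=-\frac{n-2}{r}+\frac1h,\qquad h'=-(n-1)\mu\,\frac{R^{n-2}+r^{n-2}}{R^{n-1}-r^{n-1}} .$$ Call an evolution $(T_{r(t),R(t),h(t)})_{0\le t<T}$ by $V=\beta(\nu)\kappa_\sigma$, with $r,R,h$ as in 2, self-similar if every $T_{r(t),R(t),h(t)}$ is a dilation of $T_{r(0),R(0),h(0)}$ about the origin. 3. Let $R_0>0$, $\gamma\in(0,1)$ and $\lambda>0$. There is a self-similar evolution with initial set $T_{\gamma R_0,R_0,\lambda R_0}$ on some interval $[0,T)$, $T>0$, if and only if $$\lambda=\frac{\gamma}{(n-2)(1-\gamma)}\qquad\text{and}\qquad 1+\gamma+\dots+\gamma^{n-2}=(n-1)\mu\,(1+\gamma^{n-2}).$$ 4. If $n=3$, a self-similar evolution on some interval $[0,T)$, $T>0$, exists if and only if $\mu=\frac12$. 5. If $n=3$ and $\mu=\frac12$, then $$E_t=\begin{cases}\sqrt{1-4t}\;T_{1/2,1,1},&0\le t<\frac14,\\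 \emptyset,& t\ge\frac14,\end{cases}$$ evolves by $V=\beta(\nu)\kappa_\sigma$, with $E_0=T_{1/2,1,1}$, and it is self-similar on $[0,\frac14)$. The sets $E_t$ are nonempty for $0\le t<\frac14$ and shrink to the origin as $t\uparrow t^*=\frac14$. -/

import Mathlib

open MeasureTheory Set Filter Topology
open scoped Pointwise RealInnerProductSpace

noncomputable section

/-! ### Anisotropies -/

section Anisotropy

variable {V : Type*} [NormedAddCommGroup V] [InnerProductSpace ℝ V]

/-- An anisotropy: a convex, positively one-homogeneous function, positive away from the origin. -/
structure IsAnisotropy (σ : V → ℝ) : Prop where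
  convex : ConvexOn ℝ univ σ
  homogeneous : ∀ (c : ℝ) (p : V), 0 ≤ c → σ (c • p) = c * σ p
  pos : ∀ p : V, p ≠ 0 → 0 < σ p

/-- The convex polar `σ°(x) = sup {x · p : σ(p) ≤ 1}`. -/
def polar (σ : V → ℝ) (x : V) : ℝ :=
  sSup ((fun p : V => ⟪x, p⟫) '' {p : V | σ p ≤ 1})

/-- The subdifferential `∂σ(p)`. -/
def subdifferential (σ : V → ℝ) (p : V) : Set V :=
  {ξ : V | ∀ k : V, ⟪ξ, k⟫ ≤ σ (p + k) - σ p}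

end Anisotropy

/-! ### Surfaces, Cahn-Hoffman fields and the crystalline curvature -/

section Surface

variable {V : Type*} [NormedAddCommGroup V] [InnerProductSpace ℝ V]

/-- `ν` is the unit outer normal of `E` at the boundary point `x`: to first order at `x`, the set
`E` is the half-space `{y : (y - x) · ν < 0}`. -/
def IsOuterNormal (E : Set V) (x ν : V) : Prop :=
  x ∈ frontier E ∧ ‖ν‖ = 1 ∧
    ∀ ε > 0, ∃ δ > 0, ∀ y : V, ‖y - x‖ < δ →
      (⟪y - x, ν⟫ < -(ε * ‖y - x‖) → y ∈ E) ∧ (ε * ‖y - x‖ < ⟪y - x, ν⟫ → y ∉ E)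

/-- The family `E s`, `s ∈ I`, has unit outer normal `ν` and normal velocity `v` (in the direction
of `ν`) at the point `x` of the boundary of `E t`: to first order at `(t, x)`, the space-time set
`{(s, y) : y ∈ E s}` is the half-space `{(s, y) : (y - x) · ν < v (s - t)}`. -/
def HasNormalVelocity (E : ℝ → Set V) (I : Set ℝ) (t : ℝ) (x ν : V) (v : ℝ) : Prop :=
  x ∈ frontier (E t) ∧ ‖ν‖ = 1 ∧
    ∀ ε > 0, ∃ δ > 0, ∀ s ∈ I, ∀ y : V, |s - t| < δ → ‖y - x‖ < δ →
      (⟪y - x, ν⟫ - v * (s - t) < -(ε * (|s - t| + ‖y - x‖)) → y ∈ E s) ∧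
      (ε * (|s - t| + ‖y - x‖) < ⟪y - x, ν⟫ - v * (s - t) → y ∉ E s)

/-- The surface `∂E` has a unit normal `ν` at `x`, the field `z` is differentiable along `∂E`
at `x`, and its surface divergence there, the trace of its derivative over the tangent space `ν^⊥`,
equals `d`. (The trace over `ν^⊥` does not see the freedom in the choice of `L`.) -/
def HasSurfaceDivAt (E : Set V) (z : V → V) (x : V) (d : ℝ) : Prop :=
  ∃ (ν : V) (L : V →L[ℝ] V), IsOuterNormal E x ν ∧ HasFDerivWithinAt z L (frontier E) x ∧
    d = LinearMap.trace ℝ V (L : V →ₗ[ℝ] V) - ⟪ν, L ν⟫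

variable [MeasurableSpace V] [BorelSpace V]

/-- The surface measure of `∂E`: the `(n-1)`-dimensional Hausdorff measure on `∂E`, where `n` is
the dimension of the ambient space. -/
def surfaceMeasure (E : Set V) : Measure V :=
  (Measure.hausdorffMeasure ((Module.finrank ℝ V : ℝ) - 1)).restrict (frontier E)

/-- `z` is a (Lipschitz) Cahn-Hoffman field on `∂E`, that is `z ∈ ∂σ(ν)` almost everywhere, and
`d` is its surface divergence. -/
structure IsCahnHoffman (σ : V → ℝ) (E : Set V) (z : V → V) (d : V → ℝ) : Prop where
  lipschitz : ∃ K, LipschitzOnWith K z (frontier E)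
  mem_subdifferential : ∀ᵐ x ∂(surfaceMeasure E), ∃ ν : V,
    IsOuterNormal E x ν ∧ z x ∈ subdifferential σ ν
  div_eq : ∀ᵐ x ∂(surfaceMeasure E), HasSurfaceDivAt E z x (d x)
  div_memLp : MemLp d 2 (surfaceMeasure E)

/-- `z` is a Cahn-Hoffman field on `∂E` whose surface divergence `d` has the least `L²(∂E)` norm
among all Cahn-Hoffman fields. -/
def IsMinimalCahnHoffman (σ : V → ℝ) (E : Set V) (z : V → V) (d : V → ℝ) : Prop :=
  IsCahnHoffman σ E z d ∧
    ∀ (w : V → V) (e : V → ℝ), IsCahnHoffman σ E w e →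
      ∫ x, (d x) ^ 2 ∂(surfaceMeasure E) ≤ ∫ x, (e x) ^ 2 ∂(surfaceMeasure E)

/-- `κ` is the crystalline (mean) curvature of `∂E`: minus the surface divergence of a minimal
Cahn-Hoffman field. -/
def IsCrystallineCurvature (σ : V → ℝ) (E : Set V) (κ : V → ℝ) : Prop :=
  ∃ (z : V → V) (d : V → ℝ), IsMinimalCahnHoffman σ E z d ∧
    ∀ᵐ x ∂(surfaceMeasure E), κ x = -d x

/-- The family `E t`, `t ∈ I`, evolves by the law `V = β(ν) κ_σ`. -/
def IsCurvatureFlow (σ β : V → ℝ) (E : ℝ → Set V) (I : Set ℝ) : Prop :=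
  ∀ t ∈ I, ∃ κ : V → ℝ, IsCrystallineCurvature σ (E t) κ ∧
    ∀ᵐ x ∂(surfaceMeasure (E t)), ∃ ν : V, HasNormalVelocity E I t x ν (β ν * κ x)

end Surface

/-! ### The torus -/

/-- The space `ℝ^(n-1)` of the points `x'`. -/
abbrev Horizontal (n : ℕ) : Type := EuclideanSpace ℝ (Fin (n - 1))

/-- The Euclidean space `ℝ^n` of the points `x = (x', x_n)`, with the Euclidean norm. -/
abbrev Ambient (n : ℕ) : Type := WithLp 2 (Horizontal n × ℝ)

section Torus

variable {n : ℕ}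

/-- The mobility `β(p) = σ̃(p') + μ |p_n|`. -/
def cylindricalMobility (τ : Horizontal n → ℝ) (μ : ℝ) (p : Ambient n) : ℝ :=
  τ p.fst + μ * |p.snd|

/-- The cylindrical anisotropy `σ(p) = σ̃(p') + |p_n|`. -/
def cylindricalAnisotropy (τ : Horizontal n → ℝ) (p : Ambient n) : ℝ :=
  τ p.fst + |p.snd|

/-- The set `T_{r,R,h} = {x : r < σ̃°(x') < R, |x_n| < h}`. -/
def torus (τ : Horizontal n → ℝ) (r R h : ℝ) : Set (Ambient n) :=
  {x | r < polar τ x.fst ∧ polar τ x.fst < R ∧ |x.snd| < h}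

/-- The constant `a = - R^(n-2) r^(n-2) (R + r) / (R^(n-1) - r^(n-1))`. -/
def torusA (n : ℕ) (r R : ℝ) : ℝ :=
  -(R ^ (n - 2) * r ^ (n - 2) * (R + r) / (R ^ (n - 1) - r ^ (n - 1)))

/-- The constant `b = (R^(n-2) + r^(n-2)) / (R^(n-1) - r^(n-1))`. -/
def torusB (n : ℕ) (r R : ℝ) : ℝ :=
  (R ^ (n - 2) + r ^ (n - 2)) / (R ^ (n - 1) - r ^ (n - 1))

/-- The vector field `z(x) = (g(σ̃°(x')) x', x_n / h)` with `g(s) = a s^(1-n) + b`. -/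
def torusField (τ : Horizontal n → ℝ) (r R h : ℝ) (x : Ambient n) : Ambient n :=
  WithLp.toLp 2
    ((torusA n r R / polar τ x.fst ^ (n - 1) + torusB n r R) • x.fst, x.snd / h)

open Classical in
/-- The function on the boundary of `T_{r,R,h}` that equals `(n-1) b` on the side facets
`|x_n| = h`, `(n-2)/R + 1/h` on the outer surface `σ̃°(x') = R` and `-(n-2)/r + 1/h` on the inner
surface. -/
def torusDivergence (τ : Horizontal n → ℝ) (r R h : ℝ) (x : Ambient n) : ℝ :=
  if |x.snd| = h then ((n : ℝ) - 1) * torusB n r R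
  else if polar τ x.fst = R then ((n : ℝ) - 2) / R + 1 / h
  else -(((n : ℝ) - 2) / r) + 1 / h

/-- `r, R, h` are `C¹` functions on `[0, T)`, `T > 0`, with `0 < r < R` and `0 < h`. -/
structure IsTorusData (r R h : ℝ → ℝ) (T : ℝ) : Prop where
  time_pos : 0 < T
  contDiff_r : ContDiffOn ℝ 1 r (Ico 0 T)
  contDiff_R : ContDiffOn ℝ 1 R (Ico 0 T)
  contDiff_h : ContDiffOn ℝ 1 h (Ico 0 T)
  r_pos : ∀ t ∈ Ico 0 T, 0 < r t
  r_lt_R : ∀ t ∈ Ico 0 T, r t < R t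
  h_pos : ∀ t ∈ Ico 0 T, 0 < h t

/-- The ODE system for `(r, R, h)` on `[0, T)`, in dimension `n` and with the parameter `μ`. -/
def SolvesTorusODE (n : ℕ) (μ : ℝ) (r R h : ℝ → ℝ) (T : ℝ) : Prop :=
  ∀ t ∈ Ico 0 T,
    HasDerivWithinAt R (-(((n : ℝ) - 2) / R t) - 1 / h t) (Ico 0 T) t ∧
    HasDerivWithinAt r (-(((n : ℝ) - 2) / r t) + 1 / h t) (Ico 0 T) t ∧
    HasDerivWithinAt h
      (-(((n : ℝ) - 1) * μ * ((R t ^ (n - 2) + r t ^ (n - 2)) / (R t ^ (n - 1) - r t ^ (n - 1)))))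
      (Ico 0 T) t

/-- The tori `T_{r(t),R(t),h(t)}`, `0 ≤ t < T`, form a self-similar solution of `V = β(ν) κ_σ`:
they evolve by this law and are all dilations of the initial one about the origin. -/
structure IsSelfSimilarTorusFlow (τ : Horizontal n → ℝ) (μ : ℝ) (r R h : ℝ → ℝ) (T : ℝ) :
    Prop where
  data : IsTorusData r R h T
  flow : IsCurvatureFlow (cylindricalAnisotropy τ) (cylindricalMobility τ μ)
    (fun t => torus τ (r t) (R t) (h t)) (Ico 0 T)
  selfSimilar : ∀ t ∈ Ico 0 T, ∃ c : ℝ, 0 < c ∧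
    torus τ (r t) (R t) (h t) = c • torus τ (r 0) (R 0) (h 0)

/-- The evolution `√(1 - 4t) T_{1/2,1,1}` for `t < 1/4`, empty for `t ≥ 1/4`. -/
def shrinkingDoughnut (τ : Horizontal n → ℝ) (t : ℝ) : Set (Ambient n) :=
  if t < 1 / 4 then Real.sqrt (1 - 4 * t) • torus τ (1 / 2) 1 1 else ∅

end Torus

end

noncomputable section

set_option linter.unusedSectionVars false

/-! ### The area formula for injective maps into higher dimensional spaces -/

section AreaFormula

open Module Metric
open scoped NNReal ENNReal

/-! Write ρ for `polar τ`. A torus is the product of an annulus of ρ and an interval. Up to null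
ridges its boundary consists of four facets: two flat annuli, an outer and an inner lateral surface.
Minimality rests on one claim: the integral of the surface divergence over each single facet is the
same for all Cahn-Hoffman fields. The explicit field has constant divergence on each facet, so this
divergence is L²-orthogonal to its difference from any competing one. The resulting Pythagorean
identity `IsCahnHoffman.integral_sq_eq` gives minimality, and also a.e. uniqueness of the minimal
divergence, so the curvature is known.

On a flat facet the claim is a divergence theorem. Continuity across the ridges prescribes the
component of the horizontal part along the gradient of ρ, namely 1 on the outer and -1 on the inner
rim. The difference of two fields is therefore tangential there, and
`IsGauge.integral_trace_fderiv_eq_zero` applies.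

A lateral surface is merely Lipschitz, because ρ need not be smooth, and the claim comes from the
first variation of area instead. The subdifferential condition on a field W forces ρ(x' + s W') =
ρ(x') + s on the outer surface, and W has vertical component ±1 at the two ends. Hence x ↦ x + s
W(x) carries the lateral surface of radius R and half-height h exactly onto the one with R + s and h
+ s (`IsLateralFlow.exists_image_eq`). The area of the image does not depend on W, while its
derivative at s = 0 is the total divergence of W (`IsLateralFlow.integral_div_eq`). On the inner
surface the same holds for -W, with radius r + s and half-height h - s. This needs an area formula
for bi-Lipschitz maps into a space of one more dimension,
`hausdorffMeasure_image_eq_lintegral_normDet`.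

For the evolution, the lateral facets have normal speed ±ϱ'/|∇ρ|, where ϱ is the radius, and
mobility 1/|∇ρ|, because τ(∇ρ) = 1. The factor cancels, and the velocity law becomes one scalar
equation per parameter (`torus_velocity_law_iff`). Self-similarity means r = γR and h = λR for all
times. Inserting this into the system leaves two algebraic conditions, and conversely these make R a
square root of a linear function of time. For n = 3 the second condition reads 1 + γ = 2μ(1 + γ),
whence μ = 1/2. -/

/-- If `g` expands distances on `s` at most `C` times as much as `f`, then it expands Hausdorff
measures at most `C ^ d` times as much. -/
theorem hausdorffMeasure_image_le_of_dist_le {X Y Z : Type*} [MetricSpace Y]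
    [MetricSpace Z] [MeasurableSpace Y] [BorelSpace Y] [MeasurableSpace Z] [BorelSpace Z]
    {f : X → Y} {g : X → Z} {s : Set X} {C : ℝ≥0} {d : ℝ} (hd : 0 ≤ d)
    (h : ∀ x ∈ s, ∀ y ∈ s, dist (g x) (g y) ≤ C * dist (f x) (f y)) :
    Measure.hausdorffMeasure d (g '' s) ≤ (C : ℝ≥0∞) ^ d * Measure.hausdorffMeasure d (f '' s) := by
  rcases s.eq_empty_or_nonempty with rfl | ⟨x₀, -⟩
  · simp
  have : Nonempty X := ⟨x₀⟩
  -- Points of `s` with equal `f`-values have equal `g`-values, so `g` factors through a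
  -- `C`-Lipschitz map on `f '' s` even if `f` is not injective.
  have hinv : ∀ x ∈ s, g (Function.invFunOn f s (f x)) = g x := fun x hx => by
    have h1 := Function.invFunOn_mem (f := f) (s := s) ⟨x, hx, rfl⟩
    have h2 := Function.invFunOn_eq (f := f) (s := s) ⟨x, hx, rfl⟩
    have h3 := h _ h1 x hx
    rw [h2, dist_self, mul_zero] at h3
    exact dist_le_zero.1 h3
  have himage : g '' s = (g ∘ Function.invFunOn f s) '' (f '' s) := by
    rw [image_image]
    exact image_congr fun x hx => (hinv x hx).symm
  rw [himage]
  refine LipschitzOnWith.hausdorffMeasure_image_le ?_ hd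
  refine LipschitzOnWith.of_dist_le_mul ?_
  rintro _ ⟨x, hx, rfl⟩ _ ⟨y, hy, rfl⟩
  simp only [Function.comp, hinv x hx, hinv y hy]
  exact h x hx y hy

variable {E F : Type*} [NormedAddCommGroup E] [InnerProductSpace ℝ E] [FiniteDimensional ℝ E]
  [NormedAddCommGroup F] [InnerProductSpace ℝ F] 

/-- The images of the unit ball have Hausdorff measure `normDet` times that of the ball. The latter
is positive and finite and cancels from the comparison of the two images. -/
theorem normDet_le_of_norm_le {G : Type*} [NormedAddCommGroup G] [InnerProductSpace ℝ G]
    {L₁ : E →L[ℝ] F} {L₂ : E →L[ℝ] G} {C : ℝ≥0}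
    (h : ∀ v, ‖L₂ v‖ ≤ C * ‖L₁ v‖) :
    (L₂ : E →ₗ[ℝ] G).normDet ≤ (C : ℝ) ^ finrank ℝ E * (L₁ : E →ₗ[ℝ] F).normDet := by
  borelize E F G
  have h1 := hausdorffMeasure_image_le_of_dist_le (f := L₁) (g := L₂) (s := closedBall 0 1)
    (C := C) (d := finrank ℝ E) (by positivity) (fun x _ y _ => by
      rw [dist_eq_norm, dist_eq_norm, ← map_sub, ← map_sub]; exact h _)
  have h2 := (L₁ : E →ₗ[ℝ] F).hausdorffMeasure_image (closedBall 0 1)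
  have h3 := (L₂ : E →ₗ[ℝ] G).hausdorffMeasure_image (closedBall 0 1)
  simp only [ContinuousLinearMap.coe_coe] at h2 h3
  rw [h2, h3, ENNReal.rpow_natCast, ← mul_assoc] at h1
  have hpos : (Measure.hausdorffMeasure (finrank ℝ E : ℝ) : Measure E) (closedBall 0 1) ≠ 0 :=
    (measure_closedBall_pos _ _ zero_lt_one).ne'
  have hfin : (Measure.hausdorffMeasure (finrank ℝ E : ℝ) : Measure E) (closedBall 0 1) ≠ ⊤ :=
    measure_closedBall_lt_top.ne
  rw [ENNReal.mul_le_mul_iff_left hpos hfin] at h1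
  have h4 : ((C : ℝ≥0∞) ^ finrank ℝ E) = ENNReal.ofReal ((C : ℝ) ^ finrank ℝ E) := by
    rw [ENNReal.ofReal_pow (NNReal.coe_nonneg C), ENNReal.ofReal_coe_nnreal]
  rw [h4, ← ENNReal.ofReal_mul (by positivity)] at h1
  exact (ENNReal.ofReal_le_ofReal_iff
    (mul_nonneg (by positivity) (LinearMap.normDet_nonneg _))).1 h1

/-- The square of `normDet` is the determinant of the adjoint composed with the map. -/
theorem continuous_normDet [FiniteDimensional ℝ F] :
    Continuous fun L : E →L[ℝ] F => (L : E →ₗ[ℝ] F).normDet := by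
  have : CompleteSpace E := FiniteDimensional.complete ℝ E
  have : CompleteSpace F := FiniteDimensional.complete ℝ F
  have h : (fun L : E →L[ℝ] F => (L : E →ₗ[ℝ] F).normDet) =
      fun L => Real.sqrt ((ContinuousLinearMap.adjoint L ∘L L).det) := by
    funext L
    have := L.normDet_sq
    simp only [RCLike.ofReal_real_eq_id, id] at this
    rw [← this, Real.sqrt_sq (LinearMap.normDet_nonneg _)]
  rw [h]
  refine Real.continuous_sqrt.comp (ContinuousLinearMap.continuous_det.comp ?_)
  exact (ContinuousLinearMap.adjoint.continuous.clm_comp continuous_id)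

variable [MeasurableSpace E] [BorelSpace E] 

/-- If `f` is approximated by the linear map `A` on `s`, then its derivative is close to `A` almost
everywhere on `s`. -/
theorem ApproximatesLinearOn.ae_norm_fderiv_sub_le (μ : Measure E) [μ.IsAddHaarMeasure]
    {f : E → F} {s : Set E} {A : E →L[ℝ] F} {δ : ℝ≥0}
    (hf : ApproximatesLinearOn f A s δ) (hs : MeasurableSet s) (f' : E → E →L[ℝ] F)
    (hf' : ∀ x ∈ s, HasFDerivWithinAt f (f' x) s x) : ∀ᵐ x ∂μ.restrict s, ‖f' x - A‖ ≤ δ := by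
  filter_upwards [Besicovitch.ae_tendsto_measure_inter_div μ s, ae_restrict_mem hs]
  intro x hx xs
  apply ContinuousLinearMap.opNorm_le_bound _ δ.2 fun z => ?_
  suffices H : ∀ ε, 0 < ε → ‖(f' x - A) z‖ ≤ (δ + ε) * (‖z‖ + ε) + ‖f' x - A‖ * ε by
    have :
      Tendsto (fun ε : ℝ => ((δ : ℝ) + ε) * (‖z‖ + ε) + ‖f' x - A‖ * ε) (𝓝[>] 0)
        (𝓝 ((δ + 0) * (‖z‖ + 0) + ‖f' x - A‖ * 0)) :=
      Tendsto.mono_left (Continuous.tendsto (by fun_prop) 0) nhdsWithin_le_nhds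
    simp only [add_zero, mul_zero] at this
    apply le_of_tendsto_of_tendsto tendsto_const_nhds this
    filter_upwards [self_mem_nhdsWithin]
    exact H
  intro ε εpos
  -- The derivative within `s` is seen only along `s`. At a density point there are points x + r • a
  -- of `s` with `a` arbitrarily close to any prescribed direction `z`.
  have B₁ : ∀ᶠ r in 𝓝[>] (0 : ℝ), (s ∩ ({x} + r • closedBall z ε)).Nonempty :=
    Measure.eventually_nonempty_inter_smul_of_density_one μ s x hx _ measurableSet_closedBall
      (measure_closedBall_pos μ z εpos).ne'
  obtain ⟨ρ, ρpos, hρ⟩ :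
    ∃ ρ > 0, ball x ρ ∩ s ⊆ {y : E | ‖f y - f x - (f' x) (y - x)‖ ≤ ε * ‖y - x‖} :=
    mem_nhdsWithin_iff.1 ((hf' x xs).isLittleO.def εpos)
  have B₂ : ∀ᶠ r in 𝓝[>] (0 : ℝ), {x} + r • closedBall z ε ⊆ ball x ρ := by
    apply nhdsWithin_le_nhds
    exact eventually_singleton_add_smul_subset isBounded_closedBall (ball_mem_nhds x ρpos)
  obtain ⟨r, ⟨y, ⟨ys, hy⟩⟩, rρ, rpos⟩ :
    ∃ r : ℝ,
      (s ∩ ({x} + r • closedBall z ε)).Nonempty ∧ {x} + r • closedBall z ε ⊆ ball x ρ ∧ 0 < r :=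
    (B₁.and (B₂.and self_mem_nhdsWithin)).exists
  obtain ⟨a, az, ya⟩ : ∃ a, a ∈ closedBall z ε ∧ y = x + r • a := by
    simp only [mem_smul_set, image_add_left, mem_preimage, singleton_add] at hy
    rcases hy with ⟨a, az, ha⟩
    exact ⟨a, az, by simp only [ha, add_neg_cancel_left]⟩
  have norm_a : ‖a‖ ≤ ‖z‖ + ε :=
    calc
      ‖a‖ = ‖z + (a - z)‖ := by simp only [add_sub_cancel]
      _ ≤ ‖z‖ + ‖a - z‖ := norm_add_le _ _
      _ ≤ ‖z‖ + ε := by grw [mem_closedBall_iff_norm.1 az]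
  have I : r * ‖(f' x - A) a‖ ≤ r * (δ + ε) * (‖z‖ + ε) :=
    calc
      r * ‖(f' x - A) a‖ = ‖(f' x - A) (r • a)‖ := by
        simp only [map_smul, norm_smul, Real.norm_eq_abs, abs_of_nonneg rpos.le]
      _ = ‖f y - f x - A (y - x) - (f y - f x - (f' x) (y - x))‖ := by
        simp only [ya, add_sub_cancel_left, sub_sub_sub_cancel_left, FunLike.coe_sub,
          Pi.sub_apply, map_smul, smul_sub]
      _ ≤ ‖f y - f x - A (y - x)‖ + ‖f y - f x - (f' x) (y - x)‖ := norm_sub_le _ _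
      _ ≤ δ * ‖y - x‖ + ε * ‖y - x‖ := (add_le_add (hf _ ys _ xs) (hρ ⟨rρ hy, ys⟩))
      _ = r * (δ + ε) * ‖a‖ := by
        simp only [ya, add_sub_cancel_left, norm_smul, Real.norm_eq_abs, abs_of_nonneg rpos.le]
        ring
      _ ≤ r * (δ + ε) * (‖z‖ + ε) := by gcongr
  calc
    ‖(f' x - A) z‖ = ‖(f' x - A) a + (f' x - A) (z - a)‖ := by
      congr 1
      simp only [map_sub]
      abel
    _ ≤ ‖(f' x - A) a‖ + ‖(f' x - A) (z - a)‖ := norm_add_le _ _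
    _ ≤ (δ + ε) * (‖z‖ + ε) + ‖f' x - A‖ * ‖z - a‖ := by
      apply add_le_add
      · rw [mul_assoc] at I; exact (mul_le_mul_iff_right₀ rpos).1 I
      · apply ContinuousLinearMap.le_opNorm
    _ ≤ (δ + ε) * (‖z‖ + ε) + ‖f' x - A‖ * ε := by
      rw [mem_closedBall_iff_norm'] at az
      gcongr

variable [FiniteDimensional ℝ F] [MeasurableSpace F] [BorelSpace F]

/-- The area formula on a set where `f` is close to an injective linear map. -/
theorem hausdorffMeasure_image_approx {f : E → F} {s : Set E} {f' : E → E →L[ℝ] F}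
    (hs : MeasurableSet s) (hf' : ∀ x ∈ s, HasFDerivWithinAt f (f' x) s x)
    {A : E →L[ℝ] F} {c η : ℝ≥0} (hη : η < 1) (hA : ∀ v, c * ‖v‖ ≤ ‖A v‖)
    (hf : ApproximatesLinearOn f A s (η * c)) :
    ((1 - η : ℝ≥0) : ℝ≥0∞) ^ finrank ℝ E *
        Measure.hausdorffMeasure (finrank ℝ E : ℝ) (f '' s) ≤
      ((1 + η : ℝ≥0) : ℝ≥0∞) ^ finrank ℝ E * ∫⁻ x in s,
        ENNReal.ofReal (f' x : E →ₗ[ℝ] F).normDet ∂(Measure.hausdorffMeasure (finrank ℝ E : ℝ)) ∧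
    ((1 - η : ℝ≥0) : ℝ≥0∞) ^ finrank ℝ E * ∫⁻ x in s,
        ENNReal.ofReal (f' x : E →ₗ[ℝ] F).normDet ∂(Measure.hausdorffMeasure (finrank ℝ E : ℝ)) ≤
      ((1 + η : ℝ≥0) : ℝ≥0∞) ^ finrank ℝ E *
        Measure.hausdorffMeasure (finrank ℝ E : ℝ) (f '' s) := by
  set m := finrank ℝ E
  set μ : Measure E := Measure.hausdorffMeasure (m : ℝ)
  have hη1 : ((1 - η : ℝ≥0) : ℝ) = 1 - η := by rw [NNReal.coe_sub hη.le]; rfl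
  have hη0 : (0 : ℝ) < 1 - η := by rw [← hη1]; exact_mod_cast tsub_pos_of_lt hη
  -- The lower bound on `A` turns the absolute error η c ‖z‖ into the relative error η ‖A z‖, so
  -- distances under `f` and under its derivatives differ from those under `A` by factors 1 ± η.
  have hAsub : ∀ v w : F, ∀ z : E, ‖v - w‖ ≤ η * c * ‖z‖ → ‖v - w‖ ≤ η * ‖A z‖ := fun v w z h => by
    refine h.trans ?_
    rw [mul_assoc]
    exact mul_le_mul_of_nonneg_left (hA z) η.2
  have himA : ∀ t : Set E, Measure.hausdorffMeasure (m : ℝ) (A '' t) =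
      ENNReal.ofReal (A : E →ₗ[ℝ] F).normDet * μ t := fun t =>
    (A : E →ₗ[ℝ] F).hausdorffMeasure_image t
  have hup : Measure.hausdorffMeasure (m : ℝ) (f '' s) ≤ ((1 + η : ℝ≥0) : ℝ≥0∞) ^ m *
      (ENNReal.ofReal (A : E →ₗ[ℝ] F).normDet * μ s) := by
    rw [← himA, ← ENNReal.rpow_natCast]
    refine hausdorffMeasure_image_le_of_dist_le (by positivity) fun x hx y hy => ?_
    rw [dist_eq_norm, dist_eq_norm, ← map_sub]
    have h1 := hAsub _ _ _ (hf x hx y hy)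
    have h2 := norm_le_norm_add_norm_sub' (f x - f y) (A (x - y))
    push_cast
    linarith
  have hlow : ((1 - η : ℝ≥0) : ℝ≥0∞) ^ m * (ENNReal.ofReal (A : E →ₗ[ℝ] F).normDet * μ s) ≤
      Measure.hausdorffMeasure (m : ℝ) (f '' s) := by
    rw [← himA]
    have h0 : Measure.hausdorffMeasure (m : ℝ) (A '' s) ≤
        (((1 - η)⁻¹ : ℝ≥0) : ℝ≥0∞) ^ (m : ℝ) * Measure.hausdorffMeasure (m : ℝ) (f '' s) := by
      refine hausdorffMeasure_image_le_of_dist_le (by positivity) fun x hx y hy => ?_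
      rw [dist_eq_norm, dist_eq_norm, ← map_sub]
      have h1 := hAsub _ _ _ (hf x hx y hy)
      have h2 := norm_le_norm_add_norm_sub' (A (x - y)) (f x - f y) 
      rw [norm_sub_rev (A (x - y))] at h2
      rw [NNReal.coe_inv, hη1, inv_mul_eq_div, le_div_iff₀ hη0]
      linarith
    rw [ENNReal.rpow_natCast] at h0
    have hne : (1 - η : ℝ≥0) ≠ 0 := (tsub_pos_of_lt hη).ne'
    calc _ ≤ ((1 - η : ℝ≥0) : ℝ≥0∞) ^ m * ((((1 - η)⁻¹ : ℝ≥0) : ℝ≥0∞) ^ m *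
          Measure.hausdorffMeasure (m : ℝ) (f '' s)) := by gcongr
      _ = _ := by
        rw [← mul_assoc, ← mul_pow, ← ENNReal.coe_mul, mul_inv_cancel₀ hne]
        simp
  have hae := ApproximatesLinearOn.ae_norm_fderiv_sub_le μ hf hs f' hf'
  have hint_le : ∫⁻ x in s, ENNReal.ofReal (f' x : E →ₗ[ℝ] F).normDet ∂μ ≤
      ((1 + η : ℝ≥0) : ℝ≥0∞) ^ m * (ENNReal.ofReal (A : E →ₗ[ℝ] F).normDet * μ s) := by
    have : ∀ᵐ x ∂μ.restrict s, ENNReal.ofReal (f' x : E →ₗ[ℝ] F).normDet ≤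
        ((1 + η : ℝ≥0) : ℝ≥0∞) ^ m * ENNReal.ofReal (A : E →ₗ[ℝ] F).normDet := by
      filter_upwards [hae] with x hx
      have h1 : (f' x : E →ₗ[ℝ] F).normDet ≤ ((1 + η : ℝ≥0) : ℝ) ^ m *
          (A : E →ₗ[ℝ] F).normDet := by
        refine normDet_le_of_norm_le fun v => ?_
        have h1 : ‖f' x v - A v‖ ≤ η * ‖A v‖ := hAsub _ _ v (((f' x - A).le_opNorm v).trans
          (mul_le_mul_of_nonneg_right (by exact_mod_cast hx) (norm_nonneg v)))
        have h2 := norm_le_norm_add_norm_sub' (f' x v) (A v)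
        push_cast
        linarith
      refine (ENNReal.ofReal_le_ofReal h1).trans_eq ?_
      rw [ENNReal.ofReal_mul (by positivity), ENNReal.ofReal_pow (NNReal.coe_nonneg _),
        ENNReal.ofReal_coe_nnreal]
    refine (lintegral_mono_ae this).trans_eq ?_
    rw [lintegral_const, Measure.restrict_apply_univ, mul_assoc]
  have hle_int : ((1 - η : ℝ≥0) : ℝ≥0∞) ^ m * (ENNReal.ofReal (A : E →ₗ[ℝ] F).normDet * μ s) ≤
      ∫⁻ x in s, ENNReal.ofReal (f' x : E →ₗ[ℝ] F).normDet ∂μ := by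
    have : ∀ᵐ x ∂μ.restrict s, ((1 - η : ℝ≥0) : ℝ≥0∞) ^ m *
        ENNReal.ofReal (A : E →ₗ[ℝ] F).normDet ≤ ENNReal.ofReal (f' x : E →ₗ[ℝ] F).normDet := by
      filter_upwards [hae] with x hx
      have h1 : (A : E →ₗ[ℝ] F).normDet ≤ (((1 - η)⁻¹ : ℝ≥0) : ℝ) ^ m *
          (f' x : E →ₗ[ℝ] F).normDet := by
        refine normDet_le_of_norm_le fun v => ?_
        have h1 : ‖f' x v - A v‖ ≤ η * ‖A v‖ := hAsub _ _ v (((f' x - A).le_opNorm v).trans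
          (mul_le_mul_of_nonneg_right (by exact_mod_cast hx) (norm_nonneg v)))
        have h2 := norm_le_norm_add_norm_sub' (A v) (f' x v)
        rw [norm_sub_rev (A v)] at h2
        rw [NNReal.coe_inv, hη1, inv_mul_eq_div, le_div_iff₀ hη0]
        linarith
      have h2 : ((1 - η : ℝ≥0) : ℝ) ^ m * (A : E →ₗ[ℝ] F).normDet ≤
          (f' x : E →ₗ[ℝ] F).normDet := by
        rw [NNReal.coe_inv, inv_pow, inv_mul_eq_div, le_div_iff₀ (pow_pos (by rwa [hη1]) _)] at h1
        linarith
      refine Eq.trans_le ?_ (ENNReal.ofReal_le_ofReal h2)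
      rw [ENNReal.ofReal_mul (by positivity), ENNReal.ofReal_pow (NNReal.coe_nonneg _),
        ENNReal.ofReal_coe_nnreal]
    refine Eq.trans_le ?_ (lintegral_mono_ae this)
    rw [lintegral_const, Measure.restrict_apply_univ, mul_assoc]
  -- Both sides have been squeezed between (1 - η)^m and (1 + η)^m times `normDet A` * μ(s).
  -- Eliminating this common value gives the two inequalities.
  constructor
  · calc _ ≤ ((1 - η : ℝ≥0) : ℝ≥0∞) ^ m * (((1 + η : ℝ≥0) : ℝ≥0∞) ^ m *
        (ENNReal.ofReal (A : E →ₗ[ℝ] F).normDet * μ s)) := by gcongr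
      _ = ((1 + η : ℝ≥0) : ℝ≥0∞) ^ m * (((1 - η : ℝ≥0) : ℝ≥0∞) ^ m *
        (ENNReal.ofReal (A : E →ₗ[ℝ] F).normDet * μ s)) := by rw [mul_left_comm]
      _ ≤ _ := by gcongr
  · calc _ ≤ ((1 - η : ℝ≥0) : ℝ≥0∞) ^ m * (((1 + η : ℝ≥0) : ℝ≥0∞) ^ m *
        (ENNReal.ofReal (A : E →ₗ[ℝ] F).normDet * μ s)) := by gcongr
      _ = ((1 + η : ℝ≥0) : ℝ≥0∞) ^ m * (((1 - η : ℝ≥0) : ℝ≥0∞) ^ m *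
        (ENNReal.ofReal (A : E →ₗ[ℝ] F).normDet * μ s)) := by rw [mul_left_comm]
      _ ≤ _ := by gcongr

/-- Letting η tend to 0 removes the distortion factors left by the approximation on small pieces. -/
theorem le_of_forall_pow_mul_le {a b : ℝ≥0∞} (m : ℕ)
    (h : ∀ η : ℝ≥0, 0 < η → η < 1 →
      ((1 - η : ℝ≥0) : ℝ≥0∞) ^ m * a ≤ ((1 + η : ℝ≥0) : ℝ≥0∞) ^ m * b) : a ≤ b := by
  have key : ∀ (u : ℝ≥0 → ℝ≥0) (x : ℝ≥0∞), Continuous u → u 0 = 1 →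
      Tendsto (fun η : ℝ≥0 => (u η : ℝ≥0∞) ^ m * x) (𝓝[>] 0) (𝓝 x) := fun u x hu h0 => by
    have h1 : Tendsto (fun η : ℝ≥0 => ((u η ^ m : ℝ≥0) : ℝ≥0∞)) (𝓝[>] 0) (𝓝 ((u 0 ^ m : ℝ≥0))) :=
      ENNReal.tendsto_coe.2 (((hu.pow m).tendsto 0).mono_left nhdsWithin_le_nhds)
    rw [h0, one_pow] at h1
    have h2 := ENNReal.Tendsto.mul_const (b := x) h1 (Or.inl (by simp))
    simpa using h2
  refine le_of_tendsto_of_tendsto (key (fun η => 1 - η) a (continuous_const.sub continuous_id)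
    (by simp)) (key (fun η => 1 + η) b (continuous_const.add continuous_id) (by simp)) ?_
  filter_upwards [Ioo_mem_nhdsGT (zero_lt_one' ℝ≥0)] with η hη
  exact h η hη.1 hη.2

/-- The area formula for an injective map with injective derivative. -/
theorem hausdorffMeasure_image_eq_lintegral_normDet {f : E → F} {s : Set E} {f' : E → E →L[ℝ] F}
    (hs : MeasurableSet s) (hinj : InjOn f s) (hf' : ∀ x ∈ s, HasFDerivWithinAt f (f' x) s x)
    (hf'inj : ∀ x ∈ s, Function.Injective (f' x)) :
    Measure.hausdorffMeasure (finrank ℝ E : ℝ) (f '' s) = ∫⁻ x in s,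
        ENNReal.ofReal (f' x : E →ₗ[ℝ] F).normDet ∂(Measure.hausdorffMeasure (finrank ℝ E : ℝ)) := by
  classical
  have : CompleteSpace E := FiniteDimensional.complete ℝ E
  -- The accuracy demanded of the partition is η times the lower bound of the approximating map.
  -- Noninjective maps get the dummy value 1; they do not occur, since each approximating map is a
  -- derivative at some point of `s`.
  have hexists : ∀ A : E →L[ℝ] F, ∃ c : ℝ≥0, c ≠ 0 ∧
      (Function.Injective A → ∀ v, c * ‖v‖ ≤ ‖A v‖) := fun A => by
    by_cases hA : Function.Injective A
    · obtain ⟨K, hK, hAK⟩ := (A : E →ₗ[ℝ] F).exists_antilipschitzWith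
        (LinearMap.ker_eq_bot.2 hA)
      refine ⟨K⁻¹, inv_ne_zero hK.ne', fun _ v => ?_⟩
      have h1 := hAK.le_mul_dist v 0
      rw [dist_zero_right, map_zero, dist_zero_right] at h1
      rw [NNReal.coe_inv, inv_mul_eq_div, div_le_iff₀' (by exact_mod_cast hK)]
      exact h1
    · exact ⟨1, one_ne_zero, fun h => absurd h hA⟩
  choose c hc0 hc using hexists
  have hpieces : ∀ η : ℝ≥0, 0 < η → η < 1 → ∃ t : ℕ → Set E,
      Pairwise (Function.onFun Disjoint t) ∧ (∀ n, MeasurableSet (t n)) ∧ s = ⋃ n, s ∩ t n ∧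
      ∀ n, ∃ A : E →L[ℝ] F, ((∀ v, c A * ‖v‖ ≤ ‖A v‖) ∨ s = ∅) ∧
        ApproximatesLinearOn f A (s ∩ t n) (η * c A) := fun η hη0 hη1 => by
    obtain ⟨t, A, tdisj, tmeas, tcover, ht, hA⟩ :=
      exists_partition_approximatesLinearOn_of_hasFDerivWithinAt f s f' hf' (fun A => η * c A)
        (fun A => mul_ne_zero hη0.ne' (hc0 A))
    refine ⟨t, tdisj, tmeas, ?_, fun n => ⟨A n, ?_, ht n⟩⟩
    · rw [← inter_iUnion, inter_eq_self_of_subset_left tcover]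
    · rcases s.eq_empty_or_nonempty with h | h
      · exact Or.inr h
      · obtain ⟨y, hy, hAy⟩ := hA h n
        exact Or.inl (hc _ (hAy ▸ hf'inj y hy))
  rcases s.eq_empty_or_nonempty with rfl | hne
  · simp
  have hcont : ContinuousOn f s := fun x hx => (hf' x hx).continuousWithinAt
  have hsum : ∀ t : ℕ → Set E, Pairwise (Function.onFun Disjoint t) →
      (∀ n, MeasurableSet (t n)) → s = ⋃ n, s ∩ t n →
      Measure.hausdorffMeasure (finrank ℝ E : ℝ) (f '' s) =
        ∑' n, Measure.hausdorffMeasure (finrank ℝ E : ℝ) (f '' (s ∩ t n)) ∧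
      ∫⁻ x in s, ENNReal.ofReal (f' x : E →ₗ[ℝ] F).normDet
          ∂(Measure.hausdorffMeasure (finrank ℝ E : ℝ)) =
        ∑' n, ∫⁻ x in s ∩ t n, ENNReal.ofReal (f' x : E →ₗ[ℝ] F).normDet
          ∂(Measure.hausdorffMeasure (finrank ℝ E : ℝ)) := fun t tdisj tmeas hst => by
    have hdisj : Pairwise (Function.onFun Disjoint fun n => s ∩ t n) := fun i j hij =>
      (tdisj hij).mono inter_subset_right inter_subset_right
    constructor
    · conv_lhs => rw [hst, image_iUnion]
      refine measure_iUnion (fun i j hij => ?_) fun n => ?_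
      · refine disjoint_left.2 ?_
        rintro _ ⟨x, hx, rfl⟩ ⟨y, hy, hxy⟩
        rw [hinj hy.1 hx.1 hxy] at hy
        exact disjoint_left.1 (hdisj hij) hx hy
      · exact (hs.inter (tmeas n)).image_of_continuousOn_injOn (hcont.mono inter_subset_left)
          (hinj.mono inter_subset_left)
    · conv_lhs => rw [hst]
      exact lintegral_iUnion (fun n => hs.inter (tmeas n)) hdisj _
  refine le_antisymm ?_ ?_ <;> refine le_of_forall_pow_mul_le (finrank ℝ E) fun η hη0 hη1 => ?_ <;>
  obtain ⟨t, tdisj, tmeas, hst, hA⟩ := hpieces η hη0 hη1 <;>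
  obtain ⟨h1, h2⟩ := hsum t tdisj tmeas hst <;>
  rw [h1, h2, ← ENNReal.tsum_mul_left, ← ENNReal.tsum_mul_left] <;>
  refine ENNReal.tsum_le_tsum fun n => ?_ <;>
  obtain ⟨A, hcA, happ⟩ := hA n <;>
  have happrox := hausdorffMeasure_image_approx (hs.inter (tmeas n))
    (fun x hx => (hf' x hx.1).mono inter_subset_left) hη1
    (hcA.resolve_right hne.ne_empty) happ
  exacts [happrox.1, happrox.2]

end AreaFormula

/-! ### The first variation of the area -/

section FirstVariation

open Module Metric
open scoped NNReal ENNReal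

variable {E F : Type*} [NormedAddCommGroup E] [InnerProductSpace ℝ E] [FiniteDimensional ℝ E]
  [NormedAddCommGroup F] [InnerProductSpace ℝ F] [FiniteDimensional ℝ F]

/-- A linear perturbation of an immersion with values in a hyperplane changes the Jacobian by the
determinant of an endomorphism, whose trace is the trace of the perturbation on the hyperplane. -/
theorem exists_normDet_add_smul_comp_eq {D : E →L[ℝ] F} {L : F →L[ℝ] F} {ν : F} {C : ℝ}
    (hfin : finrank ℝ F = finrank ℝ E + 1) (hν : ‖ν‖ = 1) (hD : Function.Injective D)
    (hDν : ∀ v, ⟪ν, D v⟫ = 0) (hLν : ∀ v, ⟪ν, L (D v)⟫ = 0) (hC : 0 ≤ C)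
    (hbound : ∀ v, ‖L (D v)‖ ≤ C * ‖D v‖) :
    ∃ M : E →L[ℝ] E, (∀ s : ℝ, ((D + s • (L ∘L D) : E →L[ℝ] F) : E →ₗ[ℝ] F).normDet =
        |(1 + s • M : E →L[ℝ] E).det| * (D : E →ₗ[ℝ] F).normDet) ∧
      LinearMap.trace ℝ E (M : E →ₗ[ℝ] E) = LinearMap.trace ℝ F (L : F →ₗ[ℝ] F) - ⟪ν, L ν⟫ ∧
      ‖M‖ ≤ C := by
  have : CompleteSpace E := FiniteDimensional.complete ℝ E
  have : CompleteSpace F := FiniteDimensional.complete ℝ F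
  have hν0 : ν ≠ 0 := fun h => by simp [h] at hν
  have hrank : finrank ℝ (ℝ ∙ ν)ᗮ = finrank ℝ E := by
    have h1 := Submodule.finrank_add_finrank_orthogonal (ℝ ∙ ν)
    rw [finrank_span_singleton hν0, hfin] at h1
    omega
  let e : E ≃ₗᵢ[ℝ] (ℝ ∙ ν)ᗮ := (stdOrthonormalBasis ℝ E).equiv
    (stdOrthonormalBasis ℝ (ℝ ∙ ν)ᗮ) (finCongr hrank.symm)
  -- A linear isometry of `E` onto the hyperplane orthogonal to ν; through it, maps with values in
  -- the hyperplane become endomorphisms of `E`.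
  let U : E →L[ℝ] F := ((ℝ ∙ ν)ᗮ.subtypeₗᵢ.comp e.toLinearIsometry).toContinuousLinearMap
  have hUnorm : ∀ v, ‖U v‖ = ‖v‖ := fun v => (((ℝ ∙ ν)ᗮ.subtypeₗᵢ.comp e.toLinearIsometry)).norm_map v
  have hUν : ∀ v, ⟪ν, U v⟫ = 0 := fun v =>
    Submodule.mem_orthogonal_singleton_iff_inner_right.1 (e v).2
  have hUsurj : ∀ w, ⟪ν, w⟫ = 0 → ∃ v, U v = w := fun w hw =>
    ⟨e.symm ⟨w, Submodule.mem_orthogonal_singleton_iff_inner_right.2 hw⟩, by simp [U]⟩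
  let U' : F →L[ℝ] E := ContinuousLinearMap.adjoint U
  have hU'U : ∀ v, U' (U v) = v := fun v => by
    refine ext_inner_right ℝ fun w => ?_
    rw [ContinuousLinearMap.adjoint_inner_left]
    exact (((ℝ ∙ ν)ᗮ.subtypeₗᵢ.comp e.toLinearIsometry)).inner_map_map v w
  have hUU' : ∀ w, ⟪ν, w⟫ = 0 → U (U' w) = w := fun w hw => by
    obtain ⟨v, rfl⟩ := hUsurj w hw
    rw [hU'U]
  have hU'norm : ∀ w, ⟪ν, w⟫ = 0 → ‖U' w‖ = ‖w‖ := fun w hw => by rw [← hUnorm, hUU' w hw]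
  have hU'ν : U' ν = 0 := by
    refine ext_inner_right ℝ fun w => ?_
    rw [ContinuousLinearMap.adjoint_inner_left, hUν, inner_zero_left]
  have hUU'proj : ∀ w, U (U' w) = w - ⟪ν, w⟫ • ν := fun w => by
    have h1 : ⟪ν, w - ⟪ν, w⟫ • ν⟫ = 0 := by
      rw [inner_sub_right, inner_smul_right, real_inner_self_eq_norm_sq, hν]; ring
    rw [← hUU' _ h1, map_sub, map_smul, hU'ν, smul_zero, sub_zero]
  -- The adjoint `U'` preserves norms on the hyperplane, so composing with it does not change
  -- `normDet`.
  have hnorm : ∀ X : E →L[ℝ] F, (∀ v, ⟪ν, X v⟫ = 0) →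
      (X : E →ₗ[ℝ] F).normDet = ((U' ∘L X : E →L[ℝ] E) : E →ₗ[ℝ] E).normDet := fun X hX => by
    refine le_antisymm ?_ ?_
    · have := normDet_le_of_norm_le (L₁ := U' ∘L X) (L₂ := X) (C := 1) fun v => by
        simp [hU'norm _ (hX v)]
      simpa using this
    · have := normDet_le_of_norm_le (L₂ := U' ∘L X) (L₁ := X) (C := 1) fun v => by
        simp [hU'norm _ (hX v)]
      simpa using this
  let M : E →L[ℝ] E := U' ∘L L ∘L U
  refine ⟨M, fun s => ?_, ?_, ?_⟩
  · have h1 : U' ∘L (D + s • (L ∘L D)) = (1 + s • M) ∘L (U' ∘L D) := by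
      ext v
      simp [M, hUU' _ (hDν v)]
    rw [hnorm (D + s • (L ∘L D)) fun v => by simp [inner_add_right, inner_smul_right, hDν, hLν],
      hnorm D hDν, h1, ContinuousLinearMap.toLinearMap_comp,
      LinearMap.normDet_comp_of_finrank_eq _ _ rfl,
      LinearMap.normDet_eq_abs_det (1 + s • M : E →L[ℝ] E).toLinearMap]
  -- `U ∘ U'` is the orthogonal projection off ν. Cyclicity of the trace turns the trace of `M` into
  -- that of `L` minus the rank-one map w ↦ ⟪ν, w⟫ L ν.
  · have h1 : LinearMap.trace ℝ E (M : E →ₗ[ℝ] E) =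
        LinearMap.trace ℝ F ((L ∘L (U ∘L U') : F →L[ℝ] F) : F →ₗ[ℝ] F) := by
      simp only [M, ContinuousLinearMap.toLinearMap_comp]
      rw [LinearMap.trace_comp_comm', LinearMap.comp_assoc]
    have h2 : ((L ∘L (U ∘L U') : F →L[ℝ] F) : F →ₗ[ℝ] F) =
        (L : F →ₗ[ℝ] F) - (InnerProductSpace.rankOne ℝ (L ν) ν : F →L[ℝ] F) := by
      ext w
      simp [hUU'proj]
    rw [h1, h2, map_sub, InnerProductSpace.trace_rankOne]
  · refine ContinuousLinearMap.opNorm_le_bound _ hC fun v => ?_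
    -- By equality of dimensions `D` is onto the hyperplane, so bounds assumed on its range hold on
    -- all of it.
    obtain ⟨u, hu⟩ : ∃ u, D u = U v := by
      have hinj : Function.Injective (U' ∘L D : E →L[ℝ] E) := fun a b hab => hD (by
        have := congrArg U hab
        simpa [hUU' _ (hDν _)] using this)
      obtain ⟨u, hu⟩ := (LinearMap.injective_iff_surjective (f := ((U' ∘L D : E →L[ℝ] E) : E →ₗ[ℝ] E))).1
        hinj v
      exact ⟨u, by rw [← hUU' _ (hDν u)]; exact congrArg U hu⟩
    have h1 : ‖M v‖ ≤ ‖L (U v)‖ := by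
      rw [← hUnorm (M v)]
      refine le_of_eq (congrArg norm ?_)
      change U (U' (L (U v))) = L (U v)
      rw [← hu, hUU' _ (hLν u)]
    calc ‖M v‖ ≤ ‖L (U v)‖ := h1
      _ ≤ C * ‖U v‖ := by rw [← hu]; exact hbound u
      _ = C * ‖v‖ := by rw [hUnorm]

theorem norm_fderiv_ge_of_dist_ge {f : E → F} {f' : E →L[ℝ] F} {x : E} {s : Set E} {c : ℝ}
    (hs : s ∈ 𝓝 x) (hf : HasFDerivAt f f' x)
    (hanti : ∀ y ∈ s, c * ‖y - x‖ ≤ ‖f y - f x‖) (v : E) : c * ‖v‖ ≤ ‖f' v‖ := by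
  have h1 : Tendsto (fun t : ℝ => ‖t⁻¹ • (f (x + t • v) - f x)‖) (𝓝[>] 0) (𝓝 ‖f' v‖) :=
    ((hf.hasLineDerivAt v).tendsto_slope_zero_right).norm
  refine ge_of_tendsto h1 ?_
  have h2 : Tendsto (fun t : ℝ => x + t • v) (𝓝[>] 0) (𝓝 x) := by
    have : Continuous fun t : ℝ => x + t • v := by fun_prop
    simpa using (this.tendsto 0).mono_left nhdsWithin_le_nhds
  filter_upwards [h2 hs, self_mem_nhdsWithin] with t ht ht0
  have ht0 : 0 < t := ht0
  have h3 := hanti _ ht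
  rw [norm_smul, norm_inv, Real.norm_of_nonneg ht0.le, inv_mul_eq_div, le_div_iff₀ ht0]
  rw [add_sub_cancel_left, norm_smul, Real.norm_of_nonneg ht0.le] at h3
  linarith

variable [MeasurableSpace E] [BorelSpace E] [MeasurableSpace F] [BorelSpace F]

/-- The area formula for a bi-Lipschitz map. -/
theorem LipschitzWith.hausdorffMeasure_image_eq_lintegral_normDet {f : E → F} {K : ℝ≥0} {c : ℝ}
    {s t : Set E} (hf : LipschitzWith K f) (hs : IsOpen s) (ht : MeasurableSet t) (hts : t ⊆ s)
    (hc : 0 < c) (hanti : ∀ x ∈ s, ∀ y ∈ s, c * ‖x - y‖ ≤ ‖f x - f y‖) :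
    Measure.hausdorffMeasure (finrank ℝ E : ℝ) (f '' t) = ∫⁻ x in t,
      ENNReal.ofReal (fderiv ℝ f x : E →ₗ[ℝ] F).normDet
        ∂(Measure.hausdorffMeasure (finrank ℝ E : ℝ)) := by
  have : CompleteSpace F := FiniteDimensional.complete ℝ F
  set μ : Measure E := Measure.hausdorffMeasure (finrank ℝ E : ℝ) with hμ
  set d : Set E := {x | DifferentiableAt ℝ f x}
  have hd : MeasurableSet d := measurableSet_of_differentiableAt ℝ f
  have hnull : μ dᶜ = 0 := hf.ae_differentiableAt (μ := μ)
  have h1 : Measure.hausdorffMeasure (finrank ℝ E : ℝ) (f '' (t ∩ d)) = ∫⁻ x in t ∩ d,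
      ENNReal.ofReal (fderiv ℝ f x : E →ₗ[ℝ] F).normDet ∂μ := by
    refine _root_.hausdorffMeasure_image_eq_lintegral_normDet (ht.inter hd) ?_ ?_ ?_
    · intro x hx y hy hxy
      have := hanti x (hts hx.1) y (hts hy.1)
      rw [hxy, sub_self, norm_zero] at this
      rw [← sub_eq_zero, ← norm_le_zero_iff]
      exact nonpos_of_mul_nonpos_right this hc
    · exact fun x hx => (show DifferentiableAt ℝ f x from hx.2).hasFDerivAt.hasFDerivWithinAt
    · intro x hx
      refine (injective_iff_map_eq_zero _).2 fun v hv => ?_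
      have := norm_fderiv_ge_of_dist_ge (hs.mem_nhds (hts hx.1))
        (show DifferentiableAt ℝ f x from hx.2).hasFDerivAt
        (fun y hy => hanti y hy x (hts hx.1)) v
      rw [hv, norm_zero] at this
      rw [← norm_le_zero_iff]
      exact nonpos_of_mul_nonpos_right this hc
  -- Rademacher: the points of nondifferentiability form a null set, and a Lipschitz map sends it to
  -- a null set, so it may be dropped on both sides.
  have h2 : Measure.hausdorffMeasure (finrank ℝ E : ℝ) (f '' (t \ d)) = 0 := by
    refine le_antisymm ((hf.hausdorffMeasure_image_le (by positivity) _).trans ?_) zero_le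
    rw [← hμ, measure_mono_null (sdiff_subset_compl _ _) hnull, mul_zero]
  have h3 : f '' t = f '' (t ∩ d) ∪ f '' (t \ d) := by
    rw [← image_union, inter_union_sdiff]
  have h4 : Measure.hausdorffMeasure (finrank ℝ E : ℝ) (f '' t) =
      Measure.hausdorffMeasure (finrank ℝ E : ℝ) (f '' (t ∩ d)) := by
    refine le_antisymm ?_ (measure_mono (image_mono inter_subset_left))
    rw [h3]
    exact (measure_union_le _ _).trans_eq (by rw [h2, add_zero])
  rw [h4, h1]
  refine setLIntegral_congr ?_
  filter_upwards [hf.ae_differentiableAt (μ := μ)] with x hx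
  exact propext ⟨fun h => h.1, fun h => ⟨h, hx⟩⟩

omit [MeasurableSpace E] [BorelSpace E] in
-- 1 + s M stretches lengths by at most 1 + s C, and `normDet` of an endomorphism is the absolute
-- value of its determinant. The lower bound below uses the same argument for the reverse
-- comparison.
theorem abs_det_one_add_smul_le {M : E →L[ℝ] E} {C s : ℝ} (hM : ‖M‖ ≤ C) (hs : 0 ≤ s) :
    |(1 + s • M : E →L[ℝ] E).det| ≤ (1 + s * C) ^ finrank ℝ E := by
  have hC : 0 ≤ C := (norm_nonneg _).trans hM
  have h := normDet_le_of_norm_le (L₁ := (1 : E →L[ℝ] E)) (L₂ := 1 + s • M)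
    (C := ⟨1 + s * C, by positivity⟩) fun v => by
      change ‖v + s • M v‖ ≤ (1 + s * C) * ‖v‖
      have h1 := M.le_of_opNorm_le hM v
      have h2 := norm_add_le v (s • M v)
      rw [norm_smul, Real.norm_of_nonneg hs] at h2
      nlinarith
  rw [LinearMap.normDet_eq_abs_det] at h
  have h1 : ((1 : E →L[ℝ] E) : E →ₗ[ℝ] E).normDet = 1 := LinearMap.normDet_id
  rw [h1, mul_one] at h
  exact h

omit [MeasurableSpace E] [BorelSpace E] in
theorem le_abs_det_one_add_smul {M : E →L[ℝ] E} {C s : ℝ} (hM : ‖M‖ ≤ C) (hs : 0 ≤ s)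
    (hsC : s * C < 1) : (1 - s * C) ^ finrank ℝ E ≤ |(1 + s • M : E →L[ℝ] E).det| := by
  have hpos : 0 < 1 - s * C := by linarith
  have h := normDet_le_of_norm_le (L₂ := (1 : E →L[ℝ] E)) (L₁ := 1 + s • M)
    (C := ⟨(1 - s * C)⁻¹, by positivity⟩) fun v => by
      change ‖v‖ ≤ (1 - s * C)⁻¹ * ‖v + s • M v‖
      have h1 := M.le_of_opNorm_le hM v
      have h2 := norm_sub_norm_le v (-(s • M v))
      rw [sub_neg_eq_add, norm_neg, norm_smul, Real.norm_of_nonneg hs] at h2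
      rw [inv_mul_eq_div, le_div_iff₀ hpos]
      nlinarith
  rw [LinearMap.normDet_eq_abs_det (1 + s • M : E →L[ℝ] E).toLinearMap] at h
  have h1 : ((1 : E →L[ℝ] E) : E →ₗ[ℝ] E).normDet = 1 := LinearMap.normDet_id
  rw [h1] at h
  change 1 ≤ ((1 - s * C)⁻¹) ^ finrank ℝ E * _ at h
  rw [inv_pow, inv_mul_eq_div, le_div_iff₀ (pow_pos hpos _), one_mul] at h
  exact h

/-- On [0, 1] the convex function s ↦ (1 + s C)^m lies below its chord. -/
theorem one_add_mul_pow_le {C s : ℝ} (hC : 0 ≤ C) (hs : 0 ≤ s) (hs1 : s ≤ 1) (m : ℕ) :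
    (1 + s * C) ^ m ≤ 1 + s * ((1 + C) ^ m - 1) := by
  induction m with
  | zero => simp
  | succ m ih =>
    have h1 : 1 ≤ (1 + C) ^ m := one_le_pow₀ (by linarith)
    rw [pow_succ, pow_succ]
    have h2 : (1 + s * C) ^ m * (1 + s * C) ≤ (1 + s * ((1 + C) ^ m - 1)) * (1 + s * C) :=
      mul_le_mul_of_nonneg_right ih (by positivity)
    have h3 : 0 ≤ s * (1 - s) * (((1 + C) ^ m - 1) * C) :=
      mul_nonneg (mul_nonneg hs (by linarith)) (mul_nonneg (by linarith) hC)
    nlinarith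

omit [MeasurableSpace E] [BorelSpace E] in
-- The chord bound above and Bernoulli's inequality below make the error linear in s, with a
-- constant depending only on `C` and the dimension. It serves as the majorant for dominated
-- convergence.
theorem abs_abs_det_one_add_smul_sub_one_le {M : E →L[ℝ] E} {C s : ℝ} (hM : ‖M‖ ≤ C)
    (hs : 0 ≤ s) (hs1 : s ≤ 1) (hsC : s * C < 1) :
    |(|(1 + s • M : E →L[ℝ] E).det| - 1)| ≤ s * ((1 + C) ^ finrank ℝ E - 1 + finrank ℝ E * C) := by
  have hC : 0 ≤ C := (norm_nonneg _).trans hM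
  have h1 := abs_det_one_add_smul_le hM hs
  have h2 := le_abs_det_one_add_smul hM hs hsC
  have h3 := one_add_mul_pow_le hC hs hs1 (finrank ℝ E)
  have h4 := one_add_mul_le_pow (a := -(s * C)) (by linarith) (finrank ℝ E)
  have h5 : 1 ≤ (1 + C) ^ finrank ℝ E := one_le_pow₀ (by linarith)
  rw [← sub_eq_add_neg] at h4
  have h6 : 0 ≤ s * ((1 + C) ^ finrank ℝ E - 1) := mul_nonneg hs (by linarith)
  have h7 : 0 ≤ s * (finrank ℝ E * C) := by positivity
  rw [abs_le]
  constructor <;> nlinarith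

omit [MeasurableSpace E] [BorelSpace E] in
-- The determinant is 1 + s tr M + O(s²), and it is positive for small s, so the absolute value can
-- be dropped.
theorem tendsto_abs_det_one_add_smul (M : E →L[ℝ] E) :
    Tendsto (fun s : ℝ => (|(1 + s • M : E →L[ℝ] E).det| - 1) / s) (𝓝[>] 0)
      (𝓝 (LinearMap.trace ℝ E (M : E →ₗ[ℝ] E))) := by
  let b := Module.finBasis ℝ E
  let N := LinearMap.toMatrix b b (M : E →ₗ[ℝ] E)
  have hdet : ∀ s : ℝ, (1 + s • M : E →L[ℝ] E).det = (1 + s • N).det := fun s => by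
    have h : (1 + s • N) = LinearMap.toMatrix b b ((1 + s • M : E →L[ℝ] E) : E →ₗ[ℝ] E) := by
      have h1 : ((1 + s • M : E →L[ℝ] E) : E →ₗ[ℝ] E) = LinearMap.id + s • (M : E →ₗ[ℝ] E) := rfl
      rw [h1, map_add, map_smul, LinearMap.toMatrix_id]
    rw [h, LinearMap.det_toMatrix]
  have htr : LinearMap.trace ℝ E (M : E →ₗ[ℝ] E) = N.trace := LinearMap.trace_eq_matrix_trace ℝ b _
  have hcont : Continuous fun s : ℝ => (1 + s • M : E →L[ℝ] E).det :=
    ContinuousLinearMap.continuous_det.comp (by fun_prop)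
  have hpos : ∀ᶠ s : ℝ in 𝓝[>] 0, 0 < (1 + s • M : E →L[ℝ] E).det := by
    refine (hcont.tendsto 0).mono_left nhdsWithin_le_nhds (Ioi_mem_nhds ?_)
    rw [zero_smul, add_zero]
    change 0 < LinearMap.det ((1 : E →L[ℝ] E) : E →ₗ[ℝ] E)
    rw [ContinuousLinearMap.toLinearMap_one, map_one]
    norm_num
  obtain ⟨p, hp⟩ : ∃ p : Polynomial ℝ, ∀ s : ℝ, (1 + s • N).det = 1 + N.trace * s + p.eval s * s ^ 2 :=
    ⟨_, fun s => Matrix.det_one_add_smul s N⟩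
  have hlim : Tendsto (fun s : ℝ => N.trace + p.eval s * s) (𝓝[>] 0) (𝓝 N.trace) := by
    have h1 : Continuous fun s : ℝ => N.trace + p.eval s * s := by fun_prop
    simpa using (h1.tendsto 0).mono_left nhdsWithin_le_nhds
  rw [htr]
  refine hlim.congr' ?_
  filter_upwards [hpos, self_mem_nhdsWithin] with s hs hs0
  have hs0 : s ≠ 0 := (show 0 < s from hs0).ne'
  rw [abs_of_pos hs, hdet, hp]
  field_simp
  ring

/-- The derivative of the area at a family of linear perturbations. -/
theorem tendsto_integral_abs_det_one_add_smul {α : Type*} [MeasurableSpace α] {ω : Measure α}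
    [IsFiniteMeasure ω] {M : α → E →L[ℝ] E} {C s₀ : ℝ} (hs₀ : 0 < s₀) (hM : ∀ᵐ y ∂ω, ‖M y‖ ≤ C)
    (hmeas : ∀ s ∈ Ioo 0 s₀, AEMeasurable (fun y => |(1 + s • M y : E →L[ℝ] E).det|) ω) :
    Tendsto (fun s : ℝ => ∫ y, (|(1 + s • M y : E →L[ℝ] E).det| - 1) / s ∂ω) (𝓝[>] 0)
      (𝓝 (∫ y, LinearMap.trace ℝ E (M y : E →ₗ[ℝ] E) ∂ω)) := by
  -- Below this bound s < 1 and s C < 1, as the determinant estimate requires. The absolute value is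
  -- there because `C` may be negative when ω = 0.
  have hs1 : 0 < min (min s₀ 1) (|C| + 1)⁻¹ := by positivity
  refine tendsto_integral_filter_of_dominated_convergence
    (fun _ => (1 + C) ^ finrank ℝ E - 1 + finrank ℝ E * C) ?_ ?_ (integrable_const _) ?_
  · filter_upwards [Ioo_mem_nhdsGT hs₀] with s hs
    exact (((hmeas s hs).sub_const _).div_const _).aestronglyMeasurable
  · filter_upwards [Ioo_mem_nhdsGT hs1] with s hs
    filter_upwards [hM] with y hy
    have hs2 : s < s₀ ∧ s < 1 ∧ s < (|C| + 1)⁻¹ := by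
      have := hs.2
      simp only [lt_min_iff] at this
      exact ⟨this.1.1, this.1.2, this.2⟩
    have hsC : s * C < 1 := by
      have h1 : s * (|C| + 1) < 1 := by
        have := mul_lt_mul_of_pos_right hs2.2.2 (show 0 < |C| + 1 by positivity)
        rwa [inv_mul_cancel₀ (by positivity)] at this
      nlinarith [le_abs_self C, hs.1]
    have := abs_abs_det_one_add_smul_sub_one_le hy hs.1.le hs2.2.1.le hsC
    rw [Real.norm_eq_abs, abs_div, abs_of_pos hs.1, div_le_iff₀ hs.1]
    linarith
  · exact ae_of_all _ fun y => tendsto_abs_det_one_add_smul (M y)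

end FirstVariation

/-! ### Norms and their gradients -/

section Gauge

open scoped NNReal

variable {E : Type*} [NormedAddCommGroup E] [InnerProductSpace ℝ E]

/-- A function with the properties of a norm. -/
structure IsGauge (ρ : E → ℝ) : Prop where
  add_le : ∀ x y, ρ (x + y) ≤ ρ x + ρ y
  smul : ∀ (c : ℝ) (x : E), ρ (c • x) = |c| * ρ x
  pos : ∀ x, x ≠ 0 → 0 < ρ x

namespace IsGauge

variable {ρ : E → ℝ} (hρ : IsGauge ρ)
include hρ

theorem map_zero : ρ 0 = 0 := by simpa using hρ.smul 0 0

theorem nonneg (x : E) : 0 ≤ ρ x := by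
  rcases eq_or_ne x 0 with rfl | hx
  · exact hρ.map_zero.ge
  · exact (hρ.pos x hx).le

theorem smul_of_nonneg {c : ℝ} (hc : 0 ≤ c) (x : E) : ρ (c • x) = c * ρ x := by
  rw [hρ.smul, abs_of_nonneg hc]

theorem map_neg (x : E) : ρ (-x) = ρ x := by simpa using hρ.smul (-1) x

theorem ne_zero_of_pos {x : E} (hx : 0 < ρ x) : x ≠ 0 := by
  rintro rfl
  exact hx.ne' hρ.map_zero

theorem abs_sub_le (x y : E) : |ρ x - ρ y| ≤ ρ (x - y) := by
  have h1 := hρ.add_le (x - y) y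
  have h2 := hρ.add_le (y - x) x
  rw [sub_add_cancel] at h1 h2
  rw [← neg_sub x y, hρ.map_neg] at h2
  rw [abs_le]
  constructor <;> linarith

/-- Euler's identity: along the ray through x the difference quotient is constant. -/
theorem inner_gradient_self {x : E} [CompleteSpace E] (hx : DifferentiableAt ℝ ρ x) :
    ⟪gradient ρ x, x⟫ = ρ x := by
  have h1 := (hx.hasFDerivAt.hasLineDerivAt x).tendsto_slope_zero_right
  rw [inner_gradient_left]
  refine tendsto_nhds_unique h1 (tendsto_const_nhds.congr' ?_)
  filter_upwards [self_mem_nhdsWithin] with t ht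
  have ht : 0 < t := ht
  have h2 : x + t • x = (1 + t) • x := by rw [add_smul, one_smul]
  rw [h2, hρ.smul_of_nonneg (by positivity), smul_eq_mul]
  field_simp
  ring

/-- Subadditivity bounds every forward difference quotient in direction `y` by ρ(y). -/
theorem inner_gradient_le {x : E} [CompleteSpace E] (hx : DifferentiableAt ℝ ρ x) (y : E) :
    ⟪gradient ρ x, y⟫ ≤ ρ y := by
  have h1 := (hx.hasFDerivAt.hasLineDerivAt y).tendsto_slope_zero_right
  rw [inner_gradient_left]
  refine le_of_tendsto h1 ?_
  filter_upwards [self_mem_nhdsWithin] with t ht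
  have ht : 0 < t := ht
  have h2 := hρ.add_le x (t • y)
  rw [hρ.smul_of_nonneg ht.le] at h2
  rw [smul_eq_mul, inv_mul_eq_div, div_le_iff₀ ht]
  linarith

theorem gradient_ne_zero {x : E} [CompleteSpace E] (hx : DifferentiableAt ℝ ρ x) (h0 : x ≠ 0) :
    gradient ρ x ≠ 0 := fun h => by
  have := hρ.inner_gradient_self hx
  rw [h, inner_zero_left] at this
  exact (hρ.pos x h0).ne this

/-- A subgradient at a point of differentiability is the gradient. -/
theorem eq_gradient {x p : E} [CompleteSpace E] (hx : DifferentiableAt ℝ ρ x)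
    (h1 : ⟪p, x⟫ = ρ x) (h2 : ∀ y, ⟪p, y⟫ ≤ ρ y) : p = gradient ρ x := by
  have hmin : IsLocalMin (fun y => ρ y - innerSL ℝ p y) x := by
    refine Eventually.of_forall fun y => ?_
    have := h2 y
    simp only [innerSL_apply_apply]
    linarith
  have h3 := hmin.hasFDerivAt_eq_zero (hx.hasFDerivAt.sub (innerSL ℝ p).hasFDerivAt)
  refine ext_inner_right ℝ fun y => ?_
  rw [inner_gradient_left]
  have := congrArg (fun L : E →L[ℝ] ℝ => L y) h3
  simp only [sub_apply, innerSL_apply_apply,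
    zero_apply] at this
  linarith

theorem differentiableAt_smul {x : E} {c : ℝ} (hc : 0 < c) (hx : DifferentiableAt ℝ ρ x) :
    DifferentiableAt ℝ ρ (c • x) := by
  have h : ρ = fun y => c * ρ (c⁻¹ • y) := by
    funext y
    rw [hρ.smul_of_nonneg (by positivity), mul_inv_cancel_left₀ hc.ne']
  rw [h]
  refine (DifferentiableAt.comp (c • x) (g := ρ) (f := fun y => c⁻¹ • y) ?_ (by fun_prop)).const_mul _
  rwa [inv_smul_smul₀ hc.ne']

/-- By homogeneity the gradient at x is also a subgradient at c • x, hence equal to the gradient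
there. -/
theorem gradient_smul {x : E} [CompleteSpace E] {c : ℝ} (hc : 0 < c)
    (hx : DifferentiableAt ℝ ρ x) : gradient ρ (c • x) = gradient ρ x := by
  refine (hρ.eq_gradient (hρ.differentiableAt_smul hc hx) ?_ (hρ.inner_gradient_le hx)).symm
  rw [inner_smul_right, hρ.inner_gradient_self hx, hρ.smul_of_nonneg hc.le]

variable [FiniteDimensional ℝ E]

theorem exists_le_mul_norm : ∃ C : ℝ≥0, 0 < C ∧ ∀ x, ρ x ≤ C * ‖x‖ := by
  let b := stdOrthonormalBasis ℝ E
  have hnn : 0 ≤ ∑ i, ρ (b i) := Finset.sum_nonneg fun i _ => hρ.nonneg _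
  refine ⟨⟨∑ i, ρ (b i) + 1, by positivity⟩, ?_, fun x => ?_⟩
  · change (0 : ℝ) < ∑ i, ρ (b i) + 1
    positivity
  · have hsum : ∀ s : Finset (Fin (Module.finrank ℝ E)),
        ρ (∑ i ∈ s, ⟪b i, x⟫ • b i) ≤ ∑ i ∈ s, ‖x‖ * ρ (b i) := fun s => by
      classical
      induction s using Finset.induction_on with
      | empty => simp [hρ.map_zero]
      | insert i s hi ih =>
        rw [Finset.sum_insert hi, Finset.sum_insert hi]
        refine (hρ.add_le _ _).trans (add_le_add ?_ ih)
        rw [hρ.smul]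
        refine mul_le_mul_of_nonneg_right ?_ (hρ.nonneg _)
        have := abs_real_inner_le_norm (b i) x
        rwa [b.norm_eq_one, one_mul] at this
    have h1 := hsum Finset.univ
    rw [b.sum_repr' x, ← Finset.mul_sum] at h1
    change ρ x ≤ (∑ i, ρ (b i) + 1) * ‖x‖
    nlinarith [norm_nonneg x]

theorem exists_lipschitzWith : ∃ C : ℝ≥0, LipschitzWith C ρ := by
  obtain ⟨C, -, hC⟩ := hρ.exists_le_mul_norm
  refine ⟨C, LipschitzWith.of_dist_le_mul fun x y => ?_⟩
  rw [Real.dist_eq, dist_eq_norm]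
  exact (hρ.abs_sub_le x y).trans (hC _)

theorem continuous : Continuous ρ := hρ.exists_lipschitzWith.choose_spec.continuous

theorem exists_norm_le_mul : ∃ C : ℝ≥0, 0 < C ∧ ∀ x, ‖x‖ ≤ C * ρ x := by
  rcases subsingleton_or_nontrivial E with h | h
  · exact ⟨1, one_pos, fun x => by simp [Subsingleton.elim x 0, hρ.map_zero]⟩
  obtain ⟨x₀, hx₀, hmin⟩ := (isCompact_sphere (0 : E) 1).exists_isMinOn
    (NormedSpace.sphere_nonempty.2 zero_le_one) hρ.continuous.continuousOn
  have hpos : 0 < ρ x₀ := hρ.pos x₀ (ne_zero_of_mem_unit_sphere ⟨x₀, hx₀⟩)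
  refine ⟨⟨(ρ x₀)⁻¹, by positivity⟩, inv_pos.2 hpos, fun x => ?_⟩
  change ‖x‖ ≤ (ρ x₀)⁻¹ * ρ x
  rcases eq_or_ne x 0 with rfl | hx
  · simp [hρ.map_zero]
  have hxn : 0 < ‖x‖ := norm_pos_iff.2 hx
  have h1 : ρ x₀ ≤ ρ (‖x‖⁻¹ • x) := hmin (by simp [norm_smul, hxn.ne'])
  rw [hρ.smul_of_nonneg (by positivity), inv_mul_eq_div, le_div_iff₀ hxn] at h1
  rw [inv_mul_eq_div, le_div_iff₀ hpos]
  linarith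

theorem ae_differentiableAt [MeasurableSpace E] [BorelSpace E] (μ : Measure E)
    [μ.IsAddHaarMeasure] : ∀ᵐ x ∂μ, DifferentiableAt ℝ ρ x :=
  hρ.exists_lipschitzWith.choose_spec.ae_differentiableAt

end IsGauge

end Gauge

/-! ### Duality between an even anisotropy and its polar. -/

section Polar

variable {E : Type*} [NormedAddCommGroup E] [InnerProductSpace ℝ E]

theorem IsAnisotropy.isGauge {τ : E → ℝ} (hτ : IsAnisotropy τ) (heven : ∀ p, τ (-p) = τ p) :
    IsGauge τ where
  add_le x y := by
    have h0 := hτ.convex.2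
    have h1 := h0 (mem_univ x) (mem_univ y) (show (0 : ℝ) ≤ 1 / 2 by norm_num)
      (show (0 : ℝ) ≤ 1 / 2 by norm_num) (by norm_num)
    rw [← smul_add, hτ.homogeneous _ _ (by norm_num), smul_eq_mul, smul_eq_mul] at h1
    linarith
  smul c x := by
    rcases le_total 0 c with hc | hc
    · rw [hτ.homogeneous c x hc, abs_of_nonneg hc]
    · rw [← heven, ← neg_smul, hτ.homogeneous _ x (neg_nonneg.2 hc), abs_of_nonpos hc]
  pos := hτ.pos

namespace IsGauge

variable {τ : E → ℝ} (hτ : IsGauge τ) [FiniteDimensional ℝ E]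
include hτ

theorem isCompact_setOf_le_one : IsCompact {p : E | τ p ≤ 1} := by
  obtain ⟨C, -, hC⟩ := hτ.exists_norm_le_mul
  refine (isCompact_closedBall (0 : E) C).of_isClosed_subset
    (isClosed_le hτ.continuous continuous_const) fun p hp => ?_
  rw [mem_closedBall_zero_iff]
  have hp : τ p ≤ 1 := hp
  nlinarith [hC p, C.2]

theorem bddAbove_image_inner (x : E) :
    BddAbove ((fun p : E => ⟪x, p⟫) '' {p : E | τ p ≤ 1}) :=
  (hτ.isCompact_setOf_le_one.image (by fun_prop)).bddAbove

theorem inner_le_polar_mul (x p : E) : ⟪x, p⟫ ≤ polar τ x * τ p := by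
  rcases eq_or_ne p 0 with rfl | hp
  · simp [hτ.map_zero]
  have hpos := hτ.pos p hp
  have h1 : ⟪x, (τ p)⁻¹ • p⟫ ≤ polar τ x := le_csSup (hτ.bddAbove_image_inner x)
    ⟨_, by simp [hτ.smul_of_nonneg (inv_nonneg.2 hpos.le), hpos.ne'], rfl⟩
  rw [inner_smul_right, inv_mul_eq_div, div_le_iff₀ hpos] at h1
  exact h1

theorem exists_inner_eq_polar (x : E) : ∃ p, τ p ≤ 1 ∧ ⟪x, p⟫ = polar τ x := by
  obtain ⟨p, hp, h⟩ := hτ.isCompact_setOf_le_one.exists_sSup_image_eq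
    ⟨0, by simp [hτ.map_zero]⟩ (f := fun p : E => ⟪x, p⟫) (by fun_prop)
  exact ⟨p, hp, h.symm⟩

theorem polar_le {x : E} {C : ℝ} (h : ∀ p, ⟪x, p⟫ ≤ C * τ p) (hC : 0 ≤ C) : polar τ x ≤ C := by
  obtain ⟨p, hp, hx⟩ := hτ.exists_inner_eq_polar x
  rw [← hx]
  nlinarith [h p]

theorem isGauge_polar : IsGauge (polar τ) where
  add_le x y := by
    obtain ⟨p, hp, h⟩ := hτ.exists_inner_eq_polar (x + y)
    rw [← h, inner_add_left]
    exact add_le_add (le_csSup (hτ.bddAbove_image_inner x) ⟨p, hp, rfl⟩)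
      (le_csSup (hτ.bddAbove_image_inner y) ⟨p, hp, rfl⟩)
  smul c x := by
    have hneg : ∀ y, polar τ (-y) ≤ polar τ y := fun y => by
      obtain ⟨p, hp, h⟩ := hτ.exists_inner_eq_polar (-y)
      rw [← h, inner_neg_left, ← inner_neg_right]
      exact le_csSup (hτ.bddAbove_image_inner y) ⟨-p, by simpa [hτ.map_neg] using hp, rfl⟩
    have hle : ∀ (c : ℝ) (y : E), 0 ≤ c → polar τ (c • y) ≤ c * polar τ y := fun c y hc => by
      obtain ⟨p, hp, h⟩ := hτ.exists_inner_eq_polar (c • y)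
      rw [← h, real_inner_smul_left]
      exact mul_le_mul_of_nonneg_left
        (le_csSup (hτ.bddAbove_image_inner y) ⟨p, hp, rfl⟩) hc
    have heq : ∀ (c : ℝ) (y : E), 0 < c → polar τ (c • y) = c * polar τ y := fun c y hc => by
      refine le_antisymm (hle c y hc.le) ?_
      have h1 := hle c⁻¹ (c • y) (by positivity)
      rw [inv_smul_smul₀ hc.ne', inv_mul_eq_div, le_div_iff₀ hc] at h1
      linarith
    have hzero : polar τ (0 : E) = 0 := by
      obtain ⟨p, hp, h⟩ := hτ.exists_inner_eq_polar 0
      rw [← h, inner_zero_left]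
    have hnegeq : ∀ y, polar τ (-y) = polar τ y := fun y =>
      le_antisymm (hneg y) (by simpa using hneg (-y))
    rcases lt_trichotomy c 0 with hc | rfl | hc
    · rw [← hnegeq, ← neg_smul, heq _ x (neg_pos.2 hc), abs_of_neg hc]
    · simp [hzero]
    · rw [heq c x hc, abs_of_pos hc]
  pos x hx := by
    have h1 := hτ.inner_le_polar_mul x x
    have h2 : 0 < ⟪x, x⟫ := real_inner_self_pos.2 hx
    have h3 := hτ.pos x hx
    by_contra! h
    nlinarith

/-- A maximizer in the supremum defining the polar at x is a subgradient of the polar at x, so it is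
the gradient. As the supremum is positive, it is attained where τ = 1. This is the identity that
makes the mobility cancel the length of the gradient. -/
theorem apply_gradient_polar {x : E} (hx : DifferentiableAt ℝ (polar τ) x)
    (h0 : x ≠ 0) [CompleteSpace E] : τ (gradient (polar τ) x) = 1 := by
  have hρ := hτ.isGauge_polar
  obtain ⟨p, hp, h⟩ := hτ.exists_inner_eq_polar x
  have hpg : p = gradient (polar τ) x := by
    refine hρ.eq_gradient hx (by rw [real_inner_comm, h]) fun y => ?_
    rw [real_inner_comm]
    refine (hτ.inner_le_polar_mul y p).trans ?_
    nlinarith [hρ.nonneg y]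
  rw [← hpg]
  refine le_antisymm hp ?_
  have h1 := hτ.inner_le_polar_mul x p
  rw [h] at h1
  have := hρ.pos x h0
  by_contra! h2
  nlinarith

end IsGauge

end Polar

/-! ### The lateral surface of a cylinder -/

section Lateral

open Module
open scoped NNReal ENNReal

theorem lipschitzWith_of_norm_sub_le {X Y : Type*} [SeminormedAddCommGroup X]
    [SeminormedAddCommGroup Y] {f : X → Y} {C : ℝ} (h : ∀ x y, ‖f x - f y‖ ≤ C * ‖x - y‖) :
    ∃ K : ℝ≥0, LipschitzWith K f :=
  ⟨C.toNNReal, LipschitzWith.of_dist_le_mul fun x y => by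
    rw [dist_eq_norm, dist_eq_norm]
    exact (h x y).trans (mul_le_mul_of_nonneg_right (Real.le_coe_toNNReal C) (norm_nonneg _))⟩

variable {E : Type*} [NormedAddCommGroup E] [InnerProductSpace ℝ E]

theorem norm_toLp_le (a : E) (b : ℝ) : ‖WithLp.toLp 2 (a, b)‖ ≤ ‖a‖ + |b| := by
  have h : WithLp.toLp 2 (a, b) = WithLp.toLp 2 (a, 0) + WithLp.toLp 2 (0, b) := by
    rw [← WithLp.toLp_add]
    simp
  rw [h]
  refine (norm_add_le _ _).trans_eq ?_
  rw [WithLp.norm_toLp_fst, WithLp.norm_toLp_snd, Real.norm_eq_abs]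

theorem withLp_ext {x y : WithLp 2 (E × ℝ)} (h1 : x.fst = y.fst) (h2 : x.snd = y.snd) :
    x = y := by
  apply WithLp.ofLp_injective
  exact Prod.ext h1 h2

theorem norm_fst_le_norm (x : WithLp 2 (E × ℝ)) : ‖x.fst‖ ≤ ‖x‖ := WithLp.norm_fst_le E x

theorem abs_snd_le_norm (x : WithLp 2 (E × ℝ)) : |x.snd| ≤ ‖x‖ := WithLp.norm_snd_le E x

theorem LipschitzWith.toLp_prod {X : Type*} [SeminormedAddCommGroup X] {f : X → E} {g : X → ℝ}
    {K₁ K₂ : ℝ≥0} (hf : LipschitzWith K₁ f) (hg : LipschitzWith K₂ g) :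
    LipschitzWith (K₁ + K₂) fun x => (WithLp.toLp 2 (f x, g x) : WithLp 2 (E × ℝ)) := by
  refine LipschitzWith.of_dist_le_mul fun x y => ?_
  rw [dist_eq_norm, ← WithLp.toLp_sub, Prod.mk_sub_mk]
  refine (norm_toLp_le _ _).trans ?_
  have h1 := hf.dist_le_mul x y
  have h2 := hg.dist_le_mul x y
  rw [dist_eq_norm] at h1
  rw [Real.dist_eq] at h2
  push_cast
  linarith

variable {ρ : E → ℝ} (hρ : IsGauge ρ) [FiniteDimensional ℝ E]
include hρ

namespace IsGauge

/-- The maximum with δ removes the singularity of the radial projection y ↦ y / ρ(y) at the origin,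
which makes the map globally Lipschitz. -/
theorem exists_lipschitzWith_radial {δ : ℝ} (hδ : 0 < δ) :
    ∃ K : ℝ≥0, LipschitzWith K fun y : E => (max (ρ y) δ)⁻¹ • y := by
  obtain ⟨C₁, -, hC₁⟩ := hρ.exists_le_mul_norm
  obtain ⟨C₂, -, hC₂⟩ := hρ.exists_norm_le_mul
  refine lipschitzWith_of_norm_sub_le (C := δ⁻¹ * (1 + C₁ * C₂)) fun x y => ?_
  set a := max (ρ x) δ
  set b := max (ρ y) δ
  have ha : δ ≤ a := le_max_right _ _
  have hb : ρ y ≤ b := le_max_left _ _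
  have hb0 : 0 < b := hδ.trans_le (le_max_right _ _)
  have ha0 : 0 < a := hδ.trans_le ha
  have hab : |b - a| ≤ C₁ * ‖x - y‖ := by
    rw [abs_sub_comm]
    exact (abs_max_sub_max_le_abs _ _ _).trans ((hρ.abs_sub_le x y).trans (hC₁ _))
  have h1 : a⁻¹ • x - b⁻¹ • y = a⁻¹ • ((x - y) + ((b - a) / b) • y) := by
    rw [smul_add, smul_sub, smul_smul]
    have : a⁻¹ * ((b - a) / b) = a⁻¹ - b⁻¹ := by field_simp
    rw [this, sub_smul]
    abel
  have h2 : ‖((b - a) / b) • y‖ ≤ C₁ * C₂ * ‖x - y‖ := by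
    rw [norm_smul, Real.norm_eq_abs, abs_div, abs_of_pos hb0, div_mul_eq_mul_div, div_le_iff₀ hb0]
    calc |b - a| * ‖y‖ ≤ (C₁ * ‖x - y‖) * (C₂ * b) :=
          mul_le_mul hab ((hC₂ y).trans (mul_le_mul_of_nonneg_left hb C₂.2)) (norm_nonneg _)
            (by positivity)
      _ = C₁ * C₂ * ‖x - y‖ * b := by ring
  rw [h1, norm_smul, norm_inv, Real.norm_of_nonneg ha0.le, mul_assoc]
  refine mul_le_mul (inv_anti₀ hδ ha) ?_ (norm_nonneg _) (by positivity)
  refine (norm_add_le _ _).trans ?_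
  linarith

/-- The hypothesis makes sense where ρ is not differentiable and is closed under limits. This
recovers from it the normal component of the field at points of differentiability. -/
theorem inner_gradient_eq_one {x w : E} (hx : DifferentiableAt ℝ ρ x)
    (h : ∀ s : ℝ, 0 ≤ s → ρ (x + s • w) = ρ x + s) : ⟪gradient ρ x, w⟫ = 1 := by
  have : CompleteSpace E := FiniteDimensional.complete ℝ E
  have h1 := (hx.hasFDerivAt.hasLineDerivAt w).tendsto_slope_zero_right
  rw [inner_gradient_left]
  refine tendsto_nhds_unique h1 (tendsto_const_nhds.congr' ?_)
  filter_upwards [self_mem_nhdsWithin] with t ht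
  have ht : 0 < t := ht
  rw [h t ht.le, add_sub_cancel_left, smul_eq_mul, inv_mul_cancel₀ ht.ne']

end IsGauge
omit hρ [FiniteDimensional ℝ E]

/-- The lateral surface `{x : ρ(x') = ϱ, |x_n| < h}` of a cylinder. -/
def lateralSurface (ρ : E → ℝ) (ϱ h : ℝ) : Set (WithLp 2 (E × ℝ)) :=
  {x | ρ x.fst = ϱ ∧ |x.snd| < h}

/-- The parametrization of the lateral surface of a cylinder by an annulus. -/
def lateralParam (ρ : E → ℝ) (ϱ h : ℝ) (y : E) : WithLp 2 (E × ℝ) :=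
  WithLp.toLp 2 (ϱ • (max (ρ y) 1)⁻¹ • y, h * (ρ y - 2))

/-- The annulus `{y : a < ρ(y) < b}`. -/
def annulus (ρ : E → ℝ) (a b : ℝ) : Set E := {y | a < ρ y ∧ ρ y < b}

/-- The unit normal of the level sets of the gauge `ρ`. -/
def lateralNormal (ρ : E → ℝ) (x : E) [CompleteSpace E] : WithLp 2 (E × ℝ) :=
  WithLp.toLp 2 (‖gradient ρ x‖⁻¹ • gradient ρ x, 0)

/-- A field whose flow moves the lateral surfaces of cylinders to each other. -/
structure IsLateralFlow (ρ : E → ℝ) (ϱ h κ : ℝ) (W : WithLp 2 (E × ℝ) → WithLp 2 (E × ℝ)) :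
    Prop where
  lipschitz : ∃ K, LipschitzWith K W
  flow : ∀ x, ρ x.fst = ϱ → |x.snd| ≤ h → ∀ s : ℝ, 0 ≤ s → ρ (x.fst + s • (W x).fst) = ϱ + s
  top : ∀ x, ρ x.fst = ϱ → x.snd = h → (W x).snd = κ
  bot : ∀ x, ρ x.fst = ϱ → x.snd = -h → (W x).snd = -κ

theorem lateralParam_of_mem {ϱ h : ℝ} {y : E} (hy : y ∈ annulus ρ 1 3) :
    lateralParam ρ ϱ h y = WithLp.toLp 2 ((ϱ * (ρ y)⁻¹) • y, h * (ρ y - 2)) := by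
  rw [lateralParam, max_eq_left hy.1.le, smul_smul]

variable [FiniteDimensional ℝ E]
include hρ

namespace IsGauge

theorem isOpen_annulus (a b : ℝ) : IsOpen (annulus ρ a b) :=
  (isOpen_lt continuous_const hρ.continuous).inter (isOpen_lt hρ.continuous continuous_const)

theorem isBounded_annulus (a b : ℝ) : Bornology.IsBounded (annulus ρ a b) := by
  obtain ⟨C, -, hC⟩ := hρ.exists_norm_le_mul
  refine (Metric.isBounded_closedBall (x := (0 : E)) (r := C * b)).subset fun y hy => ?_
  rw [mem_closedBall_zero_iff]
  exact (hC y).trans (mul_le_mul_of_nonneg_left hy.2.le C.2)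

theorem measure_annulus_lt_top [MeasurableSpace E] [BorelSpace E] (μ : Measure E)
    [μ.IsAddHaarMeasure] (a b : ℝ) : μ (annulus ρ a b) < ∞ :=
  (hρ.isBounded_annulus a b).measure_lt_top

theorem exists_lipschitzWith_lateralParam (ϱ h : ℝ) :
    ∃ K : ℝ≥0, LipschitzWith K (lateralParam ρ ϱ h) := by
  obtain ⟨K₁, hK₁⟩ := hρ.exists_lipschitzWith_radial one_pos
  obtain ⟨K₂, hK₂⟩ := hρ.exists_lipschitzWith
  obtain ⟨K₃, hK₃⟩ : ∃ K : ℝ≥0, LipschitzWith K fun y : E => ϱ • (max (ρ y) 1)⁻¹ • y :=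
    ⟨_, (lipschitzWith_smul ϱ).comp hK₁⟩
  obtain ⟨K₄, hK₄⟩ : ∃ K : ℝ≥0, LipschitzWith K fun y : E => h * (ρ y - 2) := by
    refine lipschitzWith_of_norm_sub_le (C := |h| * K₂) fun x y => ?_
    have h1 := hK₂.dist_le_mul x y
    rw [Real.dist_eq, dist_eq_norm] at h1
    have h2 : h * (ρ x - 2) - h * (ρ y - 2) = h * (ρ x - ρ y) := by ring
    rw [h2, norm_mul, Real.norm_eq_abs, Real.norm_eq_abs, mul_assoc]
    exact mul_le_mul_of_nonneg_left h1 (abs_nonneg h)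
  exact ⟨_, hK₃.toLp_prod hK₄⟩

theorem image_lateralParam {ϱ h : ℝ} (hϱ : 0 < ϱ) (hh : 0 < h) :
    lateralParam ρ ϱ h '' annulus ρ 1 3 = lateralSurface ρ ϱ h := by
  ext x
  constructor
  · rintro ⟨y, hy, rfl⟩
    have hy0 : 0 < ρ y := one_pos.trans hy.1
    rw [lateralParam_of_mem hy]
    refine ⟨?_, ?_⟩
    · change ρ ((ϱ * (ρ y)⁻¹) • y) = ϱ
      rw [hρ.smul_of_nonneg (by positivity)]
      field_simp
    · change |h * (ρ y - 2)| < h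
      rw [abs_mul, abs_of_pos hh]
      have : |ρ y - 2| < 1 := abs_lt.2 ⟨by linarith [hy.1], by linarith [hy.2]⟩
      nlinarith
  · rintro ⟨hx1, hx2⟩
    have h1 := abs_lt.1 hx2
    have h4 : -1 < x.snd / h := by rw [lt_div_iff₀ hh]; linarith
    have h5 : x.snd / h < 1 := by rw [div_lt_iff₀ hh]; linarith
    have hpos : 0 < 2 + x.snd / h := by linarith
    -- The direction of the preimage is that of x', and its gauge 2 + x_n / h encodes the height.
    have hval : ρ (((2 + x.snd / h) / ϱ) • x.fst) = 2 + x.snd / h := by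
      rw [hρ.smul_of_nonneg (by positivity), hx1]
      field_simp
    have hmem : ((2 + x.snd / h) / ϱ) • x.fst ∈ annulus ρ 1 3 := by
      refine ⟨?_, ?_⟩ <;> rw [hval] <;> linarith
    refine ⟨_, hmem, ?_⟩
    rw [lateralParam_of_mem hmem, hval]
    refine withLp_ext ?_ ?_
    · change (ϱ * (2 + x.snd / h)⁻¹) • ((2 + x.snd / h) / ϱ) • x.fst = x.fst
      rw [smul_smul]
      have : ϱ * (2 + x.snd / h)⁻¹ * ((2 + x.snd / h) / ϱ) = 1 := by
        generalize 2 + x.snd / h = a at hpos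
        field_simp
      rw [this, one_smul]
    · change h * (2 + x.snd / h - 2) = x.snd
      field_simp
      ring

/-- The height determines ρ(y), and the horizontal part then determines y, both in a Lipschitz way.
The lower bound gives injectivity of the parametrization and of its derivatives. -/
theorem exists_norm_lateralParam_sub_ge {ϱ h : ℝ} (hϱ : 0 < ϱ) (hh : 0 < h) :
    ∃ c : ℝ, 0 < c ∧ ∀ x ∈ annulus ρ 1 3, ∀ y ∈ annulus ρ 1 3,
      c * ‖x - y‖ ≤ ‖lateralParam ρ ϱ h x - lateralParam ρ ϱ h y‖ := by
  obtain ⟨C, hC0, hC⟩ := hρ.exists_norm_le_mul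
  have hpos : 0 < 3 / ϱ + C / h := by positivity
  refine ⟨(3 / ϱ + C / h)⁻¹, by positivity, fun x hx y hy => ?_⟩
  have hx0 : 0 < ρ x := one_pos.trans hx.1
  have hy0 : 0 < ρ y := one_pos.trans hy.1
  rw [lateralParam_of_mem hx, lateralParam_of_mem hy, ← WithLp.toLp_sub, Prod.mk_sub_mk,
    inv_mul_eq_div, div_le_iff₀ hpos]
  set N := ‖WithLp.toLp 2 ((ϱ * (ρ x)⁻¹) • x - (ϱ * (ρ y)⁻¹) • y,
    h * (ρ x - 2) - h * (ρ y - 2))‖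
  have h1 : ‖(ϱ * (ρ x)⁻¹) • x - (ϱ * (ρ y)⁻¹) • y‖ ≤ N :=
    norm_fst_le_norm (WithLp.toLp 2 ((ϱ * (ρ x)⁻¹) • x - (ϱ * (ρ y)⁻¹) • y,
      h * (ρ x - 2) - h * (ρ y - 2)))
  have h2 : |h * (ρ x - 2) - h * (ρ y - 2)| ≤ N :=
    abs_snd_le_norm (WithLp.toLp 2 ((ϱ * (ρ x)⁻¹) • x - (ϱ * (ρ y)⁻¹) • y,
      h * (ρ x - 2) - h * (ρ y - 2)))
  have h3 : x - y = (ρ x / ϱ) • ((ϱ * (ρ x)⁻¹) • x - (ϱ * (ρ y)⁻¹) • y) +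
      ((h * (ρ x - 2) - h * (ρ y - 2)) / h * (ρ y)⁻¹) • y := by
    rw [smul_sub, smul_smul, smul_smul]
    have e1 : ρ x / ϱ * (ϱ * (ρ x)⁻¹) = 1 := by field_simp
    have e2 : (h * (ρ x - 2) - h * (ρ y - 2)) / h * (ρ y)⁻¹ =
        ρ x / ϱ * (ϱ * (ρ y)⁻¹) - 1 := by field_simp; ring
    rw [e1, e2, sub_smul, one_smul, one_smul]
    abel
  rw [h3]
  refine (norm_add_le _ _).trans ?_
  rw [norm_smul, norm_smul, norm_mul, norm_div, norm_div, norm_inv, Real.norm_of_nonneg hx0.le,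
    Real.norm_of_nonneg hϱ.le, Real.norm_of_nonneg hh.le, Real.norm_of_nonneg hy0.le,
    Real.norm_eq_abs]
  have h4 : ρ x / ϱ * ‖(ϱ * (ρ x)⁻¹) • x - (ϱ * (ρ y)⁻¹) • y‖ ≤ 3 / ϱ * N := by
    gcongr
    exact hx.2.le
  have h5 : |h * (ρ x - 2) - h * (ρ y - 2)| / h * (ρ y)⁻¹ * ‖y‖ ≤ C / h * N := by
    have : (ρ y)⁻¹ * ‖y‖ ≤ C := by
      rw [inv_mul_eq_div, div_le_iff₀ hy0]
      exact hC y
    calc _ = |h * (ρ x - 2) - h * (ρ y - 2)| / h * ((ρ y)⁻¹ * ‖y‖) := by ring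
      _ ≤ N / h * C := by gcongr
      _ = _ := by ring
  linarith

end IsGauge

/-- The radii are matched by the flow identity and the heights by the values at the two ends,
because a small Lipschitz perturbation keeps the order along vertical lines. Surjectivity is a fixed
point argument. -/
theorem IsLateralFlow.exists_image_eq {ϱ h κ : ℝ} {W : WithLp 2 (E × ℝ) → WithLp 2 (E × ℝ)}
    (hW : IsLateralFlow ρ ϱ h κ W) (hϱ : 0 < ϱ) (hh : 0 < h) :
    ∃ s₀ > 0, ∀ s ∈ Ioo 0 s₀, (fun x => x + s • W x) '' lateralSurface ρ ϱ h =
      lateralSurface ρ (ϱ + s) (h + κ * s) := by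
  have : CompleteSpace E := FiniteDimensional.complete ℝ E
  obtain ⟨K, hK⟩ := hW.lipschitz
  obtain ⟨C₁, hC₁0, hC₁⟩ := hρ.exists_le_mul_norm
  obtain ⟨C₂, hC₂0, hC₂⟩ := hρ.exists_norm_le_mul
  -- Where ρ ≥ ϱ/2 this retracts onto the closed lateral surface: radial projection and truncation
  -- of the height. It extends `W` from that surface by a field on the whole space to which the
  -- contraction principle applies.
  let clamp : WithLp 2 (E × ℝ) → WithLp 2 (E × ℝ) := fun x =>
    WithLp.toLp 2 (ϱ • (max (ρ x.fst) (ϱ / 2))⁻¹ • x.fst, max (-h) (min h x.snd))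
  obtain ⟨K', hK'⟩ : ∃ K' : ℝ≥0, LipschitzWith K' clamp := by
    obtain ⟨K₁, hK₁⟩ := hρ.exists_lipschitzWith_radial (half_pos hϱ)
    have hfst : LipschitzWith 1 fun x : WithLp 2 (E × ℝ) => x.fst :=
      LipschitzWith.of_dist_le_mul fun x y => by
        rw [dist_eq_norm, dist_eq_norm, NNReal.coe_one, one_mul, ← WithLp.sub_fst]
        exact norm_fst_le_norm _
    have hsnd : LipschitzWith 1 fun x : WithLp 2 (E × ℝ) => x.snd :=
      LipschitzWith.of_dist_le_mul fun x y => by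
        rw [Real.dist_eq, dist_eq_norm, NNReal.coe_one, one_mul, ← WithLp.sub_snd]
        exact abs_snd_le_norm _
    exact ⟨_, (((lipschitzWith_smul ϱ).comp hK₁).comp hfst).toLp_prod
      ((hsnd.const_min h).const_max (-h))⟩
  have hclamp_norm : ∀ x, ‖clamp x‖ ≤ ϱ * C₂ + h := fun x => by
    refine (norm_toLp_le _ _).trans (add_le_add ?_ ?_)
    · have hpos : 0 < max (ρ x.fst) (ϱ / 2) := lt_max_of_lt_right (half_pos hϱ)
      rw [norm_smul, norm_smul, norm_inv, Real.norm_of_nonneg hϱ.le, Real.norm_of_nonneg hpos.le]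
      refine mul_le_mul_of_nonneg_left ?_ hϱ.le
      rw [inv_mul_eq_div, div_le_iff₀ hpos]
      exact (hC₂ _).trans (mul_le_mul_of_nonneg_left (le_max_left _ _) C₂.2)
    · rw [abs_le]
      exact ⟨le_max_left _ _, max_le (by linarith) (min_le_left _ _)⟩
  set B : ℝ := ‖W 0‖ + K * (ϱ * C₂ + h)
  have hB : ∀ x, ‖(W (clamp x)).fst‖ ≤ B := fun x => by
    refine (norm_fst_le_norm (W (clamp x))).trans ?_
    have h1 := hK.dist_le_mul (clamp x) 0
    rw [dist_eq_norm, dist_zero_right] at h1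
    have h2 := norm_le_norm_add_norm_sub' (W (clamp x)) (W 0)
    have h3 := mul_le_mul_of_nonneg_left (hclamp_norm x) K.2
    simp only [B]
    change K * _ ≤ (K : ℝ) * _ at h3
    linarith
  have hB0 : 0 ≤ B := by positivity
  -- The three bounds keep heights ordered (s K < 1), make the fixed point map a contraction (s K K'
  -- < 1), and keep the fixed point in the region ρ > ϱ/2, where `clamp` is the radial projection.
  refine ⟨min (min (K + 1 : ℝ)⁻¹ (K * K' + 1 : ℝ)⁻¹) (ϱ / 2 / (C₁ * B + 1)), by positivity,
    fun s hs => ?_⟩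
  obtain ⟨hs0, hs1⟩ := hs
  simp only [lt_min_iff] at hs1
  obtain ⟨⟨hsK, hsK'⟩, hsB⟩ := hs1
  have hsK : s * K < 1 := by
    have h1 := (lt_inv_comm₀ hs0 (by positivity)).1 hsK
    have h2 : s * (K + 1) < 1 := by
      have := mul_lt_mul_of_pos_left h1 hs0
      rwa [mul_inv_cancel₀ hs0.ne'] at this
    nlinarith
  have hsK' : s * (K * K') < 1 := by
    have h1 := (lt_inv_comm₀ hs0 (by positivity)).1 hsK'
    have h2 : s * (K * K' + 1) < 1 := by
      have := mul_lt_mul_of_pos_left h1 hs0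
      rwa [mul_inv_cancel₀ hs0.ne'] at this
    nlinarith
  have hsB : s * (C₁ * B) < ϱ / 2 := by
    rw [lt_div_iff₀ (by positivity)] at hsB
    nlinarith
  have hvert : ∀ x y : WithLp 2 (E × ℝ), x.fst = y.fst →
      |(W x).snd - (W y).snd| ≤ K * |x.snd - y.snd| := fun x y hxy => by
    have h1 := hK.dist_le_mul x y
    rw [dist_eq_norm, dist_eq_norm] at h1
    have h2 : x - y = WithLp.toLp 2 (0, x.snd - y.snd) :=
      withLp_ext (by simp [hxy]) (by simp)
    have h3 : ‖x - y‖ = |x.snd - y.snd| := by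
      rw [h2, WithLp.norm_toLp_snd, Real.norm_eq_abs]
    rw [h3] at h1
    exact (abs_snd_le_norm (W x - W y)).trans h1
  ext p
  constructor
  · rintro ⟨x, ⟨hx1, hx2⟩, rfl⟩
    refine ⟨hW.flow x hx1 hx2.le s hs0.le, ?_⟩
    change |x.snd + s * (W x).snd| < h + κ * s
    have h1 := hvert x (WithLp.toLp 2 (x.fst, h)) rfl
    have h2 := hvert x (WithLp.toLp 2 (x.fst, -h)) rfl
    rw [hW.top (WithLp.toLp 2 (x.fst, h)) hx1 rfl] at h1
    rw [hW.bot (WithLp.toLp 2 (x.fst, -h)) hx1 rfl] at h2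
    change _ ≤ K * |x.snd - h| at h1
    change _ ≤ K * |x.snd - -h| at h2
    obtain ⟨h3, h4⟩ := abs_lt.1 hx2
    rw [abs_of_neg (by linarith : x.snd - h < 0)] at h1
    rw [abs_of_pos (by linarith : 0 < x.snd - -h)] at h2
    have h5 := mul_le_mul_of_nonneg_left (abs_le.1 h1).2 hs0.le
    have h6 := mul_le_mul_of_nonneg_left (abs_le.1 h2).1 hs0.le
    rw [abs_lt]
    constructor
    · nlinarith [mul_pos (sub_pos.2 hsK) (show 0 < x.snd - -h by linarith)]
    · nlinarith [mul_pos (sub_pos.2 hsK) (show 0 < -(x.snd - h) by linarith)]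
  · rintro ⟨hp1, hp2⟩
    -- A preimage of `p` is sought as a fixed point x = p - s W(clamp x). It remains to show that
    -- this x lies on the lateral surface, so that clamp x = x.
    have hcontr : ContractingWith (⟨s * (K * K'), by positivity⟩ : ℝ≥0)
        (fun x => p - s • W (clamp x)) := by
      refine ⟨by exact_mod_cast hsK', LipschitzWith.of_dist_le_mul fun x y => ?_⟩
      rw [dist_sub_left, dist_smul₀, Real.norm_of_nonneg hs0.le]
      change _ ≤ s * (K * K') * dist x y
      rw [mul_assoc, mul_assoc]
      exact mul_le_mul_of_nonneg_left ((hK.dist_le_mul _ _).trans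
        (mul_le_mul_of_nonneg_left (hK'.dist_le_mul _ _) K.2)) hs0.le
    obtain ⟨x, hx⟩ : ∃ x, p - s • W (clamp x) = x :=
      ⟨_, hcontr.fixedPoint_isFixedPt⟩
    have hpx : p = x + s • W (clamp x) := sub_eq_iff_eq_add.1 hx
    have hpx1 : p.fst = x.fst + s • (W (clamp x)).fst := congrArg WithLp.fst hpx
    have hpx2 : p.snd = x.snd + s * (W (clamp x)).snd := congrArg WithLp.snd hpx
    have hxρ : ϱ / 2 < ρ x.fst := by
      have h1 := hρ.add_le x.fst (s • (W (clamp x)).fst)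
      rw [← hpx1, hp1, hρ.smul_of_nonneg hs0.le] at h1
      have h2 := mul_le_mul_of_nonneg_left ((hC₁ (W (clamp x)).fst).trans
        (mul_le_mul_of_nonneg_left (hB x) C₁.2)) hs0.le
      change _ ≤ s * (C₁ * B) at h2
      linarith
    have hxpos : 0 < ρ x.fst := (half_pos hϱ).trans hxρ
    have hfst : (clamp x).fst = (ϱ / ρ x.fst) • x.fst := by
      change ϱ • (max (ρ x.fst) (ϱ / 2))⁻¹ • x.fst = _
      rw [max_eq_left hxρ.le, smul_smul, div_eq_mul_inv]
    have hsnd : (clamp x).snd = max (-h) (min h x.snd) := rfl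
    have hcρ : ρ (clamp x).fst = ϱ := by
      rw [hfst, hρ.smul_of_nonneg (by positivity)]
      field_simp
    have hch : |(clamp x).snd| ≤ h := by
      rw [hsnd, abs_le]
      exact ⟨le_max_left _ _, max_le (by linarith) (min_le_left _ _)⟩
    -- Scaling the flow identity at clamp x by ρ(x')/ϱ gives ρ(p') = ρ(x') + s, while ρ(p') = ϱ + s.
    have hρx : ρ x.fst = ϱ := by
      have h1 := hW.flow _ hcρ hch (s / (ρ x.fst / ϱ)) (by positivity)
      have h2 : p.fst = (ρ x.fst / ϱ) •
          ((clamp x).fst + (s / (ρ x.fst / ϱ)) • (W (clamp x)).fst) := by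
        rw [hpx1, hfst, smul_add, smul_smul, smul_smul]
        have e1 : ρ x.fst / ϱ * (ϱ / ρ x.fst) = 1 := by field_simp
        have e2 : ρ x.fst / ϱ * (s / (ρ x.fst / ϱ)) = s := by field_simp
        rw [e1, e2, one_smul]
      rw [h2, hρ.smul_of_nonneg (by positivity), h1] at hp1
      field_simp at hp1
      linarith
    have hcx : (clamp x).fst = x.fst := by
      rw [hfst, hρx, div_self hϱ.ne', one_smul]
    obtain ⟨hp3, hp4⟩ := abs_lt.1 hp2
    -- If the height were truncated, `W` would have vertical component ±κ there and `p` would lie at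
    -- or beyond the end ±(h + κ s).
    have hxh : |x.snd| < h := by
      rw [abs_lt]
      constructor
      · by_contra! hle
        have h1 : (clamp x).snd = -h := by
          rw [hsnd, min_eq_right (by linarith), max_eq_left hle]
        rw [hpx2, hW.bot _ hcρ h1] at hp3
        linarith
      · by_contra! hle
        have h1 : (clamp x).snd = h := by
          rw [hsnd, min_eq_left hle, max_eq_right (by linarith)]
        rw [hpx2, hW.top _ hcρ h1] at hp4
        linarith
    have hclx : clamp x = x := withLp_ext hcx (by
      rw [hsnd, min_eq_right (abs_lt.1 hxh).2.le, max_eq_right (abs_lt.1 hxh).1.le])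
    refine ⟨x, ⟨hρx, hxh⟩, ?_⟩
    rw [hclx] at hpx
    exact hpx.symm

end Lateral

/-! ### The total divergence of a field on the lateral surface -/

section LateralDivergence

open Module
open scoped NNReal ENNReal

variable {E : Type*} [NormedAddCommGroup E] [InnerProductSpace ℝ E] [FiniteDimensional ℝ E]

theorem finrank_withLp_prod : finrank ℝ (WithLp 2 (E × ℝ)) = finrank ℝ E + 1 := by
  rw [(WithLp.linearEquiv 2 ℝ (E × ℝ)).finrank_eq, finrank_prod, finrank_self]

instance finiteDimensional_withLp_prod : FiniteDimensional ℝ (WithLp 2 (E × ℝ)) :=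
  (WithLp.linearEquiv 2 ℝ (E × ℝ)).symm.finiteDimensional

/-- The field `W` has the tangential derivative `L` on the lateral surface at `x`, and `d` is its
surface divergence. -/
def HasLateralDivAt [CompleteSpace E] (ρ : E → ℝ) (ϱ h : ℝ)
    (W : WithLp 2 (E × ℝ) → WithLp 2 (E × ℝ)) (x : WithLp 2 (E × ℝ)) (d : ℝ) : Prop :=
  ∃ L : WithLp 2 (E × ℝ) →L[ℝ] WithLp 2 (E × ℝ),
    HasFDerivWithinAt W L (lateralSurface ρ ϱ h) x ∧
    d = LinearMap.trace ℝ _ (L : WithLp 2 (E × ℝ) →ₗ[ℝ] WithLp 2 (E × ℝ)) -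
      ⟪lateralNormal ρ x.fst, L (lateralNormal ρ x.fst)⟫

variable [MeasurableSpace E] [BorelSpace E] {ρ : E → ℝ} (hρ : IsGauge ρ)

/-- The measure on the annulus which corresponds to the surface measure on the lateral surface. -/
def lateralDensity (ρ : E → ℝ) (ϱ h : ℝ) : Measure E :=
  ((Measure.hausdorffMeasure (finrank ℝ E : ℝ)).restrict (annulus ρ 1 3)).withDensity fun y =>
    ENNReal.ofReal (fderiv ℝ (lateralParam ρ ϱ h) y : E →ₗ[ℝ] WithLp 2 (E × ℝ)).normDet

theorem measurable_normDet_fderiv {F : Type*} [NormedAddCommGroup F] [InnerProductSpace ℝ F]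
    [FiniteDimensional ℝ F] (f : E → F) :
    Measurable fun y => (fderiv ℝ f y : E →ₗ[ℝ] F).normDet := by
  have : CompleteSpace F := FiniteDimensional.complete ℝ F
  borelize F
  exact continuous_normDet.measurable.comp (measurable_fderiv ℝ f)

include hρ

omit hρ in
theorem isOpen_lateral_bounds (h : ℝ) : IsOpen {x : WithLp 2 (E × ℝ) | |x.snd| < h} :=
  isOpen_lt (continuous_abs.comp (WithLp.continuous_snd 2 E ℝ)) continuous_const

theorem measurableSet_lateralSurface (ϱ h : ℝ) : MeasurableSet (lateralSurface ρ ϱ h) := by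
  refine MeasurableSet.inter ?_ (isOpen_lateral_bounds h).measurableSet
  exact (isClosed_eq (hρ.continuous.comp (WithLp.continuous_fst 2 E ℝ))
    continuous_const).measurableSet

/-- The area formula on preimages of measurable sets. It moves integrals over the surface to a fixed
annulus, where derivatives of Lipschitz maps exist a.e. -/
theorem restrict_lateralSurface_eq_map {ϱ h : ℝ} (hϱ : 0 < ϱ) (hh : 0 < h) :
    (Measure.hausdorffMeasure (finrank ℝ E : ℝ)).restrict (lateralSurface ρ ϱ h) =
      (lateralDensity ρ ϱ h).map (lateralParam ρ ϱ h) := by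
  obtain ⟨K, hK⟩ := hρ.exists_lipschitzWith_lateralParam ϱ h
  obtain ⟨c, hc, hanti⟩ := hρ.exists_norm_lateralParam_sub_ge hϱ hh
  have hm : Measurable (lateralParam ρ ϱ h) := hK.continuous.measurable
  ext S hS
  rw [Measure.map_apply hm hS, lateralDensity, withDensity_apply _ (hm hS),
    Measure.restrict_restrict (hm hS), Measure.restrict_apply hS,
    ← hK.hausdorffMeasure_image_eq_lintegral_normDet (hρ.isOpen_annulus 1 3)
      ((hm hS).inter (hρ.isOpen_annulus 1 3).measurableSet) inter_subset_right hc hanti,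
    inter_comm _ (annulus ρ 1 3), image_inter_preimage, hρ.image_lateralParam hϱ hh, inter_comm]

theorem isFiniteMeasure_lateralDensity {ϱ h : ℝ} (hϱ : 0 < ϱ) (hh : 0 < h) :
    IsFiniteMeasure (lateralDensity ρ ϱ h) := by
  obtain ⟨K, hK⟩ := hρ.exists_lipschitzWith_lateralParam ϱ h
  obtain ⟨c, hc, hanti⟩ := hρ.exists_norm_lateralParam_sub_ge hϱ hh
  refine ⟨?_⟩
  rw [lateralDensity, withDensity_apply _ MeasurableSet.univ, Measure.restrict_univ,
    ← hK.hausdorffMeasure_image_eq_lintegral_normDet (hρ.isOpen_annulus 1 3)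
      (hρ.isOpen_annulus 1 3).measurableSet subset_rfl hc hanti]
  refine (hK.hausdorffMeasure_image_le (by positivity) _).trans_lt ?_
  exact ENNReal.mul_lt_top (by simp) (hρ.measure_annulus_lt_top _ 1 3)

theorem ae_normDet_fderiv_lateralParam_pos {ϱ h : ℝ} (hϱ : 0 < ϱ) (hh : 0 < h) :
    ∀ᵐ y ∂(Measure.hausdorffMeasure (finrank ℝ E : ℝ) : Measure E), y ∈ annulus ρ 1 3 →
      0 < (fderiv ℝ (lateralParam ρ ϱ h) y : E →ₗ[ℝ] WithLp 2 (E × ℝ)).normDet := by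
  obtain ⟨K, hK⟩ := hρ.exists_lipschitzWith_lateralParam ϱ h
  obtain ⟨c, hc, hanti⟩ := hρ.exists_norm_lateralParam_sub_ge hϱ hh
  filter_upwards [hK.ae_differentiableAt] with y hy hyA
  refine lt_of_le_of_ne (LinearMap.normDet_nonneg _) (Ne.symm ?_)
  have hinj : Function.Injective (fderiv ℝ (lateralParam ρ ϱ h) y) :=
    (injective_iff_map_eq_zero _).2 fun v hv => by
      have := norm_fderiv_ge_of_dist_ge ((hρ.isOpen_annulus 1 3).mem_nhds hyA) hy.hasFDerivAt
        (fun z hz => hanti z hz y hyA) v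
      rw [hv, norm_zero] at this
      rw [← norm_le_zero_iff]
      exact nonpos_of_mul_nonpos_right this hc
  rw [Ne, LinearMap.normDet_eq_zero_iff_ker_ne_bot, not_not]
  exact LinearMap.ker_eq_bot.2 hinj

/-- The Jacobian of the parametrization is positive a.e. on the annulus, so the density does not
create null sets. -/
theorem ae_lateralDensity_iff {ϱ h : ℝ} (hϱ : 0 < ϱ) (hh : 0 < h) {p : E → Prop} :
    (∀ᵐ y ∂(lateralDensity ρ ϱ h), p y) ↔
      ∀ᵐ y ∂(Measure.hausdorffMeasure (finrank ℝ E : ℝ) : Measure E), y ∈ annulus ρ 1 3 → p y := by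
  rw [lateralDensity, ae_withDensity_iff
    (measurable_normDet_fderiv (lateralParam ρ ϱ h)).ennreal_ofReal,
    ae_restrict_iff' (hρ.isOpen_annulus 1 3).measurableSet]
  constructor
  · intro hp
    filter_upwards [hp, ae_normDet_fderiv_lateralParam_pos hρ hϱ hh] with y h1 h2 hy
    exact h1 hy (ENNReal.ofReal_pos.2 (h2 hy)).ne'
  · intro hp
    filter_upwards [hp] with y h1 hy _
    exact h1 hy

/-- Almost every point of the lateral surface is a point of differentiability. -/
theorem ae_lateralSurface_iff {ϱ h : ℝ} (hϱ : 0 < ϱ) (hh : 0 < h) {p : WithLp 2 (E × ℝ) → Prop} :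
    (∀ᵐ x ∂(Measure.hausdorffMeasure (finrank ℝ E : ℝ)).restrict (lateralSurface ρ ϱ h), p x) ↔
      ∀ᵐ y ∂(Measure.hausdorffMeasure (finrank ℝ E : ℝ) : Measure E), y ∈ annulus ρ 1 3 →
        p (lateralParam ρ ϱ h y) := by
  obtain ⟨K, hK⟩ := hρ.exists_lipschitzWith_lateralParam ϱ h
  obtain ⟨c, hc, hanti⟩ := hρ.exists_norm_lateralParam_sub_ge hϱ hh
  constructor
  · intro hp
    rw [restrict_lateralSurface_eq_map hρ hϱ hh] at hp
    exact (ae_lateralDensity_iff hρ hϱ hh).1 (ae_of_ae_map hK.continuous.aemeasurable hp)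
  · intro hp
    rw [ae_restrict_iff' (measurableSet_lateralSurface hρ ϱ h)]
    -- The property need not be measurable, so the exceptional set is covered by the Lipschitz image
    -- of a null set.
    set N := {y | ¬ (y ∈ annulus ρ 1 3 → p (lateralParam ρ ϱ h y))}
    have hN : Measure.hausdorffMeasure (finrank ℝ E : ℝ) N = 0 := hp
    refine measure_mono_null (t := lateralParam ρ ϱ h '' N) ?_
      (le_antisymm ((hK.hausdorffMeasure_image_le (by positivity) N).trans_eq
        (by rw [hN, mul_zero])) zero_le)
    intro x hx
    simp only [mem_compl_iff, mem_ofPred_eq, Classical.not_imp] at hx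
    obtain ⟨hx1, hx2⟩ := hx
    rw [← hρ.image_lateralParam hϱ hh] at hx1
    obtain ⟨y, hy, rfl⟩ := hx1
    exact ⟨y, by simp only [N, mem_ofPred_eq, Classical.not_imp]; exact ⟨hy, hx2⟩, rfl⟩

variable [CompleteSpace E]

omit [MeasurableSpace E] [BorelSpace E] in
theorem IsGauge.norm_lateralNormal {x : E} (hx : DifferentiableAt ℝ ρ x) (h0 : x ≠ 0) :
    ‖lateralNormal ρ x‖ = 1 := by
  rw [lateralNormal, WithLp.norm_toLp_fst, norm_smul, norm_inv, norm_norm,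
    inv_mul_cancel₀ (norm_ne_zero_iff.2 (hρ.gradient_ne_zero hx h0))]

omit [MeasurableSpace E] [BorelSpace E] in
omit hρ in
theorem inner_lateralNormal (x : E) (v : WithLp 2 (E × ℝ)) :
    ⟪lateralNormal ρ x, v⟫ = ‖gradient ρ x‖⁻¹ * ⟪gradient ρ x, v.fst⟫ := by
  rw [lateralNormal, WithLp.prod_inner_apply]
  simp [real_inner_smul_left]

/-- The Jacobian of the flow of a field on the lateral surface. -/
theorem IsLateralFlow.exists_normDet_eq {ϱ h κ : ℝ} (hϱ : 0 < ϱ) (hh : 0 < h)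
    {W : WithLp 2 (E × ℝ) → WithLp 2 (E × ℝ)} (hW : IsLateralFlow ρ ϱ h κ W) :
    ∃ C : ℝ, ∀ d : WithLp 2 (E × ℝ) → ℝ,
    (∀ᵐ x ∂(Measure.hausdorffMeasure (finrank ℝ E : ℝ)).restrict (lateralSurface ρ ϱ h),
      HasLateralDivAt ρ ϱ h W x (d x)) →
    ∀ᵐ y ∂(Measure.hausdorffMeasure (finrank ℝ E : ℝ) : Measure E), y ∈ annulus ρ 1 3 →
      ∃ M : E →L[ℝ] E, ‖M‖ ≤ C ∧
        LinearMap.trace ℝ E (M : E →ₗ[ℝ] E) = d (lateralParam ρ ϱ h y) ∧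
        ∀ s : ℝ, (fderiv ℝ (fun y => lateralParam ρ ϱ h y + s • W (lateralParam ρ ϱ h y)) y :
            E →ₗ[ℝ] WithLp 2 (E × ℝ)).normDet = |(1 + s • M : E →L[ℝ] E).det| *
          (fderiv ℝ (lateralParam ρ ϱ h) y : E →ₗ[ℝ] WithLp 2 (E × ℝ)).normDet := by
  obtain ⟨K, hK⟩ := hρ.exists_lipschitzWith_lateralParam ϱ h
  obtain ⟨K', hK'⟩ := hW.lipschitz
  obtain ⟨c, hc, hanti⟩ := hρ.exists_norm_lateralParam_sub_ge hϱ hh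
  have hq := hK'.comp hK
  refine ⟨(K' * K : ℝ≥0) / c, fun d hd => ?_⟩
  filter_upwards [hK.ae_differentiableAt, hq.ae_differentiableAt,
    (ae_lateralSurface_iff hρ hϱ hh).1 hd, hρ.ae_differentiableAt _] with y hΨ hWΨ hdy hρy hyA
  obtain ⟨L, hL, hdL⟩ := hdy hyA
  have hy0 : 0 < ρ y := one_pos.trans hyA.1
  have hnhds := (hρ.isOpen_annulus 1 3).mem_nhds hyA
  have hmem : ∀ z ∈ annulus ρ 1 3, lateralParam ρ ϱ h z ∈ lateralSurface ρ ϱ h := fun z hz => by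
    rw [← hρ.image_lateralParam hϱ hh]
    exact mem_image_of_mem _ hz
  have hfst : (lateralParam ρ ϱ h y).fst = (ϱ * (ρ y)⁻¹) • y := by
    rw [lateralParam_of_mem hyA]; rfl
  have hgrad : gradient ρ (lateralParam ρ ϱ h y).fst = gradient ρ y := by
    rw [hfst, hρ.gradient_smul (by positivity) hρy]
  have hdiff : DifferentiableAt ℝ ρ (lateralParam ρ ϱ h y).fst := by
    rw [hfst]; exact hρ.differentiableAt_smul (by positivity) hρy
  have hx0 : (lateralParam ρ ϱ h y).fst ≠ 0 := hρ.ne_zero_of_pos (by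
    rw [(hmem y hyA).1]; exact hϱ)
  set ν := lateralNormal ρ (lateralParam ρ ϱ h y).fst with hν
  set D := fderiv ℝ (lateralParam ρ ϱ h) y
  -- `L` is a derivative only along the surface, but the parametrization maps the open annulus into
  -- the surface, so the chain rule gives a full derivative.
  have hLD : HasFDerivAt (fun y => W (lateralParam ρ ϱ h y)) (L ∘L D) y := by
    have h1 : HasFDerivWithinAt (fun y => W (lateralParam ρ ϱ h y)) (L ∘L D) (annulus ρ 1 3) y :=
      hL.comp y hΨ.hasFDerivAt.hasFDerivWithinAt hmem
    exact h1.hasFDerivAt hnhds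
  have hsum : ∀ s : ℝ, HasFDerivAt (fun y => lateralParam ρ ϱ h y + s • W (lateralParam ρ ϱ h y))
      (D + s • (L ∘L D)) y := fun s => hΨ.hasFDerivAt.add (hLD.const_smul s)
  -- The moved surface lies in {ρ = ϱ + s}, and the linear functional ⟪∇ρ(y), ·⟫ is at most ρ with
  -- equality at the image of `y`. It thus has a local maximum there and its derivative vanishes; ρ
  -- need not be differentiable at nearby points.
  have htan : ∀ s : ℝ, 0 ≤ s → ∀ v, ⟪ν, (D + s • (L ∘L D)) v⟫ = 0 := fun s hs v => by
    let ℓ : WithLp 2 (E × ℝ) →L[ℝ] ℝ :=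
      innerSL ℝ (WithLp.toLp 2 (gradient ρ y, (0 : ℝ)) : WithLp 2 (E × ℝ))
    have hℓ : ∀ u : WithLp 2 (E × ℝ), ℓ u = ⟪gradient ρ y, u.fst⟫ := fun u => by
      simp [ℓ, WithLp.prod_inner_apply]
    have hmax : IsLocalMax (fun z => ℓ (lateralParam ρ ϱ h z + s • W (lateralParam ρ ϱ h z))) y := by
      filter_upwards [hnhds] with z hz
      have h1 := hW.flow _ (hmem z hz).1 (hmem z hz).2.le s hs
      have h2 := hρ.inner_gradient_eq_one hdiff fun t ht => by
        rw [hW.flow _ (hmem y hyA).1 (hmem y hyA).2.le t ht, (hmem y hyA).1]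
      have h3 := hρ.inner_gradient_self hdiff
      rw [hgrad] at h2 h3
      rw [hℓ, hℓ, WithLp.add_fst, WithLp.smul_fst, WithLp.add_fst, WithLp.smul_fst]
      refine (hρ.inner_gradient_le hρy _).trans ?_
      rw [h1, inner_add_right, inner_smul_right, h2, h3, (hmem y hyA).1, mul_one]
    have h4 := hmax.hasFDerivAt_eq_zero (ℓ.hasFDerivAt.comp y (hsum s))
    have h5 : ℓ ((D + s • (L ∘L D)) v) = 0 := congrArg (fun T : E →L[ℝ] ℝ => T v) h4
    rw [hν, inner_lateralNormal, hgrad, ← hℓ, h5, mul_zero]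
  -- The cases s = 0 and s = 1 separate the tangency of `D` from that of `L ∘ D`.
  have hDν : ∀ v, ⟪ν, D v⟫ = 0 := fun v => by simpa using htan 0 le_rfl v
  have hLν : ∀ v, ⟪ν, L (D v)⟫ = 0 := fun v => by
    have h1 := htan 1 zero_le_one v
    simp only [one_smul, add_apply, inner_add_right, hDν, zero_add] at h1
    exact h1
  have hDlow : ∀ v, c * ‖v‖ ≤ ‖D v‖ := norm_fderiv_ge_of_dist_ge hnhds hΨ.hasFDerivAt
    fun z hz => hanti z hz y hyA
  have hinj : Function.Injective D := (injective_iff_map_eq_zero _).2 fun v hv => by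
    have := hDlow v
    rw [hv, norm_zero] at this
    rw [← norm_le_zero_iff]
    exact nonpos_of_mul_nonpos_right this hc
  have hLDnorm : ∀ v, ‖L (D v)‖ ≤ (K' * K : ℝ≥0) / c * ‖D v‖ := fun v => by
    have h1 : ‖L ∘L D‖ ≤ (K' * K : ℝ≥0) := hLD.le_of_lipschitz hq
    have h2 := (L ∘L D).le_of_opNorm_le h1 v
    rw [div_mul_eq_mul_div, le_div_iff₀ hc]
    calc ‖L (D v)‖ * c ≤ (K' * K : ℝ≥0) * ‖v‖ * c := by gcongr; exact h2
      _ = (K' * K : ℝ≥0) * (c * ‖v‖) := by ring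
      _ ≤ _ := by gcongr; exact hDlow v
  obtain ⟨M, hM1, hM2, hM3⟩ := exists_normDet_add_smul_comp_eq finrank_withLp_prod
    (hρ.norm_lateralNormal hdiff hx0) hinj hDν hLν (by positivity) hLDnorm
  refine ⟨M, hM3, ?_, fun s => ?_⟩
  · rw [hM2, hdL]
  · rw [(hsum s).fderiv, hM1]

/-- The area of the image of the lateral surface under the flow. -/
theorem IsLateralFlow.exists_lintegral_eq {ϱ h κ : ℝ} (hϱ : 0 < ϱ) (hh : 0 < h)
    {W : WithLp 2 (E × ℝ) → WithLp 2 (E × ℝ)} (hW : IsLateralFlow ρ ϱ h κ W) :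
    ∃ s₀ > 0, ∀ s ∈ Ioo 0 s₀, ∫⁻ y in annulus ρ 1 3, ENNReal.ofReal
      (fderiv ℝ (fun y => lateralParam ρ ϱ h y + s • W (lateralParam ρ ϱ h y)) y :
        E →ₗ[ℝ] WithLp 2 (E × ℝ)).normDet ∂(Measure.hausdorffMeasure (finrank ℝ E : ℝ)) =
      Measure.hausdorffMeasure (finrank ℝ E : ℝ) (lateralSurface ρ (ϱ + s) (h + κ * s)) := by
  obtain ⟨K, hK⟩ := hρ.exists_lipschitzWith_lateralParam ϱ h
  obtain ⟨K', hK'⟩ := hW.lipschitz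
  obtain ⟨c, hc, hanti⟩ := hρ.exists_norm_lateralParam_sub_ge hϱ hh
  obtain ⟨s₀, hs₀, himage⟩ := hW.exists_image_eq hρ hϱ hh
  refine ⟨min s₀ (K' + 1 : ℝ)⁻¹, by positivity, fun s hs => ?_⟩
  obtain ⟨hs0, hs1⟩ := hs
  rw [lt_min_iff] at hs1
  -- With s K' < 1 the map x ↦ x + s W(x) shrinks distances by at most the factor 1 - s K', so the
  -- area formula applies to the moved parametrization.
  have hsK : 0 < 1 - s * K' := by
    have h1 := (lt_inv_comm₀ hs0 (by positivity)).1 hs1.2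
    have h2 := mul_lt_mul_of_pos_left h1 hs0
    rw [mul_inv_cancel₀ hs0.ne'] at h2
    nlinarith
  have hlip := hK.add ((lipschitzWith_smul s).comp (hK'.comp hK))
  rw [← himage s ⟨hs0, hs1.1⟩, ← hρ.image_lateralParam hϱ hh, image_image]
  refine (hlip.hausdorffMeasure_image_eq_lintegral_normDet (hρ.isOpen_annulus 1 3)
    (hρ.isOpen_annulus 1 3).measurableSet subset_rfl (mul_pos hsK hc) fun x hx y hy => ?_).symm
  have h1 := hanti x hx y hy
  have h2 := hK'.dist_le_mul (lateralParam ρ ϱ h x) (lateralParam ρ ϱ h y)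
  rw [dist_eq_norm, dist_eq_norm] at h2
  set P := lateralParam ρ ϱ h x
  set Q := lateralParam ρ ϱ h y
  have h3 : P + s • W P - (Q + s • W Q) = (P - Q) + s • (W P - W Q) := by
    rw [smul_sub]; abel
  have h4 := norm_sub_norm_le (P - Q) (-(s • (W P - W Q)))
  rw [sub_neg_eq_add, norm_neg, norm_smul, Real.norm_of_nonneg hs0.le] at h4
  change _ ≤ ‖P + s • W P - (Q + s • W Q)‖
  rw [h3]
  calc (1 - s * K') * c * ‖x - y‖ = (1 - s * K') * (c * ‖x - y‖) := by ring
    _ ≤ (1 - s * K') * ‖P - Q‖ := by gcongr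
    _ ≤ ‖P - Q‖ - s * ‖W P - W Q‖ := by nlinarith
    _ ≤ _ := h4

/-- The total divergence on the lateral surface is the same for all fields with the same values of
the flow. -/
theorem IsLateralFlow.integral_div_eq {ϱ h κ : ℝ} (hϱ : 0 < ϱ) (hh : 0 < h)
    {W₁ W₂ : WithLp 2 (E × ℝ) → WithLp 2 (E × ℝ)} (hW₁ : IsLateralFlow ρ ϱ h κ W₁)
    (hW₂ : IsLateralFlow ρ ϱ h κ W₂) {d₁ d₂ : WithLp 2 (E × ℝ) → ℝ}
    (hd₁ : ∀ᵐ x ∂(Measure.hausdorffMeasure (finrank ℝ E : ℝ)).restrict (lateralSurface ρ ϱ h),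
      HasLateralDivAt ρ ϱ h W₁ x (d₁ x))
    (hd₂ : ∀ᵐ x ∂(Measure.hausdorffMeasure (finrank ℝ E : ℝ)).restrict (lateralSurface ρ ϱ h),
      HasLateralDivAt ρ ϱ h W₂ x (d₂ x))
    (hm₁ : AEStronglyMeasurable d₁
      ((Measure.hausdorffMeasure (finrank ℝ E : ℝ)).restrict (lateralSurface ρ ϱ h)))
    (hm₂ : AEStronglyMeasurable d₂
      ((Measure.hausdorffMeasure (finrank ℝ E : ℝ)).restrict (lateralSurface ρ ϱ h))) :
    ∫ x in lateralSurface ρ ϱ h, d₁ x ∂(Measure.hausdorffMeasure (finrank ℝ E : ℝ)) =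
      ∫ x in lateralSurface ρ ϱ h, d₂ x ∂(Measure.hausdorffMeasure (finrank ℝ E : ℝ)) := by
  classical
  obtain ⟨K, hK⟩ := hρ.exists_lipschitzWith_lateralParam ϱ h
  have hfin := isFiniteMeasure_lateralDensity hρ hϱ hh
  set ω := lateralDensity ρ ϱ h with hω
  set A := annulus ρ 1 3
  -- The difference quotients contain only areas of lateral surfaces and do not mention `W`;
  -- uniqueness of limits then yields the theorem.
  have key : ∀ (W : WithLp 2 (E × ℝ) → WithLp 2 (E × ℝ)) (d : WithLp 2 (E × ℝ) → ℝ),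
      IsLateralFlow ρ ϱ h κ W →
      (∀ᵐ x ∂(Measure.hausdorffMeasure (finrank ℝ E : ℝ)).restrict (lateralSurface ρ ϱ h),
        HasLateralDivAt ρ ϱ h W x (d x)) →
      AEStronglyMeasurable d
        ((Measure.hausdorffMeasure (finrank ℝ E : ℝ)).restrict (lateralSurface ρ ϱ h)) →
      Tendsto (fun s : ℝ => ((Measure.hausdorffMeasure (finrank ℝ E : ℝ)
          (lateralSurface ρ (ϱ + s) (h + κ * s))).toReal - ω.real univ) / s) (𝓝[>] 0)
        (𝓝 (∫ x in lateralSurface ρ ϱ h, d x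
          ∂(Measure.hausdorffMeasure (finrank ℝ E : ℝ)))) := by
    intro W d hW hd hm
    obtain ⟨C, hC⟩ := hW.exists_normDet_eq hρ hϱ hh
    obtain ⟨s₀, hs₀, hs⟩ := hW.exists_lintegral_eq hρ hϱ hh
    have hM := (ae_lateralDensity_iff hρ hϱ hh).2 (hC d hd)
    set P : E → (E →L[ℝ] E) → Prop := fun y M => ‖M‖ ≤ C ∧
        LinearMap.trace ℝ E (M : E →ₗ[ℝ] E) = d (lateralParam ρ ϱ h y) ∧
        ∀ s : ℝ, (fderiv ℝ (fun y => lateralParam ρ ϱ h y + s • W (lateralParam ρ ϱ h y)) y :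
            E →ₗ[ℝ] WithLp 2 (E × ℝ)).normDet = |(1 + s • M : E →L[ℝ] E).det| *
          (fderiv ℝ (lateralParam ρ ϱ h) y : E →ₗ[ℝ] WithLp 2 (E × ℝ)).normDet
    let M : E → E →L[ℝ] E := fun y => if hy : ∃ M, P y M then hy.choose else 0
    have hPM : ∀ᵐ y ∂ω, P y (M y) := by
      filter_upwards [hM] with y hy
      have hy' : ∃ M, P y M := hy
      simp only [M]
      rw [dif_pos hy']
      exact hy'.choose_spec
    have hpos : ∀ᵐ y ∂ω,
        0 < (fderiv ℝ (lateralParam ρ ϱ h) y : E →ₗ[ℝ] WithLp 2 (E × ℝ)).normDet :=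
      (ae_lateralDensity_iff hρ hϱ hh).2 (ae_normDet_fderiv_lateralParam_pos hρ hϱ hh)
    -- `M` is chosen pointwise with no measurability. The determinant is nevertheless measurable,
    -- being a.e. a quotient of two Jacobians.
    have hmeas : ∀ s : ℝ, AEMeasurable (fun y => |(1 + s • M y : E →L[ℝ] E).det|) ω := fun s => by
      refine ⟨fun y => (fderiv ℝ (fun y => lateralParam ρ ϱ h y + s • W (lateralParam ρ ϱ h y)) y :
            E →ₗ[ℝ] WithLp 2 (E × ℝ)).normDet /
          (fderiv ℝ (lateralParam ρ ϱ h) y : E →ₗ[ℝ] WithLp 2 (E × ℝ)).normDet,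
        (measurable_normDet_fderiv _).div (measurable_normDet_fderiv _), ?_⟩
      filter_upwards [hPM, hpos] with y h1 h2
      rw [h1.2.2 s, mul_div_cancel_right₀ _ h2.ne']
    have hlim := tendsto_integral_abs_det_one_add_smul one_pos (hPM.mono fun y hy => hy.1)
      fun s _ => hmeas s
    have hint : ∫ y, LinearMap.trace ℝ E (M y : E →ₗ[ℝ] E) ∂ω =
        ∫ x in lateralSurface ρ ϱ h, d x ∂(Measure.hausdorffMeasure (finrank ℝ E : ℝ)) := by
      rw [restrict_lateralSurface_eq_map hρ hϱ hh] at hm ⊢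
      rw [integral_map hK.continuous.aemeasurable hm]
      exact integral_congr_ae (hPM.mono fun y hy => hy.2.1)
    rw [hint] at hlim
    refine hlim.congr' ?_
    filter_upwards [Ioo_mem_nhdsGT hs₀] with s hs1
    have hbd : ∀ᵐ y ∂ω, ‖|(1 + s • M y : E →L[ℝ] E).det|‖ ≤ (1 + s * C) ^ finrank ℝ E := by
      filter_upwards [hPM] with y hy
      rw [Real.norm_eq_abs, abs_abs]
      exact abs_det_one_add_smul_le hy.1 hs1.1.le
    have hintegrable : Integrable (fun y => |(1 + s • M y : E →L[ℝ] E).det|) ω :=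
      Integrable.of_bound (hmeas s).aestronglyMeasurable _ hbd
    rw [integral_div, integral_sub hintegrable (integrable_const _), integral_const, smul_eq_mul,
      mul_one]
    congr 2
    rw [integral_eq_lintegral_of_nonneg_ae (ae_of_all _ fun y => abs_nonneg _)
      hintegrable.aestronglyMeasurable, ← hs s hs1, hω, lateralDensity]
    congr 1
    rw [lintegral_withDensity_eq_lintegral_mul₀' ?_ ?_]
    · refine lintegral_congr_ae ?_
      rw [EventuallyEq, ae_restrict_iff' (hρ.isOpen_annulus 1 3).measurableSet]
      filter_upwards [(ae_lateralDensity_iff hρ hϱ hh).1 hPM] with y hy hyA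
      rw [(hy hyA).2.2 s, ENNReal.ofReal_mul (abs_nonneg _), mul_comm]
      rfl
    · exact (ENNReal.measurable_ofReal.comp (measurable_normDet_fderiv _)).aemeasurable
    · exact ENNReal.measurable_ofReal.comp_aemeasurable (hmeas s)
  exact tendsto_nhds_unique (key W₁ d₁ hW₁ hd₁ hm₁) (key W₂ d₂ hW₂ hd₂ hm₂)

end LateralDivergence

/-! ### The divergence theorem on an annulus -/

section Annulus

open Module
open scoped NNReal ENNReal

variable {E : Type*} [NormedAddCommGroup E] [InnerProductSpace ℝ E] [FiniteDimensional ℝ E]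

/-- A cutoff function for the annulus `{x : a < ρ(x) < b}`. -/
def annulusCutoff (ρ : E → ℝ) (a b ε : ℝ) (x : E) : ℝ :=
  max 0 (min 1 (min (b - ρ x) (ρ x - a) / ε))

theorem annulusCutoff_nonneg (ρ : E → ℝ) (a b ε : ℝ) (x : E) : 0 ≤ annulusCutoff ρ a b ε x :=
  le_max_left _ _

theorem annulusCutoff_le_one (ρ : E → ℝ) (a b ε : ℝ) (x : E) : annulusCutoff ρ a b ε x ≤ 1 :=
  max_le zero_le_one (min_le_left _ _)

theorem annulusCutoff_eq_zero {ρ : E → ℝ} {a b ε : ℝ} (hε : 0 < ε) {x : E}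
    (hx : x ∉ annulus ρ a b) : annulusCutoff ρ a b ε x = 0 := by
  refine max_eq_left ((min_le_right _ _).trans (div_nonpos_of_nonpos_of_nonneg ?_ hε.le))
  by_contra! h
  rw [lt_min_iff] at h
  exact hx ⟨by linarith [h.2], by linarith [h.1]⟩

theorem annulusCutoff_eq_one {ρ : E → ℝ} {a b ε : ℝ} (hε : 0 < ε) {x : E}
    (hx : ε ≤ min (b - ρ x) (ρ x - a)) : annulusCutoff ρ a b ε x = 1 := by
  rw [annulusCutoff, min_eq_left ((one_le_div hε).2 hx), max_eq_right zero_le_one]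

theorem abs_annulusCutoff_sub_le (ρ : E → ℝ) (a b : ℝ) {ε : ℝ} (hε : 0 < ε) (x y : E) :
    |annulusCutoff ρ a b ε x - annulusCutoff ρ a b ε y| ≤ ε⁻¹ * |ρ x - ρ y| := by
  have h1 : |min (b - ρ x) (ρ x - a) - min (b - ρ y) (ρ y - a)| ≤ |ρ x - ρ y| := by
    refine (abs_min_sub_min_le_max _ _ _ _).trans (max_le (le_of_eq ?_) (le_of_eq ?_))
    · rw [abs_sub_comm]; congr 1; ring
    · congr 1; ring
  have h2 : |annulusCutoff ρ a b ε x - annulusCutoff ρ a b ε y| ≤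
      |min (b - ρ x) (ρ x - a) / ε - min (b - ρ y) (ρ y - a) / ε| := by
    refine (abs_max_sub_max_le_max _ _ _ _).trans (max_le (by simp) ?_)
    exact (abs_min_sub_min_le_max _ _ _ _).trans (max_le (by simp) le_rfl)
  refine h2.trans ?_
  rw [← sub_div, abs_div, abs_of_pos hε, inv_mul_eq_div]
  gcongr

theorem lineDeriv_eq_zero_of_isLocalMin {f : E → ℝ} {x v : E} (h : IsLocalMin f x) :
    lineDeriv ℝ f x v = 0 := by
  have h1 : IsLocalMin (fun t : ℝ => f (x + t • v)) 0 := by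
    have hc : ContinuousAt (fun t : ℝ => x + t • v) 0 := by fun_prop
    have h0 : ∀ᶠ y in 𝓝 (x + (0 : ℝ) • v), f x ≤ f y := by
      rw [zero_smul, add_zero]
      exact h
    filter_upwards [hc.eventually h0] with t ht
    simpa using ht
  exact h1.deriv_eq_zero

theorem abs_lineDeriv_le_of_abs_sub_le {f g : E → ℝ} {x v : E} {C : ℝ}
    (h : ∀ x y, |f x - f y| ≤ C * |g x - g y|) (hf : DifferentiableAt ℝ f x)
    (hg : DifferentiableAt ℝ g x) : |fderiv ℝ f x v| ≤ C * |fderiv ℝ g x v| := by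
  have h1 := (hf.hasFDerivAt.hasLineDerivAt v).tendsto_slope_zero_right.abs
  have h2 := ((hg.hasFDerivAt.hasLineDerivAt v).tendsto_slope_zero_right.abs).const_mul C
  refine le_of_tendsto_of_tendsto h1 h2 ?_
  filter_upwards with t
  rw [smul_eq_mul, smul_eq_mul, abs_mul, abs_mul, mul_left_comm]
  exact mul_le_mul_of_nonneg_left (h _ _) (abs_nonneg _)

variable [MeasurableSpace E] [BorelSpace E] [CompleteSpace E] {ρ : E → ℝ} (hρ : IsGauge ρ)
include hρ

/-- The gradient of the cutoff has size 1/ε but lives where ρ is within ε of a boundary value. There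
the component of `v` along ∇ρ is O(ε), since it vanishes on the boundary and `v` is Lipschitz. -/
theorem IsGauge.exists_abs_fderiv_annulusCutoff_le {v : E → E} {K : ℝ≥0} {a b : ℝ} (ha : 0 < a)
    (hab : a < b) (hv : LipschitzWith K v)
    (htan : ∀ x, ρ x = a ∨ ρ x = b → DifferentiableAt ℝ ρ x → ⟪gradient ρ x, v x⟫ = 0) :
    ∃ C : ℝ, ∀ ε > 0, ∀ x ∈ annulus ρ a b, DifferentiableAt ℝ ρ x →
      DifferentiableAt ℝ (annulusCutoff ρ a b ε) x →
      |fderiv ℝ (annulusCutoff ρ a b ε) x (v x)| ≤ C := by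
  obtain ⟨C₁, -, hC₁⟩ := hρ.exists_le_mul_norm
  obtain ⟨C₂, -, hC₂⟩ := hρ.exists_norm_le_mul
  have hb : 0 < b := ha.trans hab
  have hnear : ∀ x ∈ annulus ρ a b, DifferentiableAt ℝ ρ x → ∀ c : ℝ, (c = a ∨ c = b) →
      |fderiv ℝ ρ x (v x)| ≤ C₁ * K * C₂ * |ρ x - c| := by
    intro x hx hd c hc
    have hx0 : 0 < ρ x := ha.trans hx.1
    have hc0 : 0 < c := by rcases hc with rfl | rfl <;> assumption
    -- The radial projection of x to the boundary level; ∇ρ is the same at x and at z, so tangency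
    -- at z can be used at x.
    set z := (c / ρ x) • x
    have hz : ρ z = c := by
      rw [hρ.smul_of_nonneg (by positivity)]
      field_simp
    have h1 : ⟪gradient ρ x, v z⟫ = 0 := by
      have := htan z (by rw [hz]; exact hc) (hρ.differentiableAt_smul (by positivity) hd)
      rwa [hρ.gradient_smul (by positivity) hd] at this
    have h2 : fderiv ℝ ρ x (v x) = ⟪gradient ρ x, v x - v z⟫ := by
      rw [inner_sub_right, h1, sub_zero, inner_gradient_left]
    have h3 : ‖v x - v z‖ ≤ K * (C₂ * |ρ x - c|) := by
      have h4 := hv.dist_le_mul x z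
      rw [dist_eq_norm, dist_eq_norm] at h4
      refine h4.trans (mul_le_mul_of_nonneg_left ?_ K.2)
      have h5 : x - z = ((ρ x - c) / ρ x) • x := by
        rw [sub_div, div_self hx0.ne', sub_smul, one_smul]
      rw [h5, norm_smul, Real.norm_eq_abs, abs_div, abs_of_pos hx0, div_mul_eq_mul_div,
        div_le_iff₀ hx0]
      nlinarith [hC₂ x, abs_nonneg (ρ x - c)]
    have h6 : ∀ w, |⟪gradient ρ x, w⟫| ≤ ρ w := fun w => abs_le.2 ⟨by
      have := hρ.inner_gradient_le hd (-w)
      rw [inner_neg_right, hρ.map_neg] at this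
      linarith, hρ.inner_gradient_le hd w⟩
    rw [h2]
    calc _ ≤ ρ (v x - v z) := h6 _
      _ ≤ C₁ * ‖v x - v z‖ := hC₁ _
      _ ≤ C₁ * (K * (C₂ * |ρ x - c|)) := mul_le_mul_of_nonneg_left h3 C₁.2
      _ = _ := by ring
  refine ⟨C₁ * K * C₂, fun ε hε x hx hd hφ => ?_⟩
  by_cases hfull : ε ≤ min (b - ρ x) (ρ x - a)
  · have hmax : IsLocalMax (annulusCutoff ρ a b ε) x := by
      refine Eventually.of_forall fun y => ?_
      rw [annulusCutoff_eq_one hε hfull]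
      exact annulusCutoff_le_one ρ a b ε y
    rw [hmax.fderiv_eq_zero]
    simp only [zero_apply, abs_zero]
    positivity
  · push Not at hfull
    have h1 := abs_lineDeriv_le_of_abs_sub_le (v := v x) (abs_annulusCutoff_sub_le ρ a b hε) hφ hd
    obtain ⟨c, hc, hcε⟩ : ∃ c, (c = a ∨ c = b) ∧ |ρ x - c| ≤ ε := by
      rcases min_lt_iff.1 hfull with h | h
      · exact ⟨b, Or.inr rfl, by rw [abs_sub_comm, abs_of_pos (by linarith [hx.2])]; exact h.le⟩
      · exact ⟨a, Or.inl rfl, by rw [abs_of_pos (by linarith [hx.1])]; exact h.le⟩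
    refine h1.trans ?_
    rw [inv_mul_eq_div, div_le_iff₀ hε]
    exact (hnear x hx hd c hc).trans (mul_le_mul_of_nonneg_left hcε (by positivity))

/-- The divergence theorem on the annulus `{x : a < ρ(x) < b}` for a Lipschitz field which is
tangential at the boundary. -/
theorem IsGauge.integral_trace_fderiv_eq_zero (μ : Measure E) [μ.IsAddHaarMeasure] {v : E → E}
    {K : ℝ≥0} {a b : ℝ} (ha : 0 < a) (hab : a < b) (hv : LipschitzWith K v)
    (htan : ∀ x, ρ x = a ∨ ρ x = b → DifferentiableAt ℝ ρ x → ⟪gradient ρ x, v x⟫ = 0) :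
    ∫ x in annulus ρ a b, LinearMap.trace ℝ E (fderiv ℝ v x : E →ₗ[ℝ] E) ∂μ = 0 := by
  obtain ⟨Cρ, hCρ⟩ := hρ.exists_lipschitzWith
  obtain ⟨C, hC⟩ := hρ.exists_abs_fderiv_annulusCutoff_le ha hab hv htan
  have hA : MeasurableSet (annulus ρ a b) := (hρ.isOpen_annulus a b).measurableSet
  have hfin : IsFiniteMeasure (μ.restrict (annulus ρ a b)) :=
    ⟨by rw [Measure.restrict_apply_univ]; exact hρ.measure_annulus_lt_top μ a b⟩
  set e := stdOrthonormalBasis ℝ E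
  let φ : ℝ → E → ℝ := annulusCutoff ρ a b
  have hφlip : ∀ ε > 0, ∃ K' : ℝ≥0, LipschitzWith K' (φ ε) := fun ε hε => by
    refine lipschitzWith_of_norm_sub_le (C := ε⁻¹ * Cρ) fun x y => ?_
    have h1 := hCρ.dist_le_mul x y
    rw [Real.dist_eq, dist_eq_norm] at h1
    rw [Real.norm_eq_abs, mul_assoc]
    exact (abs_annulusCutoff_sub_le ρ a b hε x y).trans
      (mul_le_mul_of_nonneg_left h1 (inv_nonneg.2 hε.le))
  have hvi : ∀ i, LipschitzWith K fun x => ⟪e i, v x⟫ := fun i =>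
    LipschitzWith.of_dist_le_mul fun x y => by
      rw [Real.dist_eq, ← inner_sub_right]
      refine (abs_real_inner_le_norm _ _).trans ?_
      rw [e.norm_eq_one, one_mul, ← dist_eq_norm]
      exact hv.dist_le_mul x y
  have hsupp : ∀ ε > 0, HasCompactSupport (φ ε) := fun ε hε =>
    HasCompactSupport.of_support_subset_isCompact (hρ.isBounded_annulus a b).isCompact_closure
      fun x hx => subset_closure (by
        by_contra h
        exact hx (annulusCutoff_eq_zero hε h))
  -- Integration by parts of Lipschitz functions on the whole space; outside the annulus both
  -- integrands vanish, the second because the cutoff is minimal there.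
  have hparts : ∀ ε > 0, ∀ i,
      ∫ x in annulus ρ a b, lineDeriv ℝ (fun x => ⟪e i, v x⟫) x (e i) * φ ε x ∂μ =
        ∫ x in annulus ρ a b, lineDeriv ℝ (φ ε) x (-e i) * ⟪e i, v x⟫ ∂μ := fun ε hε i => by
    obtain ⟨K', hK'⟩ := hφlip ε hε
    rw [setIntegral_eq_integral_of_forall_compl_eq_zero fun x hx => by
        rw [show φ ε x = 0 from annulusCutoff_eq_zero hε hx, mul_zero],
      setIntegral_eq_integral_of_forall_compl_eq_zero fun x hx => by
        rw [lineDeriv_eq_zero_of_isLocalMin (Eventually.of_forall fun y => by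
          rw [show φ ε x = 0 from annulusCutoff_eq_zero hε hx]
          exact annulusCutoff_nonneg ρ a b ε y), zero_mul]]
    exact (hvi i).integral_lineDeriv_mul_eq hK' (hsupp ε hε) (e i)
  have hvbdd : ∃ R : ℝ, ∀ x ∈ annulus ρ a b, ‖v x‖ ≤ R := by
    obtain ⟨R, hR⟩ := (hρ.isBounded_annulus a b).exists_norm_le
    refine ⟨‖v 0‖ + K * R, fun x hx => ?_⟩
    have h1 := hv.dist_le_mul x 0
    rw [dist_eq_norm, dist_zero_right] at h1
    have h2 := norm_le_norm_add_norm_sub' (v x) (v 0)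
    have h3 : (K : ℝ) * ‖x‖ ≤ K * R := mul_le_mul_of_nonneg_left (hR x hx) K.2
    linarith
  obtain ⟨R, hR⟩ := hvbdd
  have hmeasF : ∀ ε > 0, ∀ i, AEStronglyMeasurable
      (fun x => lineDeriv ℝ (fun x => ⟪e i, v x⟫) x (e i) * φ ε x)
      (μ.restrict (annulus ρ a b)) := fun ε hε i => by
    obtain ⟨K', hK'⟩ := hφlip ε hε
    exact (aestronglyMeasurable_lineDeriv (hvi i).continuous _).mul
      hK'.continuous.aestronglyMeasurable
  have hmeasG : ∀ ε > 0, ∀ i, AEStronglyMeasurable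
      (fun x => lineDeriv ℝ (φ ε) x (-e i) * ⟪e i, v x⟫)
      (μ.restrict (annulus ρ a b)) := fun ε hε i => by
    obtain ⟨K', hK'⟩ := hφlip ε hε
    exact (aestronglyMeasurable_lineDeriv hK'.continuous _).mul
      (hvi i).continuous.aestronglyMeasurable
  have hbdF : ∀ ε i x, ‖lineDeriv ℝ (fun x => ⟪e i, v x⟫) x (e i) * φ ε x‖ ≤ K := fun ε i x => by
    have h1 := norm_lineDeriv_le_of_lipschitz ℝ (hvi i) (x₀ := x) (v := e i)
    rw [e.norm_eq_one, mul_one] at h1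
    rw [norm_mul, Real.norm_of_nonneg (annulusCutoff_nonneg ρ a b ε x)]
    calc _ ≤ (K : ℝ) * 1 := mul_le_mul h1 (annulusCutoff_le_one ρ a b ε x)
          (annulusCutoff_nonneg ρ a b ε x) K.2
      _ = K := mul_one _
  have hintF : ∀ ε > 0, ∀ i, Integrable
      (fun x => lineDeriv ℝ (fun x => ⟪e i, v x⟫) x (e i) * φ ε x)
      (μ.restrict (annulus ρ a b)) := fun ε hε i =>
    Integrable.of_bound (hmeasF ε hε i) K (ae_of_all _ (hbdF ε i))
  have hintG : ∀ ε > 0, ∀ i, Integrable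
      (fun x => lineDeriv ℝ (φ ε) x (-e i) * ⟪e i, v x⟫)
      (μ.restrict (annulus ρ a b)) := fun ε hε i => by
    obtain ⟨K', hK'⟩ := hφlip ε hε
    refine Integrable.of_bound (hmeasG ε hε i) (K' * R) ?_
    filter_upwards [ae_restrict_mem hA] with x hx
    have h1 := norm_lineDeriv_le_of_lipschitz ℝ hK' (x₀ := x) (v := -e i)
    rw [norm_neg, e.norm_eq_one, mul_one] at h1
    have h2 : ‖⟪e i, v x⟫‖ ≤ R := by
      refine (abs_real_inner_le_norm _ _).trans ?_
      rw [e.norm_eq_one, one_mul]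
      exact hR x hx
    rw [norm_mul]
    exact mul_le_mul h1 h2 (norm_nonneg _) K'.2
  have hdiv : ∀ᵐ x ∂μ.restrict (annulus ρ a b), ∀ ε : ℝ,
      ∑ i, lineDeriv ℝ (fun x => ⟪e i, v x⟫) x (e i) * φ ε x =
        LinearMap.trace ℝ E (fderiv ℝ v x : E →ₗ[ℝ] E) * φ ε x := by
    filter_upwards [ae_restrict_of_ae hv.ae_differentiableAt] with x hx ε
    rw [← Finset.sum_mul, LinearMap.trace_eq_sum_inner _ e]
    congr 1
    refine Finset.sum_congr rfl fun i _ => ?_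
    have h1 : HasFDerivAt (fun x => ⟪e i, v x⟫) ((innerSL ℝ (e i)) ∘L fderiv ℝ v x) x :=
      (innerSL ℝ (e i)).hasFDerivAt.comp x hx.hasFDerivAt
    rw [(h1.hasLineDerivAt (e i)).lineDeriv]
    rfl
  have hsum : ∀ ε > 0,
      ∫ x in annulus ρ a b, LinearMap.trace ℝ E (fderiv ℝ v x : E →ₗ[ℝ] E) * φ ε x ∂μ =
        ∫ x in annulus ρ a b, ∑ i, lineDeriv ℝ (φ ε) x (-e i) * ⟪e i, v x⟫ ∂μ := fun ε hε => by
    rw [integral_finsetSum _ fun i _ => hintG ε hε i,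
      ← Finset.sum_congr rfl fun i _ => hparts ε hε i,
      ← integral_finsetSum _ fun i _ => hintF ε hε i]
    exact integral_congr_ae (hdiv.mono fun x hx => (hx ε).symm)
  have hevent : ∀ x ∈ annulus ρ a b, ∀ᶠ ε : ℝ in 𝓝[>] 0, φ ε x = 1 := fun x hx => by
    have h1 : 0 < min (b - ρ x) (ρ x - a) := lt_min (by linarith [hx.2]) (by linarith [hx.1])
    filter_upwards [Ioo_mem_nhdsGT h1] with ε hε
    exact annulusCutoff_eq_one hε.1 hε.2.le
  have hlimF : Tendsto (fun ε : ℝ => ∫ x in annulus ρ a b,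
      LinearMap.trace ℝ E (fderiv ℝ v x : E →ₗ[ℝ] E) * φ ε x ∂μ) (𝓝[>] 0)
      (𝓝 (∫ x in annulus ρ a b, LinearMap.trace ℝ E (fderiv ℝ v x : E →ₗ[ℝ] E) ∂μ)) := by
    refine tendsto_integral_filter_of_dominated_convergence
      (fun _ => ∑ _i : Fin (finrank ℝ E), (K : ℝ)) ?_ ?_ (integrable_const _) ?_
    · filter_upwards [self_mem_nhdsWithin] with ε hε
      exact (integrable_finsetSum _ fun i _ => hintF ε hε i).aestronglyMeasurable.congr
        (hdiv.mono fun x hx => hx ε)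
    · filter_upwards with ε
      filter_upwards [hdiv] with x hx
      rw [← hx ε]
      exact norm_sum_le_of_le _ fun i _ => hbdF ε i x
    · filter_upwards [ae_restrict_mem hA] with x hx
      refine tendsto_const_nhds.congr' ?_
      filter_upwards [hevent x hx] with ε hε
      rw [hε, mul_one]
  -- The boundary term: it is bounded uniformly in ε by the tangency estimate, and for each point it
  -- vanishes once the cutoff equals 1 there, its maximum.
  have hlimG : Tendsto (fun ε : ℝ => ∫ x in annulus ρ a b,
      ∑ i, lineDeriv ℝ (φ ε) x (-e i) * ⟪e i, v x⟫ ∂μ) (𝓝[>] 0)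
      (𝓝 (∫ _x in annulus ρ a b, (0 : ℝ) ∂μ)) := by
    refine tendsto_integral_filter_of_dominated_convergence
      (fun _ => C) ?_ ?_ (integrable_const _) ?_
    · filter_upwards [self_mem_nhdsWithin] with ε hε
      exact (integrable_finsetSum _ fun i _ => hintG ε hε i).aestronglyMeasurable
    · filter_upwards [self_mem_nhdsWithin] with ε hε
      obtain ⟨K', hK'⟩ := hφlip ε hε
      filter_upwards [ae_restrict_mem hA, ae_restrict_of_ae (hρ.ae_differentiableAt μ),
        ae_restrict_of_ae hK'.ae_differentiableAt] with x hxA hx1 hx2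
      have h1 : ∑ i, lineDeriv ℝ (φ ε) x (-e i) * ⟪e i, v x⟫ = -fderiv ℝ (φ ε) x (v x) := by
        conv_rhs => rw [← e.sum_repr' (v x), map_sum, ← Finset.sum_neg_distrib]
        refine Finset.sum_congr rfl fun i _ => ?_
        rw [hx2.lineDeriv_eq_fderiv, (fderiv ℝ (φ ε) x).map_neg, map_smul, smul_eq_mul]
        ring
      rw [h1, norm_neg]
      exact hC ε hε x hxA hx1 hx2
    · filter_upwards [ae_restrict_mem hA] with x hx
      refine tendsto_const_nhds.congr' ?_
      filter_upwards [hevent x hx] with ε hε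
      refine (Finset.sum_eq_zero fun i _ => ?_).symm
      have hmin : IsLocalMin (fun y => -φ ε y) x := Eventually.of_forall fun y => by
        change -φ ε x ≤ -φ ε y
        rw [hε]
        exact neg_le_neg (annulusCutoff_le_one ρ a b ε y)
      have h2 : lineDeriv ℝ (fun y => -φ ε y) x (-e i) = 0 := lineDeriv_eq_zero_of_isLocalMin hmin
      have h3 : lineDeriv ℝ (fun y => -φ ε y) x (-e i) = -lineDeriv ℝ (φ ε) x (-e i) := by
        simp only [lineDeriv]
        exact deriv.fun_neg
      rw [h3, neg_eq_zero] at h2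
      rw [h2, zero_mul]
  rw [integral_zero] at hlimG
  refine tendsto_nhds_unique hlimF (hlimG.congr' ?_)
  filter_upwards [self_mem_nhdsWithin] with ε hε
  exact (hsum ε hε).symm

end Annulus

/-! ### The boundary of a hollow cylinder -/

section HollowCylinder

open Module
open scoped NNReal ENNReal

variable {E : Type*} [NormedAddCommGroup E] [InnerProductSpace ℝ E]

/-- The set `{x : r < ρ(x') < R, |x_n| < h}`. -/
def hollowCylinder (ρ : E → ℝ) (r R h : ℝ) : Set (WithLp 2 (E × ℝ)) :=
  {x | r < ρ x.fst ∧ ρ x.fst < R ∧ |x.snd| < h}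

/-- The horizontal surface `{x : r < ρ(x') < R, x_n = c}`. -/
def flatFacet (ρ : E → ℝ) (r R c : ℝ) : Set (WithLp 2 (E × ℝ)) :=
  {x | x.fst ∈ annulus ρ r R ∧ x.snd = c}

/-- The set `{x : ρ(x') = ϱ, x_n = c}`. -/
def cylinderRidge (ρ : E → ℝ) (ϱ c : ℝ) : Set (WithLp 2 (E × ℝ)) :=
  {x | ρ x.fst = ϱ ∧ x.snd = c}

theorem isometry_toLp_left (c : ℝ) :
    Isometry fun y : E => (WithLp.toLp 2 (y, c) : WithLp 2 (E × ℝ)) :=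
  Isometry.of_dist_eq fun x y => by
    rw [dist_eq_norm, dist_eq_norm, ← WithLp.toLp_sub, Prod.mk_sub_mk, sub_self,
      WithLp.norm_toLp_fst]

theorem flatFacet_eq_image (ρ : E → ℝ) (r R c : ℝ) :
    flatFacet ρ r R c = (fun y : E => WithLp.toLp 2 (y, c)) '' annulus ρ r R := by
  ext x
  constructor
  · rintro ⟨h1, h2⟩
    exact ⟨x.fst, h1, withLp_ext rfl h2.symm⟩
  · rintro ⟨y, hy, rfl⟩
    exact ⟨hy, rfl⟩

theorem cylinderRidge_eq_image (ρ : E → ℝ) (ϱ c : ℝ) :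
    cylinderRidge ρ ϱ c = (fun y : E => WithLp.toLp 2 (y, c)) '' {y | ρ y = ϱ} := by
  ext x
  constructor
  · rintro ⟨h1, h2⟩
    exact ⟨x.fst, h1, withLp_ext rfl h2.symm⟩
  · rintro ⟨y, hy, rfl⟩
    exact ⟨hy, rfl⟩

variable [FiniteDimensional ℝ E] {ρ : E → ℝ} (hρ : IsGauge ρ)
include hρ

theorem isOpen_hollowCylinder (r R h : ℝ) : IsOpen (hollowCylinder ρ r R h) := by
  have hc := hρ.continuous.comp (WithLp.continuous_fst 2 E ℝ)
  exact (isOpen_lt continuous_const hc).inter ((isOpen_lt hc continuous_const).inter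
    (isOpen_lt (continuous_abs.comp (WithLp.continuous_snd 2 E ℝ)) continuous_const))

theorem closure_hollowCylinder {r R h : ℝ} (hr : 0 < r) (hrR : r < R) (hh : 0 < h) :
    closure (hollowCylinder ρ r R h) = {x | r ≤ ρ x.fst ∧ ρ x.fst ≤ R ∧ |x.snd| ≤ h} := by
  have hc := hρ.continuous.comp (WithLp.continuous_fst 2 E ℝ)
  apply Subset.antisymm
  · refine closure_minimal (fun x hx => ⟨hx.1.le, hx.2.1.le, hx.2.2.le⟩) ?_
    exact (isClosed_le continuous_const hc).inter ((isClosed_le hc continuous_const).inter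
      (isClosed_le (continuous_abs.comp (WithLp.continuous_snd 2 E ℝ)) continuous_const))
  · rintro x ⟨h1, h2, h3⟩
    have hx0 : 0 < ρ x.fst := hr.trans_le h1
    -- A path from x into the open set, moving the radius toward (r + R)/2 and the height toward 0.
    let γ : ℝ → WithLp 2 (E × ℝ) := fun s =>
      WithLp.toLp 2 ((((1 - s) * ρ x.fst + s * ((r + R) / 2)) / ρ x.fst) • x.fst, (1 - s) * x.snd)
    have hγ0 : γ 0 = x := by
      refine withLp_ext ?_ ?_
      · change (((1 - 0) * ρ x.fst + 0 * ((r + R) / 2)) / ρ x.fst) • x.fst = x.fst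
        rw [sub_zero, one_mul, zero_mul, add_zero, div_self hx0.ne', one_smul]
      · change (1 - 0) * x.snd = x.snd
        ring
    have hγ : Tendsto γ (𝓝[>] 0) (𝓝 x) := by
      have : Continuous γ := by
        refine (WithLp.prod_continuous_toLp 2 E ℝ).comp ?_
        fun_prop
      have h := this.tendsto 0
      rw [hγ0] at h
      exact h.mono_left nhdsWithin_le_nhds
    refine mem_closure_of_tendsto hγ ?_
    filter_upwards [Ioo_mem_nhdsGT (zero_lt_one (α := ℝ))] with s hs
    have hval : ρ (γ s).fst = (1 - s) * ρ x.fst + s * ((r + R) / 2) := by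
      change ρ ((((1 - s) * ρ x.fst + s * ((r + R) / 2)) / ρ x.fst) • x.fst) = _
      have h4 : 0 ≤ (1 - s) * ρ x.fst + s * ((r + R) / 2) := by
        have := sub_pos.2 hs.2
        have := hs.1
        have : 0 < R := hr.trans hrR
        positivity
      rw [hρ.smul_of_nonneg (by positivity), div_mul_cancel₀ _ hx0.ne']
    have hs1 := sub_pos.2 hs.2
    have hs0 := hs.1
    refine ⟨?_, ?_, ?_⟩
    · rw [hval]; nlinarith
    · rw [hval]; nlinarith
    · change |(1 - s) * x.snd| < h
      rw [abs_mul, abs_of_pos hs1]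
      nlinarith

theorem mem_frontier_hollowCylinder {r R h : ℝ} (hr : 0 < r) (hrR : r < R) (hh : 0 < h)
    {x : WithLp 2 (E × ℝ)} : x ∈ frontier (hollowCylinder ρ r R h) ↔
      (r ≤ ρ x.fst ∧ ρ x.fst ≤ R ∧ |x.snd| ≤ h) ∧ (ρ x.fst = r ∨ ρ x.fst = R ∨ |x.snd| = h) := by
  rw [(isOpen_hollowCylinder hρ r R h).frontier_eq, closure_hollowCylinder hρ hr hrR hh]
  constructor
  · rintro ⟨⟨h1, h2, h3⟩, h4⟩
    refine ⟨⟨h1, h2, h3⟩, ?_⟩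
    by_contra! h5
    exact h4 ⟨h1.lt_of_ne' h5.1, h2.lt_of_ne h5.2.1, h3.lt_of_ne h5.2.2⟩
  · rintro ⟨h1, h2⟩
    refine ⟨h1, fun h3 => ?_⟩
    rcases h2 with h2 | h2 | h2
    · exact h3.1.ne' h2
    · exact h3.2.1.ne h2
    · exact h3.2.2.ne h2

theorem frontier_hollowCylinder {r R h : ℝ} (hr : 0 < r) (hrR : r < R) (hh : 0 < h) :
    frontier (hollowCylinder ρ r R h) =
      (flatFacet ρ r R h ∪ (flatFacet ρ r R (-h) ∪
        (lateralSurface ρ R h ∪ lateralSurface ρ r h))) ∪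
      ((cylinderRidge ρ R h ∪ cylinderRidge ρ R (-h)) ∪
        (cylinderRidge ρ r h ∪ cylinderRidge ρ r (-h))) := by
  ext x
  rw [mem_frontier_hollowCylinder hρ hr hrR hh]
  constructor
  · rintro ⟨⟨h1, h2, h3⟩, h4⟩
    rcases h3.lt_or_eq with h5 | h5
    · left; right; right
      rcases h4 with h4 | h4 | h4
      · exact Or.inr ⟨h4, h5⟩
      · exact Or.inl ⟨h4, h5⟩
      · exact absurd h4 h5.ne
    · rcases h1.lt_or_eq with h6 | h6
      · rcases h2.lt_or_eq with h7 | h7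
        · left
          rcases eq_or_eq_neg_of_abs_eq h5 with h8 | h8
          · exact Or.inl ⟨⟨h6, h7⟩, h8⟩
          · exact Or.inr (Or.inl ⟨⟨h6, h7⟩, h8⟩)
        · right; left
          rcases eq_or_eq_neg_of_abs_eq h5 with h8 | h8
          · exact Or.inl ⟨h7, h8⟩
          · exact Or.inr ⟨h7, h8⟩
      · right; right
        rcases eq_or_eq_neg_of_abs_eq h5 with h8 | h8
        · exact Or.inl ⟨h6.symm, h8⟩
        · exact Or.inr ⟨h6.symm, h8⟩
  · rintro ((⟨⟨h1, h2⟩, h3⟩ | ⟨⟨h1, h2⟩, h3⟩ | ⟨h1, h2⟩ | ⟨h1, h2⟩) |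
      ((⟨h1, h2⟩ | ⟨h1, h2⟩) | (⟨h1, h2⟩ | ⟨h1, h2⟩)))
    · have : |x.snd| = h := by rw [h3, abs_of_pos hh]
      exact ⟨⟨h1.le, h2.le, this.le⟩, Or.inr (Or.inr this)⟩
    · have : |x.snd| = h := by rw [h3, abs_neg, abs_of_pos hh]
      exact ⟨⟨h1.le, h2.le, this.le⟩, Or.inr (Or.inr this)⟩
    · exact ⟨⟨h1 ▸ hrR.le, h1.le, h2.le⟩, Or.inr (Or.inl h1)⟩
    · exact ⟨⟨h1.ge, h1 ▸ hrR.le, h2.le⟩, Or.inl h1⟩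
    all_goals
      have : |x.snd| = h := by simp [h2, abs_of_pos hh]
      exact ⟨⟨by linarith, by linarith, this.le⟩, Or.inr (Or.inr this)⟩

variable [MeasurableSpace E] [BorelSpace E]

/-- The level set lies in the frontier of the convex sublevel set, since (1 + s) • y leaves it for
every s > 0, and frontiers of convex sets are null. -/
theorem IsGauge.measure_level_eq_zero (μ : Measure E) [μ.IsAddHaarMeasure] {ϱ : ℝ} (hϱ : 0 < ϱ) :
    μ {y | ρ y = ϱ} = 0 := by
  have hconv : Convex ℝ {y | ρ y ≤ ϱ} := by
    intro x hx y hy a b ha hb hab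
    have h1 := hρ.add_le (a • x) (b • y)
    rw [hρ.smul_of_nonneg ha, hρ.smul_of_nonneg hb] at h1
    have hx : ρ x ≤ ϱ := hx
    have hy : ρ y ≤ ϱ := hy
    change ρ (a • x + b • y) ≤ ϱ
    nlinarith
  refine measure_mono_null (fun y hy => ?_) (hconv.addHaar_frontier μ)
  have hy : ρ y = ϱ := hy
  refine ⟨subset_closure hy.le, fun hint => ?_⟩
  have hc : Tendsto (fun s : ℝ => (1 + s) • y) (𝓝[>] 0) (𝓝 y) := by
    have h1 : Continuous fun s : ℝ => (1 + s) • y := by fun_prop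
    have h2 := h1.tendsto 0
    rw [add_zero, one_smul] at h2
    exact h2.mono_left nhdsWithin_le_nhds
  obtain ⟨s, hs, hs0⟩ := ((hc.eventually (mem_interior_iff_mem_nhds.1 hint)).and
    self_mem_nhdsWithin).exists
  have hs0 : 0 < s := hs0
  have hs : ρ ((1 + s) • y) ≤ ϱ := hs
  rw [hρ.smul_of_nonneg (by positivity), hy] at hs
  nlinarith

theorem hausdorffMeasure_cylinderRidge {ϱ : ℝ} (hϱ : 0 < ϱ) (c : ℝ) :
    Measure.hausdorffMeasure (finrank ℝ E : ℝ) (cylinderRidge ρ ϱ c) = 0 := by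
  rw [cylinderRidge_eq_image, (isometry_toLp_left c).hausdorffMeasure_image
    (Or.inl (Nat.cast_nonneg _))]
  exact hρ.measure_level_eq_zero _ hϱ

theorem measurableSet_flatFacet (r R c : ℝ) : MeasurableSet (flatFacet ρ r R c) :=
  ((hρ.isOpen_annulus r R).preimage (WithLp.continuous_fst 2 E ℝ)).measurableSet.inter
    (isClosed_eq (WithLp.continuous_snd 2 E ℝ) continuous_const).measurableSet

omit hρ in
theorem measurableEmbedding_toLp_left (c : ℝ) :
    MeasurableEmbedding fun y : E => (WithLp.toLp 2 (y, c) : WithLp 2 (E × ℝ)) :=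
  (isometry_toLp_left c).isClosedEmbedding.measurableEmbedding

omit hρ in
theorem restrict_flatFacet_eq_map (r R c : ℝ) :
    (Measure.hausdorffMeasure (finrank ℝ E : ℝ)).restrict (flatFacet ρ r R c) =
      ((Measure.hausdorffMeasure (finrank ℝ E : ℝ)).restrict (annulus ρ r R)).map
        fun y => WithLp.toLp 2 (y, c) := by
  have h1 := (isometry_toLp_left (E := E) c).map_hausdorffMeasure
    (d := (finrank ℝ E : ℝ)) (Or.inl (Nat.cast_nonneg _))
  have h2 : annulus ρ r R = (fun y : E => (WithLp.toLp 2 (y, c) : WithLp 2 (E × ℝ))) ⁻¹'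
      flatFacet ρ r R c := by
    ext y
    exact ⟨fun h => ⟨h, rfl⟩, fun h => h.1⟩
  conv_rhs => rw [h2]
  rw [← (measurableEmbedding_toLp_left c).restrict_map, h1, Measure.restrict_restrict_of_subset]
  rw [flatFacet_eq_image]
  exact image_subset_range _ _

omit hρ in
theorem ae_flatFacet_iff {r R c : ℝ} {p : WithLp 2 (E × ℝ) → Prop} :
    (∀ᵐ x ∂(Measure.hausdorffMeasure (finrank ℝ E : ℝ)).restrict (flatFacet ρ r R c), p x) ↔
      ∀ᵐ y ∂(Measure.hausdorffMeasure (finrank ℝ E : ℝ)).restrict (annulus ρ r R),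
        p (WithLp.toLp 2 (y, c)) := by
  rw [restrict_flatFacet_eq_map, (measurableEmbedding_toLp_left c).ae_map_iff]

omit hρ in
theorem integral_flatFacet {r R c : ℝ} (f : WithLp 2 (E × ℝ) → ℝ) :
    ∫ x in flatFacet ρ r R c, f x ∂(Measure.hausdorffMeasure (finrank ℝ E : ℝ)) =
      ∫ y in annulus ρ r R, f (WithLp.toLp 2 (y, c))
        ∂(Measure.hausdorffMeasure (finrank ℝ E : ℝ)) := by
  rw [restrict_flatFacet_eq_map, (measurableEmbedding_toLp_left c).integral_map]

/-- The ridges are isometric copies of level sets of ρ, which are null. All later a.e. statements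
and integrals split over the four facets. -/
theorem surfaceMeasure_hollowCylinder {r R h : ℝ} (hr : 0 < r) (hrR : r < R) (hh : 0 < h) :
    surfaceMeasure (hollowCylinder ρ r R h) =
      (Measure.hausdorffMeasure (finrank ℝ E : ℝ)).restrict (flatFacet ρ r R h) +
      ((Measure.hausdorffMeasure (finrank ℝ E : ℝ)).restrict (flatFacet ρ r R (-h)) +
      ((Measure.hausdorffMeasure (finrank ℝ E : ℝ)).restrict (lateralSurface ρ R h) +
      (Measure.hausdorffMeasure (finrank ℝ E : ℝ)).restrict (lateralSurface ρ r h))) := by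
  have hdim : ((finrank ℝ (WithLp 2 (E × ℝ)) : ℝ) - 1) = (finrank ℝ E : ℝ) := by
    rw [finrank_withLp_prod]; push_cast; ring
  have hL : ∀ ϱ, MeasurableSet (lateralSurface ρ ϱ h) := fun ϱ => measurableSet_lateralSurface hρ ϱ h
  have hR : 0 < R := hr.trans hrR
  rw [surfaceMeasure, hdim, frontier_hollowCylinder hρ hr hrR hh,
    Measure.restrict_congr_set (union_ae_eq_left_of_ae_eq_empty (ae_eq_empty.2 ?_)),
    Measure.restrict_union ?_ ((measurableSet_flatFacet hρ r R _).union ((hL R).union (hL r))),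
    Measure.restrict_union ?_ ((hL R).union (hL r)), Measure.restrict_union ?_ (hL r)]
  · refine disjoint_left.2 fun x hx hx' => ?_
    exact hrR.ne (hx'.1.symm.trans hx.1)
  · refine disjoint_left.2 fun x hx hx' => ?_
    have h1 : |x.snd| = h := by rw [hx.2, abs_neg, abs_of_pos hh]
    rcases hx' with hx' | hx' <;> exact hx'.2.ne h1
  · refine disjoint_left.2 fun x hx hx' => ?_
    have h1 : |x.snd| = h := by rw [hx.2, abs_of_pos hh]
    rcases hx' with hx' | hx' | hx'
    · have h2 := hx.2.symm.trans hx'.2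
      linarith
    · exact hx'.2.ne h1
    · exact hx'.2.ne h1
  · refine measure_union_null (measure_union_null ?_ ?_) (measure_union_null ?_ ?_)
    exacts [hausdorffMeasure_cylinderRidge hρ hR _, hausdorffMeasure_cylinderRidge hρ hR _,
      hausdorffMeasure_cylinderRidge hρ hr _, hausdorffMeasure_cylinderRidge hρ hr _]

theorem isFiniteMeasure_lateralSurface {ϱ h : ℝ} (hϱ : 0 < ϱ) (hh : 0 < h) :
    IsFiniteMeasure ((Measure.hausdorffMeasure (finrank ℝ E : ℝ)).restrict
      (lateralSurface ρ ϱ h)) := by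
  have := isFiniteMeasure_lateralDensity hρ hϱ hh
  rw [restrict_lateralSurface_eq_map hρ hϱ hh]
  infer_instance

theorem isFiniteMeasure_flatFacet (r R c : ℝ) :
    IsFiniteMeasure ((Measure.hausdorffMeasure (finrank ℝ E : ℝ)).restrict
      (flatFacet ρ r R c)) := by
  have : IsFiniteMeasure ((Measure.hausdorffMeasure (finrank ℝ E : ℝ)).restrict
    (annulus ρ r R)) := ⟨by
      rw [Measure.restrict_apply_univ]
      exact hρ.measure_annulus_lt_top _ r R⟩
  rw [restrict_flatFacet_eq_map]
  infer_instance

theorem isFiniteMeasure_surfaceMeasure_hollowCylinder {r R h : ℝ} (hr : 0 < r) (hrR : r < R)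
    (hh : 0 < h) : IsFiniteMeasure (surfaceMeasure (hollowCylinder ρ r R h)) := by
  have h1 := isFiniteMeasure_lateralSurface hρ hr hh
  have h2 := isFiniteMeasure_lateralSurface hρ (hr.trans hrR) hh
  have h3 := isFiniteMeasure_flatFacet hρ r R h
  have h4 := isFiniteMeasure_flatFacet hρ r R (-h)
  rw [surfaceMeasure_hollowCylinder hρ hr hrR hh]
  infer_instance

theorem ae_surfaceMeasure_hollowCylinder_iff {r R h : ℝ} (hr : 0 < r) (hrR : r < R) (hh : 0 < h)
    {p : WithLp 2 (E × ℝ) → Prop} : (∀ᵐ x ∂surfaceMeasure (hollowCylinder ρ r R h), p x) ↔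
      (∀ᵐ x ∂(Measure.hausdorffMeasure (finrank ℝ E : ℝ)).restrict (flatFacet ρ r R h), p x) ∧
      (∀ᵐ x ∂(Measure.hausdorffMeasure (finrank ℝ E : ℝ)).restrict (flatFacet ρ r R (-h)), p x) ∧
      (∀ᵐ x ∂(Measure.hausdorffMeasure (finrank ℝ E : ℝ)).restrict (lateralSurface ρ R h), p x) ∧
      (∀ᵐ x ∂(Measure.hausdorffMeasure (finrank ℝ E : ℝ)).restrict (lateralSurface ρ r h),
        p x) := by
  rw [surfaceMeasure_hollowCylinder hρ hr hrR hh, ae_add_measure_iff, ae_add_measure_iff,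
    ae_add_measure_iff]

theorem IsGauge.annulus_nonempty [Nontrivial E] {a b : ℝ} (ha : 0 ≤ a) (hab : a < b) :
    (annulus ρ a b).Nonempty := by
  obtain ⟨x, hx⟩ := exists_ne (0 : E)
  have h := hρ.pos x hx
  have h1 : ρ (((a + b) / 2 / ρ x) • x) = (a + b) / 2 := by
    have : 0 < b := ha.trans_lt hab
    rw [hρ.smul_of_nonneg (by positivity), div_mul_cancel₀ _ h.ne']
  exact ⟨_, by rw [h1]; linarith, by rw [h1]; linarith⟩

theorem IsGauge.ae_annulus_neBot [Nontrivial E] (μ : Measure E) [μ.IsAddHaarMeasure] {a b : ℝ}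
    (ha : 0 ≤ a) (hab : a < b) : (ae (μ.restrict (annulus ρ a b))).NeBot := by
  rw [ae_neBot, Ne, Measure.restrict_eq_zero]
  exact ((hρ.isOpen_annulus a b).measure_pos μ (hρ.annulus_nonempty ha hab)).ne'

theorem ae_flatFacet_neBot [Nontrivial E] {r R : ℝ} (hr : 0 ≤ r) (hrR : r < R) (c : ℝ) :
    (ae ((Measure.hausdorffMeasure (finrank ℝ E : ℝ)).restrict (flatFacet ρ r R c))).NeBot := by
  have := hρ.ae_annulus_neBot (Measure.hausdorffMeasure (finrank ℝ E : ℝ)) hr hrR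
  refine ⟨fun h => ?_⟩
  have h1 : ∀ᵐ x ∂(Measure.hausdorffMeasure (finrank ℝ E : ℝ)).restrict (flatFacet ρ r R c),
      False := by rw [h]; trivial
  exact (ae_flatFacet_iff.1 h1).exists.elim fun _ h => h

theorem ae_lateralSurface_neBot [Nontrivial E] {ϱ h : ℝ} (hϱ : 0 < ϱ) (hh : 0 < h) :
    (ae ((Measure.hausdorffMeasure (finrank ℝ E : ℝ)).restrict (lateralSurface ρ ϱ h))).NeBot := by
  have := hρ.ae_annulus_neBot (Measure.hausdorffMeasure (finrank ℝ E : ℝ)) zero_le_one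
    (show (1 : ℝ) < 3 by norm_num)
  refine ⟨fun h' => ?_⟩
  have h1 : ∀ᵐ x ∂(Measure.hausdorffMeasure (finrank ℝ E : ℝ)).restrict (lateralSurface ρ ϱ h),
      False := by rw [h']; trivial
  have h2 := (ae_restrict_iff' (hρ.isOpen_annulus 1 3).measurableSet).2
    ((ae_lateralSurface_iff hρ hϱ hh).1 h1)
  exact h2.exists.elim fun _ h => h

theorem ae_lateralSurface_differentiableAt {ϱ h : ℝ} (hϱ : 0 < ϱ) (hh : 0 < h) :
    ∀ᵐ x ∂(Measure.hausdorffMeasure (finrank ℝ E : ℝ)).restrict (lateralSurface ρ ϱ h),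
      x ∈ lateralSurface ρ ϱ h ∧ DifferentiableAt ℝ ρ x.fst := by
  rw [ae_lateralSurface_iff hρ hϱ hh]
  filter_upwards [hρ.ae_differentiableAt (Measure.hausdorffMeasure (finrank ℝ E : ℝ))]
    with y hy hyA
  refine ⟨hρ.image_lateralParam hϱ hh ▸ mem_image_of_mem _ hyA, ?_⟩
  rw [lateralParam_of_mem hyA]
  exact hρ.differentiableAt_smul (mul_pos hϱ (inv_pos.2 (one_pos.trans hyA.1))) hy

theorem ae_flatFacet_differentiableAt (r R c : ℝ) :
    ∀ᵐ x ∂(Measure.hausdorffMeasure (finrank ℝ E : ℝ)).restrict (flatFacet ρ r R c),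
      x ∈ flatFacet ρ r R c ∧ DifferentiableAt ℝ ρ x.fst := by
  rw [ae_flatFacet_iff]
  filter_upwards [ae_restrict_mem (hρ.isOpen_annulus r R).measurableSet,
    ae_restrict_of_ae (hρ.ae_differentiableAt (Measure.hausdorffMeasure (finrank ℝ E : ℝ)))]
    with y hy hd
  exact ⟨⟨hy, rfl⟩, hd⟩

/-- A closed condition which holds almost everywhere on an annulus holds on its closure. -/
theorem IsGauge.forall_of_ae_annulus {μ : Measure E} [μ.IsAddHaarMeasure] {a b : ℝ} (ha : 0 < a)
    (hab : a < b) {P : Set E} (hP : IsClosed P) (h : ∀ᵐ y ∂μ, y ∈ annulus ρ a b → y ∈ P) {y : E}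
    (hy : a ≤ ρ y) (hy' : ρ y ≤ b) : y ∈ P := by
  have hsub : annulus ρ a b ⊆ P := fun y hy => by
    by_contra hyP
    have hopen : IsOpen (annulus ρ a b ∩ Pᶜ) := (hρ.isOpen_annulus a b).inter hP.isOpen_compl
    refine (hopen.measure_pos μ ⟨y, hy, hyP⟩).ne' ?_
    refine measure_mono_null (fun z hz => ?_) h
    exact fun hz' => hz.2 (hz' hz.1)
  have hy0 : 0 < ρ y := ha.trans_le hy
  have hb : 0 < b := ha.trans hab
  have hc : Tendsto (fun s : ℝ => (((1 - s) * ρ y + s * ((a + b) / 2)) / ρ y) • y) (𝓝[>] 0)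
      (𝓝 y) := by
    have h1 : Continuous fun s : ℝ => (((1 - s) * ρ y + s * ((a + b) / 2)) / ρ y) • y := by
      fun_prop
    have h2 := h1.tendsto 0
    rw [sub_zero, one_mul, zero_mul, add_zero, div_self hy0.ne', one_smul] at h2
    exact h2.mono_left nhdsWithin_le_nhds
  refine hP.mem_of_tendsto hc ?_
  filter_upwards [Ioo_mem_nhdsGT (zero_lt_one (α := ℝ))] with s hs
  have hs1 := sub_pos.2 hs.2
  have hs0 := hs.1
  have hval : ρ ((((1 - s) * ρ y + s * ((a + b) / 2)) / ρ y) • y) =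
      (1 - s) * ρ y + s * ((a + b) / 2) := by
    rw [hρ.smul_of_nonneg (by positivity), div_mul_cancel₀ _ hy0.ne']
  refine hsub ⟨?_, ?_⟩ <;> rw [hval] <;> nlinarith

end HollowCylinder

/-! ### Outer normals and normal velocities -/

section NormalVelocity

variable {V : Type*} [NormedAddCommGroup V] [InnerProductSpace ℝ V]

/-- Small steps from x in the direction ν₂ - ν₁ would enter the set according to ν₁ and leave it
according to ν₂. -/
theorem IsOuterNormal.unique {S : Set V} {x ν₁ ν₂ : V} (h₁ : IsOuterNormal S x ν₁)
    (h₂ : IsOuterNormal S x ν₂) : ν₁ = ν₂ := by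
  by_contra hne
  have hu : 0 < ‖ν₂ - ν₁‖ := norm_pos_iff.2 (sub_ne_zero.2 (Ne.symm hne))
  set u := ν₂ - ν₁ with hu_def
  have h11 : ⟪u, ν₁⟫ = -(‖u‖ ^ 2 / 2) := by
    have h := norm_sub_sq_real ν₂ ν₁
    rw [hu_def, h, inner_sub_left, real_inner_self_eq_norm_sq, h₁.2.1, h₂.2.1]
    ring
  have h22 : ⟪u, ν₂⟫ = ‖u‖ ^ 2 / 2 := by
    have h := norm_sub_sq_real ν₂ ν₁
    rw [hu_def, h, inner_sub_left, real_inner_self_eq_norm_sq, real_inner_comm ν₂ ν₁, h₁.2.1,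
      h₂.2.1]
    ring
  obtain ⟨δ₁, hδ₁, H₁⟩ := h₁.2.2 (‖u‖ / 4) (by positivity)
  obtain ⟨δ₂, hδ₂, H₂⟩ := h₂.2.2 (‖u‖ / 4) (by positivity)
  have hs : 0 < min δ₁ δ₂ / 2 / ‖u‖ := by positivity
  set s := min δ₁ δ₂ / 2 / ‖u‖ with hs_def
  have hsu : ‖(x + s • u) - x‖ = s * ‖u‖ := by
    rw [add_sub_cancel_left, norm_smul, Real.norm_eq_abs, abs_of_pos hs]
  have hsu' : s * ‖u‖ = min δ₁ δ₂ / 2 := by rw [hs_def]; field_simp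
  have hmin : min δ₁ δ₂ / 2 < min δ₁ δ₂ := half_lt_self (lt_min hδ₁ hδ₂)
  have hpos : 0 < s * ‖u‖ ^ 2 := by positivity
  refine (H₂ (x + s • u) ?_).2 ?_ ((H₁ (x + s • u) ?_).1 ?_)
  · rw [hsu, hsu']; exact hmin.trans_le (min_le_right _ _)
  · rw [hsu, add_sub_cancel_left, real_inner_smul_left, h22]; nlinarith
  · rw [hsu, hsu']; exact hmin.trans_le (min_le_left _ _)
  · rw [hsu, add_sub_cancel_left, real_inner_smul_left, h11]; nlinarith

theorem HasNormalVelocity.isOuterNormal {S : ℝ → Set V} {I : Set ℝ} {t : ℝ} {x ν : V} {v : ℝ}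
    (h : HasNormalVelocity S I t x ν v) (ht : t ∈ I) : IsOuterNormal (S t) x ν := by
  refine ⟨h.1, h.2.1, fun ε hε => ?_⟩
  obtain ⟨δ, hδ, H⟩ := h.2.2 ε hε
  refine ⟨δ, hδ, fun y hy => ?_⟩
  simpa using H t ht y (by simpa using hδ) hy

/-- A point moving along ν with the mean of two velocities would be outside according to the smaller
and inside according to the larger one. Only times after t, accumulating at t, are needed. -/
theorem HasNormalVelocity.unique {S : ℝ → Set V} {I : Set ℝ} {t : ℝ} {x ν : V} {v₁ v₂ : ℝ}
    (hI : ∀ δ > 0, ∃ s ∈ I, t < s ∧ s < t + δ) (h₁ : HasNormalVelocity S I t x ν v₁)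
    (h₂ : HasNormalVelocity S I t x ν v₂) : v₁ = v₂ := by
  wlog hlt : v₁ < v₂ generalizing v₁ v₂
  · rcases (not_lt.1 hlt).lt_or_eq with h | h
    · exact (this h₂ h₁ h).symm
    · exact h.symm
  exfalso
  set m := (v₁ + v₂) / 2 with hm
  have hm0 : 0 < 1 + |m| := by positivity
  have hd : 0 < v₂ - v₁ := sub_pos.2 hlt
  obtain ⟨δ₁, hδ₁, H₁⟩ := h₁.2.2 ((v₂ - v₁) / 4 / (1 + |m|)) (by positivity)
  obtain ⟨δ₂, hδ₂, H₂⟩ := h₂.2.2 ((v₂ - v₁) / 4 / (1 + |m|)) (by positivity)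
  obtain ⟨s, hsI, hts, hs⟩ := hI (min δ₁ δ₂ / (1 + |m|)) (by positivity)
  have hst : 0 < s - t := sub_pos.2 hts
  have hst' : (s - t) * (1 + |m|) < min δ₁ δ₂ := by
    rw [← lt_div_iff₀ hm0]; linarith
  have hnorm : ‖(x + (m * (s - t)) • ν) - x‖ = |m| * (s - t) := by
    rw [add_sub_cancel_left, norm_smul, h₁.2.1, mul_one, Real.norm_eq_abs, abs_mul,
      abs_of_pos hst]
  have hinner : ⟪(x + (m * (s - t)) • ν) - x, ν⟫ = m * (s - t) := by
    rw [add_sub_cancel_left, real_inner_smul_left, real_inner_self_eq_norm_sq, h₁.2.1]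
    ring
  have hlt1 : s - t < min δ₁ δ₂ := by nlinarith [abs_nonneg m, mul_nonneg (abs_nonneg m) hst.le]
  have hlt2 : |m| * (s - t) < min δ₁ δ₂ := by nlinarith
  have hε : (v₂ - v₁) / 4 / (1 + |m|) * (|s - t| + |m| * (s - t)) = (v₂ - v₁) / 4 * (s - t) := by
    rw [abs_of_pos hst]
    field_simp
  refine (H₁ s hsI (x + (m * (s - t)) • ν) ?_ ?_).2 ?_
    ((H₂ s hsI (x + (m * (s - t)) • ν) ?_ ?_).1 ?_)
  · rw [abs_of_pos hst]; exact hlt1.trans_le (min_le_left _ _)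
  · rw [hnorm]; exact hlt2.trans_le (min_le_left _ _)
  · rw [hnorm, hinner, hε, hm]; nlinarith
  · rw [abs_of_pos hst]; exact hlt1.trans_le (min_le_right _ _)
  · rw [hnorm]; exact hlt2.trans_le (min_le_right _ _)
  · rw [hnorm, hinner, hε, hm]; nlinarith

/-- Near (t, x) the family is a moving sublevel set {φ < c}. First-order expansion of φ and c gives
the space-time half-space, normalized by ‖g‖. -/
theorem hasNormalVelocity_of_eventually_mem_iff {S : ℝ → Set V} {I : Set ℝ} {t : ℝ} {x g : V}
    {φ : V → ℝ} {c : ℝ → ℝ} {c' : ℝ} (hx : x ∈ frontier (S t)) (hg : g ≠ 0)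
    (hφ : HasFDerivAt φ (innerSL ℝ g) x) (hc : HasDerivWithinAt c c' I t) (h0 : φ x = c t)
    (hmem : ∀ᶠ p in 𝓝[I] t ×ˢ 𝓝 x, (p.2 ∈ S p.1 ↔ φ p.2 < c p.1)) :
    HasNormalVelocity S I t x (‖g‖⁻¹ • g) (‖g‖⁻¹ * c') := by
  have hg0 : 0 < ‖g‖ := norm_pos_iff.2 hg
  refine ⟨hx, ?_, fun ε hε => ?_⟩
  · rw [norm_smul, norm_inv, norm_norm, inv_mul_cancel₀ hg0.ne']
  have h1 : ∀ᶠ y in 𝓝 x, ‖φ y - φ x - innerSL ℝ g (y - x)‖ ≤ ε * ‖g‖ * ‖y - x‖ :=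
    hφ.isLittleO.bound (by positivity)
  have h2 : ∀ᶠ s in 𝓝[I] t, ‖c s - c t - (s - t) • c'‖ ≤ ε * ‖g‖ * ‖s - t‖ :=
    (hasDerivWithinAt_iff_isLittleO.1 hc).bound (by positivity)
  obtain ⟨pa, ha, pb, hb, H⟩ := eventually_prod_iff.1 ((h2.prod_mk h1).and hmem)
  obtain ⟨δ₁, hδ₁, H₁⟩ := Metric.mem_nhdsWithin_iff.1 ha
  obtain ⟨δ₂, hδ₂, H₂⟩ := Metric.mem_nhds_iff.1 hb
  refine ⟨min δ₁ δ₂, lt_min hδ₁ hδ₂, fun s hs y hst hyx => ?_⟩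
  have hpa : pa s := H₁ ⟨by
    rw [Metric.mem_ball, Real.dist_eq]; exact hst.trans_le (min_le_left _ _), hs⟩
  have hpb : pb y := H₂ (by
    rw [Metric.mem_ball, dist_eq_norm]; exact hyx.trans_le (min_le_right _ _))
  obtain ⟨⟨h4, h5⟩, h6⟩ := H hpa hpb
  simp only at h4 h5 h6
  rw [innerSL_apply_apply, h0, Real.norm_eq_abs, abs_le] at h5
  rw [smul_eq_mul, Real.norm_eq_abs, Real.norm_eq_abs, abs_le] at h4
  have h7 : ⟪y - x, ‖g‖⁻¹ • g⟫ - ‖g‖⁻¹ * c' * (s - t) =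
      (⟪g, y - x⟫ - c' * (s - t)) / ‖g‖ := by
    rw [real_inner_smul_right, real_inner_comm]
    field_simp
  rw [h6, h7, div_lt_iff₀ hg0, lt_div_iff₀ hg0]
  constructor
  · intro h8
    nlinarith
  · intro h8
    nlinarith

end NormalVelocity

/-! ### Normals and velocities of the four facets. -/

section HollowCylinderNormals

open Module
open scoped NNReal ENNReal

variable {E : Type*} [NormedAddCommGroup E] [InnerProductSpace ℝ E] [FiniteDimensional ℝ E]
  [CompleteSpace E] {ρ : E → ℝ} (hρ : IsGauge ρ)

/-- The vertical unit vector. -/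
def verticalUnit (E : Type*) [NormedAddCommGroup E] [InnerProductSpace ℝ E] :
    WithLp 2 (E × ℝ) := WithLp.toLp 2 (0, 1)

theorem norm_verticalUnit : ‖verticalUnit E‖ = 1 := by
  rw [verticalUnit, WithLp.norm_toLp_snd, norm_one]

theorem verticalUnit_ne_zero : verticalUnit E ≠ 0 :=
  norm_ne_zero_iff.1 (by rw [norm_verticalUnit]; exact one_ne_zero)

theorem inner_verticalUnit_left (x : WithLp 2 (E × ℝ)) : ⟪verticalUnit E, x⟫ = x.snd := by
  rw [verticalUnit, WithLp.prod_inner_apply]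
  simp

theorem norm_inv_smul_toLp_gradient (x : E) :
    ‖(WithLp.toLp 2 (gradient ρ x, (0 : ℝ)) : WithLp 2 (E × ℝ))‖⁻¹ •
      WithLp.toLp 2 (gradient ρ x, (0 : ℝ)) = lateralNormal ρ x := by
  rw [WithLp.norm_toLp_fst, lateralNormal, ← WithLp.toLp_smul, Prod.smul_mk, smul_zero]

theorem hasFDerivAt_comp_fst {x : WithLp 2 (E × ℝ)} (hx : DifferentiableAt ℝ ρ x.fst) :
    HasFDerivAt (fun y : WithLp 2 (E × ℝ) => ρ y.fst)
      (innerSL ℝ (WithLp.toLp 2 (gradient ρ x.fst, (0 : ℝ)) : WithLp 2 (E × ℝ))) x := by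
  have h1 := hx.hasGradientAt.hasFDerivAt.comp x
    (WithLp.fstL 2 ℝ E ℝ : WithLp 2 (E × ℝ) →L[ℝ] E).hasFDerivAt
  refine h1.congr_fderiv ?_
  ext y
  simp [WithLp.prod_inner_apply]

include hρ
variable {r R h : ℝ → ℝ} {I : Set ℝ} {t : ℝ}

theorem lateralSurface_subset_frontier {r R h : ℝ} (hr : 0 < r) (hrR : r < R) (hh : 0 < h) :
    lateralSurface ρ R h ⊆ frontier (hollowCylinder ρ r R h) ∧
      lateralSurface ρ r h ⊆ frontier (hollowCylinder ρ r R h) := by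
  constructor <;> rintro x ⟨h1, h2⟩ <;> rw [mem_frontier_hollowCylinder hρ hr hrR hh, h1]
  · exact ⟨⟨hrR.le, le_rfl, h2.le⟩, Or.inr (Or.inl rfl)⟩
  · exact ⟨⟨le_rfl, hrR.le, h2.le⟩, Or.inl rfl⟩

theorem flatFacet_subset_frontier {r R h : ℝ} (hr : 0 < r) (hrR : r < R) (hh : 0 < h) :
    flatFacet ρ r R h ⊆ frontier (hollowCylinder ρ r R h) ∧
      flatFacet ρ r R (-h) ⊆ frontier (hollowCylinder ρ r R h) := by
  constructor <;> rintro x ⟨⟨h1, h2⟩, h3⟩ <;>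
    rw [mem_frontier_hollowCylinder hρ hr hrR hh, h3]
  · exact ⟨⟨h1.le, h2.le, (abs_of_pos hh).le⟩, Or.inr (Or.inr (abs_of_pos hh))⟩
  · rw [abs_neg]
    exact ⟨⟨h1.le, h2.le, (abs_of_pos hh).le⟩, Or.inr (Or.inr (abs_of_pos hh))⟩

/-- Near a point of the open outer surface, and at nearby times, the other constraints hold
strictly, so the set is locally {ρ < R}. The remaining facets are treated in the same way. -/
theorem hasNormalVelocity_outer {R' : ℝ} (hr : 0 < r t) (hrR : r t < R t) (hh : 0 < h t)
    (hrc : ContinuousWithinAt r I t) (hRd : HasDerivWithinAt R R' I t)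
    (hhc : ContinuousWithinAt h I t) {x : WithLp 2 (E × ℝ)}
    (hx : x ∈ lateralSurface ρ (R t) (h t)) (hd : DifferentiableAt ℝ ρ x.fst) :
    HasNormalVelocity (fun s => hollowCylinder ρ (r s) (R s) (h s)) I t x
      (lateralNormal ρ x.fst) (‖gradient ρ x.fst‖⁻¹ * R') := by
  have hx0 : x.fst ≠ 0 := hρ.ne_zero_of_pos (by rw [hx.1]; exact hr.trans hrR)
  have h1 := hasNormalVelocity_of_eventually_mem_iff (I := I) (t := t) (c := R) (c' := R')
    (S := fun s => hollowCylinder ρ (r s) (R s) (h s)) (x := x)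
    (g := WithLp.toLp 2 (gradient ρ x.fst, (0 : ℝ))) (φ := fun y => ρ y.fst)
    ((lateralSurface_subset_frontier hρ hr hrR hh).1 hx) ?_ (hasFDerivAt_comp_fst hd) hRd hx.1 ?_
  · rwa [norm_inv_smul_toLp_gradient, WithLp.norm_toLp_fst] at h1
  · rw [← norm_ne_zero_iff, WithLp.norm_toLp_fst, norm_ne_zero_iff]
    exact hρ.gradient_ne_zero hd hx0
  · have hρc : Tendsto (fun y : WithLp 2 (E × ℝ) => ρ y.fst) (𝓝 x) (𝓝 (ρ x.fst)) :=
      (hρ.continuous.comp (WithLp.continuous_fst 2 E ℝ)).tendsto x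
    have hsc : Tendsto (fun y : WithLp 2 (E × ℝ) => |y.snd|) (𝓝 x) (𝓝 |x.snd|) :=
      (continuous_abs.comp (WithLp.continuous_snd 2 E ℝ)).tendsto x
    have h2 := (Tendsto.comp hrc tendsto_fst).eventually_lt (hρc.comp tendsto_snd)
      (by rw [hx.1]; exact hrR)
    have h3 := (hsc.comp tendsto_snd).eventually_lt (Tendsto.comp hhc tendsto_fst) hx.2
    filter_upwards [h2, h3] with p hp2 hp3
    exact ⟨fun hp => hp.2.1, fun hp => ⟨hp2, hp, hp3⟩⟩

theorem hasNormalVelocity_inner {r' : ℝ} (hr : 0 < r t) (hrR : r t < R t) (hh : 0 < h t)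
    (hrd : HasDerivWithinAt r r' I t) (hRc : ContinuousWithinAt R I t)
    (hhc : ContinuousWithinAt h I t) {x : WithLp 2 (E × ℝ)}
    (hx : x ∈ lateralSurface ρ (r t) (h t)) (hd : DifferentiableAt ℝ ρ x.fst) :
    HasNormalVelocity (fun s => hollowCylinder ρ (r s) (R s) (h s)) I t x
      (-lateralNormal ρ x.fst) (-(‖gradient ρ x.fst‖⁻¹ * r')) := by
  have hx0 : x.fst ≠ 0 := hρ.ne_zero_of_pos (by rw [hx.1]; exact hr)
  have h1 := hasNormalVelocity_of_eventually_mem_iff (I := I) (t := t) (c := fun s => -r s)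
    (c' := -r') (S := fun s => hollowCylinder ρ (r s) (R s) (h s)) (x := x)
    (g := -WithLp.toLp 2 (gradient ρ x.fst, (0 : ℝ))) (φ := fun y => -ρ y.fst)
    ((lateralSurface_subset_frontier hρ hr hrR hh).2 hx) ?_ ?_ hrd.fun_neg (by rw [hx.1]) ?_
  · rwa [norm_neg, smul_neg, norm_inv_smul_toLp_gradient, WithLp.norm_toLp_fst, mul_neg] at h1
  · rw [neg_ne_zero, ← norm_ne_zero_iff, WithLp.norm_toLp_fst, norm_ne_zero_iff]
    exact hρ.gradient_ne_zero hd hx0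
  · rw [map_neg]
    exact (hasFDerivAt_comp_fst hd).fun_neg
  · have hρc : Tendsto (fun y : WithLp 2 (E × ℝ) => ρ y.fst) (𝓝 x) (𝓝 (ρ x.fst)) :=
      (hρ.continuous.comp (WithLp.continuous_fst 2 E ℝ)).tendsto x
    have hsc : Tendsto (fun y : WithLp 2 (E × ℝ) => |y.snd|) (𝓝 x) (𝓝 |x.snd|) :=
      (continuous_abs.comp (WithLp.continuous_snd 2 E ℝ)).tendsto x
    have h2 := (hρc.comp tendsto_snd).eventually_lt (Tendsto.comp hRc tendsto_fst)
      (by rw [hx.1]; exact hrR)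
    have h3 := (hsc.comp tendsto_snd).eventually_lt (Tendsto.comp hhc tendsto_fst) hx.2
    filter_upwards [h2, h3] with p hp2 hp3
    exact ⟨fun hp => neg_lt_neg hp.1, fun hp => ⟨neg_lt_neg_iff.1 hp, hp2, hp3⟩⟩

theorem hasNormalVelocity_flat {h' κ : ℝ} (hκ : κ = 1 ∨ κ = -1) (hr : 0 < r t) (hrR : r t < R t)
    (hh : 0 < h t) (hrc : ContinuousWithinAt r I t) (hRc : ContinuousWithinAt R I t)
    (hhd : HasDerivWithinAt h h' I t) {x : WithLp 2 (E × ℝ)}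
    (hx : x ∈ flatFacet ρ (r t) (R t) (κ * h t)) :
    HasNormalVelocity (fun s => hollowCylinder ρ (r s) (R s) (h s)) I t x
      (κ • verticalUnit E) h' := by
  have hκκ : κ * κ = 1 := by rcases hκ with rfl | rfl <;> norm_num
  have hκ1 : |κ| = 1 := by rcases hκ with rfl | rfl <;> norm_num
  have hκ0 : κ ≠ 0 := by rintro rfl; simp at hκκ
  have hxs : κ * x.snd = h t := by rw [hx.2, ← mul_assoc, hκκ, one_mul]
  have h1 := hasNormalVelocity_of_eventually_mem_iff (I := I) (t := t) (c := h)
    (c' := h') (S := fun s => hollowCylinder ρ (r s) (R s) (h s)) (x := x)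
    (g := κ • verticalUnit E) (φ := fun y => κ * y.snd) ?_ ?_ ?_ hhd hxs ?_
  · rwa [norm_smul, norm_verticalUnit, mul_one, Real.norm_eq_abs, hκ1, inv_one, one_smul,
      one_mul] at h1
  · rcases hκ with rfl | rfl
    · rw [one_mul] at hx
      exact (flatFacet_subset_frontier hρ hr hrR hh).1 hx
    · rw [neg_one_mul] at hx
      exact (flatFacet_subset_frontier hρ hr hrR hh).2 hx
  · exact smul_ne_zero hκ0 verticalUnit_ne_zero
  · have h2 : (fun y : WithLp 2 (E × ℝ) => κ * y.snd) = innerSL ℝ (κ • verticalUnit E) := by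
      funext y
      rw [innerSL_apply_apply, real_inner_smul_left, inner_verticalUnit_left]
    rw [h2]
    exact (innerSL ℝ (κ • verticalUnit E)).hasFDerivAt
  · have hρc : Tendsto (fun y : WithLp 2 (E × ℝ) => ρ y.fst) (𝓝 x) (𝓝 (ρ x.fst)) :=
      (hρ.continuous.comp (WithLp.continuous_fst 2 E ℝ)).tendsto x
    have hsc : Tendsto (fun y : WithLp 2 (E × ℝ) => κ * y.snd) (𝓝 x) (𝓝 (κ * x.snd)) :=
      (continuous_const.mul (WithLp.continuous_snd 2 E ℝ)).tendsto x
    have h2 := (Tendsto.comp hrc tendsto_fst).eventually_lt (hρc.comp tendsto_snd) hx.1.1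
    have h3 := (hρc.comp tendsto_snd).eventually_lt (Tendsto.comp hRc tendsto_fst) hx.1.2
    have h4 := (Tendsto.comp hhd.continuousWithinAt tendsto_fst).neg.eventually_lt
      (hsc.comp tendsto_snd) (by rw [hxs]; linarith)
    filter_upwards [h2, h3, h4] with p hp2 hp3 hp4
    simp only [Function.comp] at hp2 hp3 hp4
    have habs : |p.2.snd| = |κ * p.2.snd| := by rw [abs_mul, hκ1, one_mul]
    constructor
    · intro hp
      exact (le_abs_self _).trans_lt (habs ▸ hp.2.2)
    · intro hp
      exact ⟨hp2, hp3, by rw [habs, abs_lt]; exact ⟨hp4, hp⟩⟩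

variable {r R h : ℝ}

/-- A stationary family has normal velocity zero, and its normal is the outer normal. -/
theorem isOuterNormal_outer (hr : 0 < r) (hrR : r < R) (hh : 0 < h) {x : WithLp 2 (E × ℝ)}
    (hx : x ∈ lateralSurface ρ R h) (hd : DifferentiableAt ℝ ρ x.fst) :
    IsOuterNormal (hollowCylinder ρ r R h) x (lateralNormal ρ x.fst) :=
  (hasNormalVelocity_outer hρ (r := fun _ => r) (R := fun _ => R) (h := fun _ => h) (I := univ)
    (t := 0) hr hrR hh continuousWithinAt_const (hasDerivWithinAt_const _ _ _)
    continuousWithinAt_const hx hd).isOuterNormal (mem_univ 0)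

theorem isOuterNormal_inner (hr : 0 < r) (hrR : r < R) (hh : 0 < h) {x : WithLp 2 (E × ℝ)}
    (hx : x ∈ lateralSurface ρ r h) (hd : DifferentiableAt ℝ ρ x.fst) :
    IsOuterNormal (hollowCylinder ρ r R h) x (-lateralNormal ρ x.fst) :=
  (hasNormalVelocity_inner hρ (r := fun _ => r) (R := fun _ => R) (h := fun _ => h) (I := univ)
    (t := 0) hr hrR hh (hasDerivWithinAt_const _ _ _) continuousWithinAt_const
    continuousWithinAt_const hx hd).isOuterNormal (mem_univ 0)

theorem isOuterNormal_flat {κ : ℝ} (hκ : κ = 1 ∨ κ = -1) (hr : 0 < r) (hrR : r < R) (hh : 0 < h)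
    {x : WithLp 2 (E × ℝ)} (hx : x ∈ flatFacet ρ r R (κ * h)) :
    IsOuterNormal (hollowCylinder ρ r R h) x (κ • verticalUnit E) :=
  (hasNormalVelocity_flat hρ (r := fun _ => r) (R := fun _ => R) (h := fun _ => h) (I := univ)
    (t := 0) hκ hr hrR hh continuousWithinAt_const continuousWithinAt_const
    (hasDerivWithinAt_const _ _ _) hx).isOuterNormal (mem_univ 0)

end HollowCylinderNormals

/-! ### Cahn-Hoffman fields on the boundary of a hollow cylinder -/

section CylindricalSubdifferential

variable {E : Type*} [NormedAddCommGroup E] [InnerProductSpace ℝ E]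

theorem IsGauge.mem_subdifferential_iff {σ : E → ℝ} (hσ : IsGauge σ) {ξ p : E} :
    ξ ∈ subdifferential σ p ↔ ⟪ξ, p⟫ = σ p ∧ ∀ k, ⟪ξ, k⟫ ≤ σ k := by
  constructor
  · intro h
    have h1 : ∀ k, ⟪ξ, k⟫ ≤ σ (p + k) - σ p := h
    refine ⟨le_antisymm ?_ ?_, fun k => ?_⟩
    -- Homogeneity is exploited by the test increments p and -p, which give the two inequalities of
    -- ⟪ξ, p⟫ = σ(p).
    · have h2 := h1 p
      rw [← two_smul ℝ p, hσ.smul] at h2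
      norm_num at h2
      linarith
    · have h2 := h1 (-p)
      rw [add_neg_cancel, hσ.map_zero, inner_neg_right] at h2
      linarith
    · have h2 := hσ.add_le p k
      linarith [h1 k]
  · rintro ⟨h1, h2⟩ k
    have h3 := h2 (p + k)
    rw [inner_add_right, h1] at h3
    linarith

/-- The function `τ(p') + |p_n|`. -/
def verticalSum (τ : E → ℝ) (p : WithLp 2 (E × ℝ)) : ℝ := τ p.fst + |p.snd|

theorem IsGauge.verticalSum {τ : E → ℝ} (hτ : IsGauge τ) : IsGauge (verticalSum τ) where
  add_le x y := by
    have h1 := hτ.add_le x.fst y.fst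
    have h2 := abs_add_le x.snd y.snd
    change τ (x.fst + y.fst) + |x.snd + y.snd| ≤ _
    unfold _root_.verticalSum
    linarith
  smul c x := by
    change τ (c • x.fst) + |c * x.snd| = |c| * (τ x.fst + |x.snd|)
    rw [hτ.smul, abs_mul]
    ring
  pos x hx := by
    unfold _root_.verticalSum
    by_cases h : x.fst = 0
    · have h2 : x.snd ≠ 0 := fun h2 => hx (withLp_ext h h2)
      have := abs_pos.2 h2
      have := hτ.nonneg x.fst
      linarith
    · have := hτ.pos _ h
      have := abs_nonneg x.snd
      linarith

variable [FiniteDimensional ℝ E] {τ : E → ℝ} (hτ : IsGauge τ)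
include hτ

/-- Testing the subgradient with horizontal vectors. -/
theorem polar_fst_le_one {ξ p : WithLp 2 (E × ℝ)}
    (h : ξ ∈ subdifferential (verticalSum τ) p) : polar τ ξ.fst ≤ 1 := by
  refine hτ.polar_le (fun q => ?_) zero_le_one
  have h1 := (hτ.verticalSum.mem_subdifferential_iff.1 h).2 (WithLp.toLp 2 (q, 0))
  simpa [WithLp.prod_inner_apply, verticalSum, real_inner_comm] using h1

theorem mem_subdifferential_verticalSum {ξ p : WithLp 2 (E × ℝ)} (h1 : polar τ ξ.fst ≤ 1)
    (h2 : |ξ.snd| ≤ 1) (h3 : ⟪ξ, p⟫ = verticalSum τ p) :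
    ξ ∈ subdifferential (verticalSum τ) p := by
  refine hτ.verticalSum.mem_subdifferential_iff.2 ⟨h3, fun k => ?_⟩
  rw [WithLp.prod_inner_apply]
  refine add_le_add ?_ ?_
  · refine (hτ.inner_le_polar_mul _ _).trans ?_
    exact mul_le_of_le_one_left (hτ.nonneg _) h1
  · rw [real_inner_eq_re_inner]
    change k.snd * ξ.snd ≤ |k.snd|
    refine (le_abs_self _).trans ?_
    rw [abs_mul]
    exact mul_le_of_le_one_right (abs_nonneg _) h2

theorem snd_eq_of_mem_subdifferential_verticalUnit {ξ : WithLp 2 (E × ℝ)} {κ : ℝ}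
    (hκ : κ = 1 ∨ κ = -1) (h : ξ ∈ subdifferential (verticalSum τ) (κ • verticalUnit E)) :
    ξ.snd = κ := by
  have h1 := (hτ.verticalSum.mem_subdifferential_iff.1 h).1
  rw [hτ.verticalSum.smul, real_inner_smul_right, real_inner_comm, inner_verticalUnit_left] at h1
  have h2 : verticalSum τ (verticalUnit E) = 1 := by
    simp [verticalSum, verticalUnit, hτ.map_zero]
  rw [h2] at h1
  rcases hκ with rfl | rfl
  · simpa using h1
  · norm_num at h1
    linarith

theorem verticalSum_lateralNormal [CompleteSpace E] {x : E} (hx : DifferentiableAt ℝ (polar τ) x)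
    (h0 : x ≠ 0) :
    verticalSum τ (lateralNormal (polar τ) x) = ‖gradient (polar τ) x‖⁻¹ := by
  change τ (‖gradient (polar τ) x‖⁻¹ • gradient (polar τ) x) + |(0 : ℝ)| = _
  rw [hτ.smul_of_nonneg (by positivity), hτ.apply_gradient_polar hx h0, abs_zero, mul_one,
    add_zero]

/-- The upper bound is the triangle inequality, as the polar of ξ' is at most 1. The lower bound is
the supporting hyperplane at x, since ⟪∇ρ(x), κ ξ'⟫ = 1. This is where the anisotropy makes the
first variation of area computable. -/
theorem polar_add_smul_of_mem_subdifferential [CompleteSpace E] {ξ : WithLp 2 (E × ℝ)} {x : E}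
    {κ : ℝ} (hκ : κ = 1 ∨ κ = -1) (hx : DifferentiableAt ℝ (polar τ) x) (h0 : x ≠ 0)
    (h : ξ ∈ subdifferential (verticalSum τ) (κ • lateralNormal (polar τ) x)) {s : ℝ}
    (hs : 0 ≤ s) : polar τ (x + s • κ • ξ.fst) = polar τ x + s := by
  have hρ := hτ.isGauge_polar
  have hκ1 : |κ| = 1 := by rcases hκ with rfl | rfl <;> norm_num
  have hg : 0 < ‖gradient (polar τ) x‖ := norm_pos_iff.2 (hρ.gradient_ne_zero hx h0)
  have h1 := (hτ.verticalSum.mem_subdifferential_iff.1 h).1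
  rw [hτ.verticalSum.smul, hκ1, verticalSum_lateralNormal hτ hx h0, one_mul,
    real_inner_smul_right, real_inner_comm, inner_lateralNormal] at h1
  have h2 : κ * ⟪gradient (polar τ) x, ξ.fst⟫ = 1 := by
    field_simp at h1
    exact h1
  apply le_antisymm
  · refine (hρ.add_le _ _).trans ?_
    rw [hρ.smul_of_nonneg hs, hρ.smul, hκ1, one_mul]
    have := mul_le_mul_of_nonneg_left (polar_fst_le_one hτ h) hs
    linarith
  · have h3 := hρ.inner_gradient_le hx (x + s • κ • ξ.fst)
    rwa [inner_add_right, real_inner_smul_right, real_inner_smul_right, h2,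
      hρ.inner_gradient_self hx, mul_one] at h3

end CylindricalSubdifferential

/-! ### Splitting traces into horizontal and vertical parts. -/

section TraceOfDerivative

open Module

variable {E : Type*} [NormedAddCommGroup E] [InnerProductSpace ℝ E] [FiniteDimensional ℝ E]

/-- The inclusion of the horizontal space. -/
def horizontalInclusion (E : Type*) [NormedAddCommGroup E] [InnerProductSpace ℝ E] :
    E →L[ℝ] WithLp 2 (E × ℝ) :=
  ((WithLp.prodContinuousLinearEquiv 2 ℝ E ℝ).symm : E × ℝ →L[ℝ] WithLp 2 (E × ℝ)).comp
    (ContinuousLinearMap.inl ℝ E ℝ)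

theorem hasFDerivAt_toLp_left (c : ℝ) (y : E) :
    HasFDerivAt (fun y : E => (WithLp.toLp 2 (y, c) : WithLp 2 (E × ℝ)))
      (horizontalInclusion E) y := by
  have h := (horizontalInclusion E).hasFDerivAt (x := y) |>.add_const
    (WithLp.toLp 2 (0, c) : WithLp 2 (E × ℝ))
  refine h.congr_of_eventuallyEq (Eventually.of_forall fun z => ?_)
  exact withLp_ext (by simp [horizontalInclusion]) (by simp [horizontalInclusion])

/-- `L` is the sum of a map factoring through the horizontal projection and a rank-one map carried
by the vertical coordinate; the trace of the latter is the subtracted vertical entry. -/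
theorem trace_sub_inner_verticalUnit (L : WithLp 2 (E × ℝ) →L[ℝ] WithLp 2 (E × ℝ)) :
    LinearMap.trace ℝ _ (L : WithLp 2 (E × ℝ) →ₗ[ℝ] WithLp 2 (E × ℝ)) -
      ⟪verticalUnit E, L (verticalUnit E)⟫ =
    LinearMap.trace ℝ E (((WithLp.fstL 2 ℝ E ℝ).comp (L.comp (horizontalInclusion E)) :
      E →L[ℝ] E) : E →ₗ[ℝ] E) := by
  have h1 : (L : WithLp 2 (E × ℝ) →ₗ[ℝ] WithLp 2 (E × ℝ)) =
      ((L.comp (horizontalInclusion E) : E →L[ℝ] WithLp 2 (E × ℝ)) : E →ₗ[ℝ] WithLp 2 (E × ℝ)) ∘ₗ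
        ((WithLp.fstL 2 ℝ E ℝ : WithLp 2 (E × ℝ) →L[ℝ] E) : WithLp 2 (E × ℝ) →ₗ[ℝ] E) +
      ((WithLp.sndL 2 ℝ E ℝ : WithLp 2 (E × ℝ) →L[ℝ] ℝ) :
        WithLp 2 (E × ℝ) →ₗ[ℝ] ℝ).smulRight (L (verticalUnit E)) := by
    ext x : 1
    have h2 : x = horizontalInclusion E x.fst + x.snd • verticalUnit E :=
      withLp_ext (by simp [horizontalInclusion, verticalUnit])
        (by simp [horizontalInclusion, verticalUnit])
    have h3 := congrArg L h2
    rw [map_add, map_smul] at h3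
    exact h3
  rw [h1, map_add, LinearMap.trace_smulRight, LinearMap.trace_comp_comm', inner_verticalUnit_left]
  change _ + (L (verticalUnit E)).snd - _ = _
  rw [add_sub_cancel_right]
  rfl

end TraceOfDerivative

/-! ### What the Cahn-Hoffman condition says facet by facet. -/

section CahnHoffmanFields

open Module
open scoped NNReal ENNReal

variable {E : Type*} [NormedAddCommGroup E] [InnerProductSpace ℝ E] [FiniteDimensional ℝ E]
  [CompleteSpace E] [MeasurableSpace E] [BorelSpace E]

section Closed

variable {ρ : E → ℝ} (hρ : IsGauge ρ)
include hρ

/-- A closed condition which holds almost everywhere on the lateral surface holds on its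
closure. -/
theorem forall_of_ae_lateralSurface {ϱ h : ℝ} (hϱ : 0 < ϱ) (hh : 0 < h)
    {P : Set (WithLp 2 (E × ℝ))} (hP : IsClosed P)
    (hae : ∀ᵐ x ∂(Measure.hausdorffMeasure (finrank ℝ E : ℝ)).restrict (lateralSurface ρ ϱ h),
      x ∈ P) {x : WithLp 2 (E × ℝ)} (hx : ρ x.fst = ϱ) (hx' : |x.snd| ≤ h) : x ∈ P := by
  obtain ⟨K, hK⟩ := hρ.exists_lipschitzWith_lateralParam ϱ h
  have h1 := abs_le.1 hx'
  have h2 : -1 ≤ x.snd / h := by rw [le_div_iff₀ hh]; linarith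
  have h3 : x.snd / h ≤ 1 := by rw [div_le_iff₀ hh]; linarith
  have hval : ρ (((2 + x.snd / h) / ϱ) • x.fst) = 2 + x.snd / h := by
    rw [hρ.smul_of_nonneg (div_nonneg (by linarith) hϱ.le), hx, div_mul_cancel₀ _ hϱ.ne']
  have h4 := hρ.forall_of_ae_annulus one_pos (show (1 : ℝ) < 3 by norm_num)
    (hP.preimage hK.continuous) ((ae_lateralSurface_iff hρ hϱ hh).1 hae)
    (y := ((2 + x.snd / h) / ϱ) • x.fst) (by rw [hval]; linarith) (by rw [hval]; linarith)
  have h5 : lateralParam ρ ϱ h (((2 + x.snd / h) / ϱ) • x.fst) = x := by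
    have h6 : (2 + x.snd / h) ≠ 0 := by linarith
    refine withLp_ext ?_ ?_
    · change ϱ • (max (ρ _) 1)⁻¹ • (((2 + x.snd / h) / ϱ) • x.fst) = x.fst
      rw [hval, max_eq_left (by linarith), smul_smul, smul_smul]
      generalize 2 + x.snd / h = q at h6
      rw [show ϱ * q⁻¹ * (q / ϱ) = 1 by field_simp, one_smul]
    · change h * (ρ _ - 2) = x.snd
      rw [hval]
      field_simp
      ring
  rwa [mem_preimage, h5] at h4

theorem forall_of_ae_flatFacet {r R c : ℝ} (hr : 0 < r) (hrR : r < R)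
    {P : Set (WithLp 2 (E × ℝ))} (hP : IsClosed P)
    (hae : ∀ᵐ x ∂(Measure.hausdorffMeasure (finrank ℝ E : ℝ)).restrict (flatFacet ρ r R c),
      x ∈ P) {x : WithLp 2 (E × ℝ)} (h1 : r ≤ ρ x.fst) (h2 : ρ x.fst ≤ R) (hx : x.snd = c) :
    x ∈ P := by
  have h3 := hρ.forall_of_ae_annulus (μ := Measure.hausdorffMeasure (finrank ℝ E : ℝ)) hr hrR
    (hP.preimage (isometry_toLp_left c).continuous)
    ((ae_restrict_iff' (hρ.isOpen_annulus r R).measurableSet).1 (ae_flatFacet_iff.1 hae)) h1 h2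
  have h4 : x = WithLp.toLp 2 (x.fst, c) := withLp_ext rfl hx
  rw [h4]
  exact h3

end Closed

variable {τ : E → ℝ} (hτ : IsGauge τ) {r R h : ℝ} (hr : 0 < r) (hrR : r < R) (hh : 0 < h)
  {w : WithLp 2 (E × ℝ) → WithLp 2 (E × ℝ)} {e : WithLp 2 (E × ℝ) → ℝ}
include hτ hr hrR hh

/-- A Cahn-Hoffman field on the boundary of a hollow cylinder extends to the whole space, and its
restrictions to the lateral surfaces generate flows between lateral surfaces. -/
theorem IsCahnHoffman.exists_extension
    (hw : IsCahnHoffman (verticalSum τ) (hollowCylinder (polar τ) r R h) w e) :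
    ∃ W, EqOn w W (frontier (hollowCylinder (polar τ) r R h)) ∧
      IsLateralFlow (polar τ) R h 1 W ∧ IsLateralFlow (polar τ) r h (-1) fun x => -W x := by
  have hρ := hτ.isGauge_polar
  have hR : 0 < R := hr.trans hrR
  obtain ⟨K, hK⟩ := hw.lipschitz
  obtain ⟨W, hWlip, hEq⟩ := hK.extend_finite_dimension
  have hWc : Continuous W := hWlip.continuous
  obtain ⟨h1, h2, h3, h4⟩ :=
    (ae_surfaceMeasure_hollowCylinder_iff hρ hr hrR hh).1 hw.mem_subdifferential
  have hfst : Continuous fun x : WithLp 2 (E × ℝ) => (W x).fst :=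
    (WithLp.continuous_fst 2 E ℝ).comp hWc
  have hsnd : Continuous fun x : WithLp 2 (E × ℝ) => (W x).snd :=
    (WithLp.continuous_snd 2 E ℝ).comp hWc
  have hx1 : Continuous fun x : WithLp 2 (E × ℝ) => x.fst := WithLp.continuous_fst 2 E ℝ
  -- In this gradient-free form the a.e. subdifferential condition is closed, so it extends to every
  -- point of the closed lateral surface.
  have hflow : ∀ κ : ℝ, IsClosed {x : WithLp 2 (E × ℝ) | ∀ s : ℝ, 0 ≤ s →
      polar τ (x.fst + s • κ • (W x).fst) = polar τ x.fst + s} := fun κ => by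
    simp only [ofPred_forall]
    refine isClosed_iInter fun s => isClosed_iInter fun _ => isClosed_eq ?_ ?_
    · exact hρ.continuous.comp (hx1.add ((hfst.const_smul κ).const_smul s))
    · exact (hρ.continuous.comp hx1).add continuous_const
  -- Continuity carries the vertical component from the flat facet to its ridges. There it becomes
  -- the end condition for both lateral flows.
  have htop : ∀ x : WithLp 2 (E × ℝ), r ≤ polar τ x.fst → polar τ x.fst ≤ R → x.snd = h →
      (W x).snd = 1 := fun x hx1 hx2 hx3 => by
    refine forall_of_ae_flatFacet hρ hr hrR (isClosed_eq hsnd continuous_const) ?_ hx1 hx2 hx3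
    filter_upwards [h1, ae_restrict_mem (measurableSet_flatFacet hρ r R h)] with x hx hxm
    obtain ⟨ν, hν, hmem⟩ := hx
    rw [hEq hν.1, hν.unique (isOuterNormal_flat hρ (Or.inl rfl) hr hrR hh
      (by rwa [one_mul]))] at hmem
    exact snd_eq_of_mem_subdifferential_verticalUnit hτ (Or.inl rfl) hmem
  have hbot : ∀ x : WithLp 2 (E × ℝ), r ≤ polar τ x.fst → polar τ x.fst ≤ R → x.snd = -h →
      (W x).snd = -1 := fun x hx1 hx2 hx3 => by
    refine forall_of_ae_flatFacet hρ hr hrR (isClosed_eq hsnd continuous_const) ?_ hx1 hx2 hx3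
    filter_upwards [h2, ae_restrict_mem (measurableSet_flatFacet hρ r R (-h))] with x hx hxm
    obtain ⟨ν, hν, hmem⟩ := hx
    rw [hEq hν.1, hν.unique (isOuterNormal_flat hρ (Or.inr rfl) hr hrR hh
      (by rwa [neg_one_mul]))] at hmem
    exact snd_eq_of_mem_subdifferential_verticalUnit hτ (Or.inr rfl) hmem
  have hout : ∀ x : WithLp 2 (E × ℝ), polar τ x.fst = R → |x.snd| ≤ h → ∀ s : ℝ, 0 ≤ s →
      polar τ (x.fst + s • (1 : ℝ) • (W x).fst) = polar τ x.fst + s := fun x hx1 hx2 => by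
    refine forall_of_ae_lateralSurface hρ hR hh (hflow 1) ?_ hx1 hx2
    filter_upwards [h3, ae_lateralSurface_differentiableAt hρ hR hh] with x hx hxm s hs
    obtain ⟨ν, hν, hmem⟩ := hx
    rw [hEq hν.1, hν.unique (isOuterNormal_outer hρ hr hrR hh hxm.1 hxm.2),
      ← one_smul ℝ (lateralNormal _ _)] at hmem
    exact polar_add_smul_of_mem_subdifferential hτ (Or.inl rfl) hxm.2
      (hρ.ne_zero_of_pos (by rw [hxm.1.1]; exact hR)) hmem hs
  have hinn : ∀ x : WithLp 2 (E × ℝ), polar τ x.fst = r → |x.snd| ≤ h → ∀ s : ℝ, 0 ≤ s →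
      polar τ (x.fst + s • (-1 : ℝ) • (W x).fst) = polar τ x.fst + s := fun x hx1 hx2 => by
    refine forall_of_ae_lateralSurface hρ hr hh (hflow (-1)) ?_ hx1 hx2
    filter_upwards [h4, ae_lateralSurface_differentiableAt hρ hr hh] with x hx hxm s hs
    obtain ⟨ν, hν, hmem⟩ := hx
    rw [hEq hν.1, hν.unique (isOuterNormal_inner hρ hr hrR hh hxm.1 hxm.2),
      ← neg_one_smul ℝ (lateralNormal _ _)] at hmem
    exact polar_add_smul_of_mem_subdifferential hτ (Or.inr rfl) hxm.2
      (hρ.ne_zero_of_pos (by rw [hxm.1.1]; exact hr)) hmem hs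
  refine ⟨W, hEq, ⟨⟨_, hWlip⟩, ?_, ?_, ?_⟩, ⟨⟨_, hWlip.neg⟩, ?_, ?_, ?_⟩⟩
  · intro x hx hx' s hs
    simpa only [one_smul, hx] using hout x hx hx' s hs
  · intro x hx hx'
    exact htop x (hx ▸ hrR.le) hx.le hx'
  · intro x hx hx'
    exact hbot x (hx ▸ hrR.le) hx.le hx'
  · intro x hx hx' s hs
    simpa only [neg_one_smul, hx, WithLp.neg_fst] using hinn x hx hx' s hs
  · intro x hx hx'
    rw [WithLp.neg_snd, htop x hx.ge (hx ▸ hrR.le) hx']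
  · intro x hx hx'
    rw [WithLp.neg_snd, hbot x hx.ge (hx ▸ hrR.le) hx']

omit [MeasurableSpace E] [BorelSpace E] in
theorem HasSurfaceDivAt.hasLateralDivAt_outer {W : WithLp 2 (E × ℝ) → WithLp 2 (E × ℝ)}
    (hW : EqOn w W (frontier (hollowCylinder (polar τ) r R h))) {x : WithLp 2 (E × ℝ)} {d : ℝ}
    (hx : x ∈ lateralSurface (polar τ) R h) (hd : DifferentiableAt ℝ (polar τ) x.fst)
    (hdiv : HasSurfaceDivAt (hollowCylinder (polar τ) r R h) w x d) :
    HasLateralDivAt (polar τ) R h W x d := by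
  have hρ := hτ.isGauge_polar
  obtain ⟨ν, L, hν, hL, rfl⟩ := hdiv
  refine ⟨L, ?_, ?_⟩
  · exact ((hL.congr' (fun y hy => (hW hy).symm) hν.1).mono
      (lateralSurface_subset_frontier hρ hr hrR hh).1)
  · rw [hν.unique (isOuterNormal_outer hρ hr hrR hh hx hd)]

omit [MeasurableSpace E] [BorelSpace E] in
-- On the inner surface the outer normal points toward smaller ρ, so -W plays the role of the flow
-- field and the divergence changes sign.
theorem HasSurfaceDivAt.hasLateralDivAt_inner {W : WithLp 2 (E × ℝ) → WithLp 2 (E × ℝ)}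
    (hW : EqOn w W (frontier (hollowCylinder (polar τ) r R h))) {x : WithLp 2 (E × ℝ)} {d : ℝ}
    (hx : x ∈ lateralSurface (polar τ) r h) (hd : DifferentiableAt ℝ (polar τ) x.fst)
    (hdiv : HasSurfaceDivAt (hollowCylinder (polar τ) r R h) w x d) :
    HasLateralDivAt (polar τ) r h (fun x => -W x) x (-d) := by
  have hρ := hτ.isGauge_polar
  obtain ⟨ν, L, hν, hL, rfl⟩ := hdiv
  refine ⟨-L, ?_, ?_⟩
  · exact ((hL.congr' (fun y hy => (hW hy).symm) hν.1).mono
      (lateralSurface_subset_frontier hρ hr hrR hh).2).fun_neg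
  · rw [hν.unique (isOuterNormal_inner hρ hr hrR hh hx hd)]
    rw [neg_apply, map_neg, inner_neg_neg, inner_neg_right, ContinuousLinearMap.toLinearMap_neg,
      map_neg]
    ring

omit [MeasurableSpace E] [BorelSpace E] in
-- The flat facet is parametrized isometrically by an open annulus, so the derivative along the
-- surface becomes an ordinary one, and removing the vertical entry of the trace leaves the
-- horizontal divergence.
theorem HasSurfaceDivAt.eq_trace_fderiv {W : WithLp 2 (E × ℝ) → WithLp 2 (E × ℝ)}
    (hW : EqOn w W (frontier (hollowCylinder (polar τ) r R h))) {x : WithLp 2 (E × ℝ)} {d κ : ℝ}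
    (hκ : κ = 1 ∨ κ = -1) (hx : x ∈ flatFacet (polar τ) r R (κ * h))
    (hdiv : HasSurfaceDivAt (hollowCylinder (polar τ) r R h) w x d) :
    d = LinearMap.trace ℝ E
      (fderiv ℝ (fun y => (W (WithLp.toLp 2 (y, κ * h))).fst) x.fst : E →ₗ[ℝ] E) := by
  have hρ := hτ.isGauge_polar
  obtain ⟨ν, L, hν, hL, rfl⟩ := hdiv
  have hκκ : κ * κ = 1 := by rcases hκ with rfl | rfl <;> norm_num
  have hx' : x = WithLp.toLp 2 (x.fst, κ * h) := withLp_ext rfl hx.2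
  have hsub : flatFacet (polar τ) r R (κ * h) ⊆ frontier (hollowCylinder (polar τ) r R h) := by
    rcases hκ with rfl | rfl
    · rw [one_mul]
      exact (flatFacet_subset_frontier hρ hr hrR hh).1
    · rw [neg_one_mul]
      exact (flatFacet_subset_frontier hρ hr hrR hh).2
  have h1 : HasFDerivWithinAt W L (flatFacet (polar τ) r R (κ * h))
      (WithLp.toLp 2 (x.fst, κ * h)) := by
    rw [← hx']
    exact (hL.congr' (fun y hy => (hW hy).symm) hν.1).mono hsub
  have hmaps : MapsTo (fun y : E => (WithLp.toLp 2 (y, κ * h) : WithLp 2 (E × ℝ)))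
      (annulus (polar τ) r R) (flatFacet (polar τ) r R (κ * h)) := fun y hy => ⟨hy, rfl⟩
  have h2 := h1.comp x.fst (hasFDerivAt_toLp_left (κ * h) x.fst).hasFDerivWithinAt hmaps
  have h3 := ((WithLp.fstL 2 ℝ E ℝ : WithLp 2 (E × ℝ) →L[ℝ] E).hasFDerivAt.comp_hasFDerivWithinAt
    x.fst h2).hasFDerivAt ((hρ.isOpen_annulus r R).mem_nhds hx.1)
  have h4 : fderiv ℝ (fun y => (W (WithLp.toLp 2 (y, κ * h))).fst) x.fst = _ := h3.fderiv
  rw [h4, ← trace_sub_inner_verticalUnit, hν.unique (isOuterNormal_flat hρ hκ hr hrR hh hx),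
    map_smul, real_inner_smul_left, real_inner_smul_right, ← mul_assoc, hκκ, one_mul]

end CahnHoffmanFields

/-! ### Fields whose divergence is constant on the facets -/

section FacetwiseConstant

open Module
open scoped NNReal ENNReal

variable {E : Type*} [NormedAddCommGroup E] [InnerProductSpace ℝ E] [FiniteDimensional ℝ E]
  [CompleteSpace E] [MeasurableSpace E] [BorelSpace E]

theorem restrict_le_surfaceMeasure_hollowCylinder {ρ : E → ℝ} (hρ : IsGauge ρ) {r R h : ℝ}
    (hr : 0 < r) (hrR : r < R) (hh : 0 < h) :
    (Measure.hausdorffMeasure (finrank ℝ E : ℝ)).restrict (flatFacet ρ r R h) ≤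
        surfaceMeasure (hollowCylinder ρ r R h) ∧
      (Measure.hausdorffMeasure (finrank ℝ E : ℝ)).restrict (flatFacet ρ r R (-h)) ≤
        surfaceMeasure (hollowCylinder ρ r R h) ∧
      (Measure.hausdorffMeasure (finrank ℝ E : ℝ)).restrict (lateralSurface ρ R h) ≤
        surfaceMeasure (hollowCylinder ρ r R h) ∧
      (Measure.hausdorffMeasure (finrank ℝ E : ℝ)).restrict (lateralSurface ρ r h) ≤
        surfaceMeasure (hollowCylinder ρ r R h) := by
  rw [surfaceMeasure_hollowCylinder hρ hr hrR hh]
  refine ⟨Measure.le_add_right le_rfl, Measure.le_add_left (Measure.le_add_right le_rfl),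
    Measure.le_add_left (Measure.le_add_left (Measure.le_add_right le_rfl)),
    Measure.le_add_left (Measure.le_add_left (Measure.le_add_left le_rfl))⟩

variable {τ : E → ℝ} (hτ : IsGauge τ) {r R h : ℝ} (hr : 0 < r) (hrR : r < R) (hh : 0 < h)
  {w₁ w₂ : WithLp 2 (E × ℝ) → WithLp 2 (E × ℝ)} {e₁ e₂ : WithLp 2 (E × ℝ) → ℝ}
include hτ hr hrR hh

theorem IsCahnHoffman.integrable
    (hw : IsCahnHoffman (verticalSum τ) (hollowCylinder (polar τ) r R h) w₁ e₁) :
    Integrable e₁ (surfaceMeasure (hollowCylinder (polar τ) r R h)) := by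
  have := isFiniteMeasure_surfaceMeasure_hollowCylinder hτ.isGauge_polar hr hrR hh
  exact hw.div_memLp.integrable one_le_two

/-- The horizontal parts of both fields have component 1 along ∇ρ on the outer rim and -1 on the
inner rim. Their difference is tangential, and its divergence integrates to zero. -/
theorem IsCahnHoffman.setIntegral_flatFacet_eq {κ : ℝ} (hκ : κ = 1 ∨ κ = -1)
    (hw₁ : IsCahnHoffman (verticalSum τ) (hollowCylinder (polar τ) r R h) w₁ e₁)
    (hw₂ : IsCahnHoffman (verticalSum τ) (hollowCylinder (polar τ) r R h) w₂ e₂) :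
    ∫ x in flatFacet (polar τ) r R (κ * h), e₁ x ∂(Measure.hausdorffMeasure (finrank ℝ E : ℝ)) =
      ∫ x in flatFacet (polar τ) r R (κ * h), e₂ x
        ∂(Measure.hausdorffMeasure (finrank ℝ E : ℝ)) := by
  have hρ := hτ.isGauge_polar
  have hR : 0 < R := hr.trans hrR
  have key : ∀ w e, IsCahnHoffman (verticalSum τ) (hollowCylinder (polar τ) r R h) w e →
      ∃ (v : E → E) (K : ℝ≥0), LipschitzWith K v ∧
        (∀ y, polar τ y = R → DifferentiableAt ℝ (polar τ) y → ⟪gradient (polar τ) y, v y⟫ = 1) ∧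
        (∀ y, polar τ y = r → DifferentiableAt ℝ (polar τ) y → ⟪gradient (polar τ) y, v y⟫ = -1) ∧
        (∀ᵐ y ∂(Measure.hausdorffMeasure (finrank ℝ E : ℝ)).restrict (annulus (polar τ) r R),
          e (WithLp.toLp 2 (y, κ * h)) = LinearMap.trace ℝ E (fderiv ℝ v y : E →ₗ[ℝ] E)) ∧
        Integrable (fun y => e (WithLp.toLp 2 (y, κ * h)))
          ((Measure.hausdorffMeasure (finrank ℝ E : ℝ)).restrict (annulus (polar τ) r R)) := by
    intro w e hw
    obtain ⟨W, hWeq, hout, hinn⟩ := hw.exists_extension hτ hr hrR hh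
    obtain ⟨K, hK⟩ := hout.lipschitz
    have habs : |κ * h| ≤ h := by
      rcases hκ with rfl | rfl <;> simp [abs_of_pos hh]
    have hsurf := restrict_le_surfaceMeasure_hollowCylinder hρ hr hrR hh
    have hle : (Measure.hausdorffMeasure (finrank ℝ E : ℝ)).restrict
        (flatFacet (polar τ) r R (κ * h)) ≤
        surfaceMeasure (hollowCylinder (polar τ) r R h) := by
      rcases hκ with rfl | rfl
      · rw [one_mul]; exact hsurf.1
      · rw [neg_one_mul]; exact hsurf.2.1
    refine ⟨fun y => (W (WithLp.toLp 2 (y, κ * h))).fst, K, ?_, ?_, ?_, ?_, ?_⟩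
    · refine LipschitzWith.of_dist_le_mul fun x y => ?_
      rw [dist_eq_norm, ← WithLp.sub_fst]
      refine (norm_fst_le_norm _).trans ?_
      rw [← dist_eq_norm]
      have h1 : dist (WithLp.toLp 2 (x, κ * h) : WithLp 2 (E × ℝ)) (WithLp.toLp 2 (y, κ * h)) =
          dist x y := (isometry_toLp_left (κ * h)).dist_eq x y
      exact (hK.dist_le_mul _ _).trans_eq (by rw [h1])
    · intro y hy hd
      refine hρ.inner_gradient_eq_one hd fun s hs => ?_
      have h1 := hout.flow (WithLp.toLp 2 (y, κ * h)) hy habs s hs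
      rw [hy]
      exact h1
    · intro y hy hd
      have h2 : ⟪gradient (polar τ) y, -(W (WithLp.toLp 2 (y, κ * h))).fst⟫ = 1 := by
        refine hρ.inner_gradient_eq_one hd fun s hs => ?_
        have h1 := hinn.flow (WithLp.toLp 2 (y, κ * h)) hy habs s hs
        rw [hy]
        exact h1
      rw [inner_neg_right] at h2
      linarith
    · have h1 := ae_mono hle hw.div_eq
      have h2 := (ae_flatFacet_iff (p := fun x => HasSurfaceDivAt
        (hollowCylinder (polar τ) r R h) w x (e x))).1 h1
      filter_upwards [h2, ae_restrict_mem (hρ.isOpen_annulus r R).measurableSet] with y hy hyA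
      have hyF : (WithLp.toLp 2 (y, κ * h) : WithLp 2 (E × ℝ)) ∈
          flatFacet (polar τ) r R (κ * h) := ⟨hyA, rfl⟩
      exact hy.eq_trace_fderiv hτ hr hrR hh hWeq hκ hyF
    · have h1 := (hw.integrable hτ hr hrR hh).mono_measure hle
      rw [restrict_flatFacet_eq_map] at h1
      exact (measurableEmbedding_toLp_left (κ * h)).integrable_map_iff.1 h1
  obtain ⟨v₁, K₁, hv₁, hR₁, hr₁, he₁, hi₁⟩ := key w₁ e₁ hw₁
  obtain ⟨v₂, K₂, hv₂, hR₂, hr₂, he₂, hi₂⟩ := key w₂ e₂ hw₂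
  rw [integral_flatFacet, integral_flatFacet, ← sub_eq_zero, ← integral_sub hi₁ hi₂,
    ← hρ.integral_trace_fderiv_eq_zero (Measure.hausdorffMeasure (finrank ℝ E : ℝ)) hr hrR
      (hv₁.sub hv₂) ?_]
  · refine integral_congr_ae ?_
    filter_upwards [he₁, he₂, ae_restrict_of_ae hv₁.ae_differentiableAt,
      ae_restrict_of_ae hv₂.ae_differentiableAt] with y h1 h2 h3 h4
    rw [h1, h2, ← map_sub, fderiv_fun_sub h3 h4]
    rfl
  · rintro y (hy | hy) hd
    · rw [inner_sub_right, hr₁ y hy hd, hr₂ y hy hd, sub_self]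
    · rw [inner_sub_right, hR₁ y hy hd, hR₂ y hy hd, sub_self]

/-- Both fields move the outer surface through the same family of surfaces, with κ = 1. -/
theorem IsCahnHoffman.setIntegral_outer_eq
    (hw₁ : IsCahnHoffman (verticalSum τ) (hollowCylinder (polar τ) r R h) w₁ e₁)
    (hw₂ : IsCahnHoffman (verticalSum τ) (hollowCylinder (polar τ) r R h) w₂ e₂) :
    ∫ x in lateralSurface (polar τ) R h, e₁ x ∂(Measure.hausdorffMeasure (finrank ℝ E : ℝ)) =
      ∫ x in lateralSurface (polar τ) R h, e₂ x
        ∂(Measure.hausdorffMeasure (finrank ℝ E : ℝ)) := by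
  have hρ := hτ.isGauge_polar
  have hR : 0 < R := hr.trans hrR
  obtain ⟨-, -, hle, -⟩ := restrict_le_surfaceMeasure_hollowCylinder hρ hr hrR hh
  have key : ∀ w e, IsCahnHoffman (verticalSum τ) (hollowCylinder (polar τ) r R h) w e →
      ∃ W, IsLateralFlow (polar τ) R h 1 W ∧
        (∀ᵐ x ∂(Measure.hausdorffMeasure (finrank ℝ E : ℝ)).restrict
          (lateralSurface (polar τ) R h), HasLateralDivAt (polar τ) R h W x (e x)) := by
    intro w e hw
    obtain ⟨W, hWeq, hout, -⟩ := hw.exists_extension hτ hr hrR hh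
    refine ⟨W, hout, ?_⟩
    filter_upwards [ae_mono hle hw.div_eq, ae_lateralSurface_differentiableAt hρ hR hh]
      with x hx hxm
    exact hx.hasLateralDivAt_outer hτ hr hrR hh hWeq hxm.1 hxm.2
  obtain ⟨W₁, hW₁, hd₁⟩ := key w₁ e₁ hw₁
  obtain ⟨W₂, hW₂, hd₂⟩ := key w₂ e₂ hw₂
  exact IsLateralFlow.integral_div_eq hρ hR hh hW₁ hW₂ hd₁ hd₂
    (hw₁.div_memLp.1.mono_measure hle) (hw₂.div_memLp.1.mono_measure hle)

/-- The negatives of both fields enlarge the radius and shorten the height, so the flow argument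
applies with κ = -1; the two sign changes cancel. -/
theorem IsCahnHoffman.setIntegral_inner_eq
    (hw₁ : IsCahnHoffman (verticalSum τ) (hollowCylinder (polar τ) r R h) w₁ e₁)
    (hw₂ : IsCahnHoffman (verticalSum τ) (hollowCylinder (polar τ) r R h) w₂ e₂) :
    ∫ x in lateralSurface (polar τ) r h, e₁ x ∂(Measure.hausdorffMeasure (finrank ℝ E : ℝ)) =
      ∫ x in lateralSurface (polar τ) r h, e₂ x
        ∂(Measure.hausdorffMeasure (finrank ℝ E : ℝ)) := by
  have hρ := hτ.isGauge_polar
  obtain ⟨-, -, -, hle⟩ := restrict_le_surfaceMeasure_hollowCylinder hρ hr hrR hh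
  have key : ∀ w e, IsCahnHoffman (verticalSum τ) (hollowCylinder (polar τ) r R h) w e →
      ∃ W, IsLateralFlow (polar τ) r h (-1) W ∧
        (∀ᵐ x ∂(Measure.hausdorffMeasure (finrank ℝ E : ℝ)).restrict
          (lateralSurface (polar τ) r h), HasLateralDivAt (polar τ) r h W x (-e x)) := by
    intro w e hw
    obtain ⟨W, hWeq, -, hinn⟩ := hw.exists_extension hτ hr hrR hh
    refine ⟨_, hinn, ?_⟩
    filter_upwards [ae_mono hle hw.div_eq, ae_lateralSurface_differentiableAt hρ hr hh]
      with x hx hxm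
    exact hx.hasLateralDivAt_inner hτ hr hrR hh hWeq hxm.1 hxm.2
  obtain ⟨W₁, hW₁, hd₁⟩ := key w₁ e₁ hw₁
  obtain ⟨W₂, hW₂, hd₂⟩ := key w₂ e₂ hw₂
  have h1 := IsLateralFlow.integral_div_eq hρ hr hh hW₁ hW₂ hd₁ hd₂
    (hw₁.div_memLp.1.mono_measure hle).neg (hw₂.div_memLp.1.mono_measure hle).neg
  rwa [integral_neg, integral_neg, neg_inj] at h1

/-- A field whose divergence is constant on each of the facets satisfies a Pythagorean identity. -/
theorem IsCahnHoffman.integral_sq_eq {z w : WithLp 2 (E × ℝ) → WithLp 2 (E × ℝ)}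
    {d e : WithLp 2 (E × ℝ) → ℝ} {c₁ c₂ c₃ c₄ : ℝ}
    (hz : IsCahnHoffman (verticalSum τ) (hollowCylinder (polar τ) r R h) z d)
    (h₁ : ∀ x ∈ flatFacet (polar τ) r R h, d x = c₁)
    (h₂ : ∀ x ∈ flatFacet (polar τ) r R (-h), d x = c₂)
    (h₃ : ∀ x ∈ lateralSurface (polar τ) R h, d x = c₃)
    (h₄ : ∀ x ∈ lateralSurface (polar τ) r h, d x = c₄)
    (hw : IsCahnHoffman (verticalSum τ) (hollowCylinder (polar τ) r R h) w e) :
    ∫ x, (e x) ^ 2 ∂surfaceMeasure (hollowCylinder (polar τ) r R h) =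
      ∫ x, (d x) ^ 2 ∂surfaceMeasure (hollowCylinder (polar τ) r R h) +
        ∫ x, (e x - d x) ^ 2 ∂surfaceMeasure (hollowCylinder (polar τ) r R h) := by
  have hρ := hτ.isGauge_polar
  have hfin := isFiniteMeasure_surfaceMeasure_hollowCylinder hρ hr hrR hh
  have hdI := hz.integrable hτ hr hrR hh
  have heI := hw.integrable hτ hr hrR hh
  have hprod : Integrable (fun x => (e x - d x) * d x)
      (surfaceMeasure (hollowCylinder (polar τ) r R h)) :=
    (hw.div_memLp.sub hz.div_memLp).integrable_mul hz.div_memLp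
  have hfacet : ∀ (S : Set (WithLp 2 (E × ℝ))) (c : ℝ), MeasurableSet S →
      (Measure.hausdorffMeasure (finrank ℝ E : ℝ)).restrict S ≤
        surfaceMeasure (hollowCylinder (polar τ) r R h) → (∀ x ∈ S, d x = c) →
      ∫ x in S, e x ∂(Measure.hausdorffMeasure (finrank ℝ E : ℝ)) =
        ∫ x in S, d x ∂(Measure.hausdorffMeasure (finrank ℝ E : ℝ)) →
      ∫ x in S, (e x - d x) * d x ∂(Measure.hausdorffMeasure (finrank ℝ E : ℝ)) = 0 := by
    intro S c hS hle hc heq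
    rw [setIntegral_congr_fun hS (g := fun x => (e x - d x) * c)
      (fun x hx => by simp only [hc x hx]), integral_mul_const,
      integral_sub (heI.mono_measure hle) (hdI.mono_measure hle), heq, sub_self, zero_mul]
  -- On each facet `d` is a constant factor and `e - d` has zero integral, so the cross term
  -- vanishes.
  have hzero : ∫ x, (e x - d x) * d x ∂surfaceMeasure (hollowCylinder (polar τ) r R h) = 0 := by
    obtain ⟨hl₁, hl₂, hl₃, hl₄⟩ := restrict_le_surfaceMeasure_hollowCylinder hρ hr hrR hh
    have e1 := hfacet _ _ (measurableSet_flatFacet hρ r R h) hl₁ h₁ (by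
      simpa using hw.setIntegral_flatFacet_eq hτ hr hrR hh (Or.inl rfl) hz)
    have e2 := hfacet _ _ (measurableSet_flatFacet hρ r R (-h)) hl₂ h₂ (by
      simpa using hw.setIntegral_flatFacet_eq hτ hr hrR hh (Or.inr rfl) hz)
    have e3 := hfacet _ _ (measurableSet_lateralSurface hρ R h) hl₃ h₃
      (hw.setIntegral_outer_eq hτ hr hrR hh hz)
    have e4 := hfacet _ _ (measurableSet_lateralSurface hρ r h) hl₄ h₄
      (hw.setIntegral_inner_eq hτ hr hrR hh hz)
    have i1 := hprod.mono_measure hl₁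
    have i2 := hprod.mono_measure hl₂
    have i3 := hprod.mono_measure hl₃
    have i4 := hprod.mono_measure hl₄
    rw [surfaceMeasure_hollowCylinder hρ hr hrR hh,
      integral_add_measure i1 (i2.add_measure (i3.add_measure i4)),
      integral_add_measure i2 (i3.add_measure i4), integral_add_measure i3 i4, e1, e2, e3, e4]
    simp
  have hdd : Integrable (fun x => (d x) ^ 2)
    (surfaceMeasure (hollowCylinder (polar τ) r R h)) := hz.div_memLp.integrable_sq
  have hed : Integrable (fun x => (e x - d x) ^ 2)
    (surfaceMeasure (hollowCylinder (polar τ) r R h)) :=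
    (hw.div_memLp.sub hz.div_memLp).integrable_sq
  have hsum : Integrable (fun x => (d x) ^ 2 + (e x - d x) ^ 2)
    (surfaceMeasure (hollowCylinder (polar τ) r R h)) := hdd.add hed
  have hexp : ∀ x, (e x) ^ 2 = (d x) ^ 2 + (e x - d x) ^ 2 + 2 * ((e x - d x) * d x) :=
    fun x => by ring
  rw [integral_congr_ae (Eventually.of_forall hexp), integral_add hsum
    (hprod.const_mul 2), integral_add hdd hed, integral_const_mul, hzero, mul_zero, add_zero]

theorem IsCahnHoffman.isMinimal {z : WithLp 2 (E × ℝ) → WithLp 2 (E × ℝ)}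
    {d : WithLp 2 (E × ℝ) → ℝ} {c₁ c₂ c₃ c₄ : ℝ}
    (hz : IsCahnHoffman (verticalSum τ) (hollowCylinder (polar τ) r R h) z d)
    (h₁ : ∀ x ∈ flatFacet (polar τ) r R h, d x = c₁)
    (h₂ : ∀ x ∈ flatFacet (polar τ) r R (-h), d x = c₂)
    (h₃ : ∀ x ∈ lateralSurface (polar τ) R h, d x = c₃)
    (h₄ : ∀ x ∈ lateralSurface (polar τ) r h, d x = c₄) :
    IsMinimalCahnHoffman (verticalSum τ) (hollowCylinder (polar τ) r R h) z d := by
  refine ⟨hz, fun w e hw => ?_⟩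
  rw [hz.integral_sq_eq hτ hr hrR hh h₁ h₂ h₃ h₄ hw]
  exact le_add_of_nonneg_right (integral_nonneg fun x => sq_nonneg _)

/-- Minimality leaves no room for the square term in the Pythagorean identity. Since a curvature may
come from any minimal field, this makes it well defined a.e. -/
theorem IsMinimalCahnHoffman.ae_eq {z w : WithLp 2 (E × ℝ) → WithLp 2 (E × ℝ)}
    {d e : WithLp 2 (E × ℝ) → ℝ} {c₁ c₂ c₃ c₄ : ℝ}
    (hw : IsMinimalCahnHoffman (verticalSum τ) (hollowCylinder (polar τ) r R h) w e)
    (hz : IsCahnHoffman (verticalSum τ) (hollowCylinder (polar τ) r R h) z d)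
    (h₁ : ∀ x ∈ flatFacet (polar τ) r R h, d x = c₁)
    (h₂ : ∀ x ∈ flatFacet (polar τ) r R (-h), d x = c₂)
    (h₃ : ∀ x ∈ lateralSurface (polar τ) R h, d x = c₃)
    (h₄ : ∀ x ∈ lateralSurface (polar τ) r h, d x = c₄) :
    ∀ᵐ x ∂surfaceMeasure (hollowCylinder (polar τ) r R h), e x = d x := by
  have hed : Integrable (fun x => (e x - d x) ^ 2)
    (surfaceMeasure (hollowCylinder (polar τ) r R h)) :=
    (hw.1.div_memLp.sub hz.div_memLp).integrable_sq
  have h5 := hw.2 z d hz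
  rw [hz.integral_sq_eq hτ hr hrR hh h₁ h₂ h₃ h₄ hw.1] at h5
  have h6 : ∫ x, (e x - d x) ^ 2 ∂surfaceMeasure (hollowCylinder (polar τ) r R h) = 0 :=
    le_antisymm (by linarith) (integral_nonneg fun x => sq_nonneg _)
  have h7 := (integral_eq_zero_iff_of_nonneg (fun x => sq_nonneg _) hed).1 h6
  filter_upwards [h7] with x hx
  exact sub_eq_zero.1 (pow_eq_zero_iff two_ne_zero |>.1 hx)

end FacetwiseConstant

/-! ### The explicit minimal Cahn-Hoffman field -/

section ProductField

open Module

variable {E : Type*} [NormedAddCommGroup E] [InnerProductSpace ℝ E] [FiniteDimensional ℝ E]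

/-- The linear map `x ↦ (A x', c x_n)`. -/
def blockDiagonal (A : E →L[ℝ] E) (c : ℝ) : WithLp 2 (E × ℝ) →L[ℝ] WithLp 2 (E × ℝ) :=
  (horizontalInclusion E).comp (A.comp (WithLp.fstL 2 ℝ E ℝ)) +
    (c • (WithLp.sndL 2 ℝ E ℝ : WithLp 2 (E × ℝ) →L[ℝ] ℝ)).smulRight (verticalUnit E)

theorem fst_blockDiagonal (A : E →L[ℝ] E) (c : ℝ) (x : WithLp 2 (E × ℝ)) :
    (blockDiagonal A c x).fst = A x.fst := by
  simp [blockDiagonal, horizontalInclusion, verticalUnit]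

theorem snd_blockDiagonal (A : E →L[ℝ] E) (c : ℝ) (x : WithLp 2 (E × ℝ)) :
    (blockDiagonal A c x).snd = c * x.snd := by
  simp [blockDiagonal, horizontalInclusion, verticalUnit]

theorem hasFDerivAt_toLp_blockDiagonal {G : E → E} {A : E →L[ℝ] E} {x : WithLp 2 (E × ℝ)}
    (hG : HasFDerivAt G A x.fst) (h : ℝ) :
    HasFDerivAt (fun y : WithLp 2 (E × ℝ) => (WithLp.toLp 2 (G y.fst, y.snd / h) :
      WithLp 2 (E × ℝ))) (blockDiagonal A h⁻¹) x := by
  have h1 := (horizontalInclusion E).hasFDerivAt.comp x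
    (hG.comp x (WithLp.fstL 2 ℝ E ℝ : WithLp 2 (E × ℝ) →L[ℝ] E).hasFDerivAt)
  have h2 := (h⁻¹ • (WithLp.sndL 2 ℝ E ℝ : WithLp 2 (E × ℝ) →L[ℝ] ℝ)).hasFDerivAt (x := x)
    |>.smul_const (verticalUnit E)
  refine (h1.add h2).congr_of_eventuallyEq (Eventually.of_forall fun y => ?_)
  exact withLp_ext (by simp [horizontalInclusion, verticalUnit])
    (by simp [horizontalInclusion, verticalUnit, div_eq_inv_mul])

theorem trace_blockDiagonal (A : E →L[ℝ] E) (c : ℝ) :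
    LinearMap.trace ℝ _ (blockDiagonal A c : WithLp 2 (E × ℝ) →ₗ[ℝ] WithLp 2 (E × ℝ)) =
      LinearMap.trace ℝ E (A : E →ₗ[ℝ] E) + c := by
  have h1 := trace_sub_inner_verticalUnit (blockDiagonal A c)
  have h2 : (WithLp.fstL 2 ℝ E ℝ).comp ((blockDiagonal A c).comp (horizontalInclusion E)) = A := by
    ext1 v
    simp [blockDiagonal, horizontalInclusion, verticalUnit]
  rw [h2, inner_verticalUnit_left, snd_blockDiagonal] at h1
  rw [← h1, show (verticalUnit E).snd = 1 from rfl]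
  ring

end ProductField

/-! ### The radial profile of the explicit field and its derivative. -/

section TorusField

open Module
open scoped NNReal ENNReal

theorem sub_pow_pos {n : ℕ} (hn : 3 ≤ n) {r R : ℝ} (hr : 0 < r) (hrR : r < R) :
    0 < R ^ (n - 1) - r ^ (n - 1) :=
  sub_pos.2 (pow_lt_pow_left₀ hrR hr.le (by omega))

theorem torusA_neg {n : ℕ} (hn : 3 ≤ n) {r R : ℝ} (hr : 0 < r) (hrR : r < R) :
    torusA n r R < 0 := by
  have hD := sub_pow_pos hn hr hrR
  have hR : 0 < R := hr.trans hrR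
  rw [torusA, neg_lt_zero]
  positivity

theorem torusB_pos {n : ℕ} (hn : 3 ≤ n) {r R : ℝ} (hr : 0 < r) (hrR : r < R) :
    0 < torusB n r R := by
  have hD := sub_pow_pos hn hr hrR
  have hR : 0 < R := hr.trans hrR
  rw [torusB]
  positivity

/-- The constants a and b are the solution of g(R) = 1/R and g(r) = -1/r, the boundary values that
put the field in the subdifferential on the lateral surfaces. -/
theorem torus_profile_outer {n : ℕ} (hn : 3 ≤ n) {r R : ℝ} (hr : 0 < r) (hrR : r < R) :
    torusA n r R / R ^ (n - 1) + torusB n r R = R⁻¹ := by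
  have hD := (sub_pow_pos hn hr hrR).ne'
  have hR : 0 < R := hr.trans hrR
  obtain ⟨k, rfl⟩ := Nat.exists_eq_add_of_le' hn
  rw [torusA, torusB]
  rw [show k + 3 - 1 = k + 2 by omega] at hD ⊢
  rw [show k + 3 - 2 = k + 1 by omega]
  generalize hD' : R ^ (k + 2) - r ^ (k + 2) = D at hD
  field_simp
  rw [← hD']
  ring

theorem torus_profile_inner {n : ℕ} (hn : 3 ≤ n) {r R : ℝ} (hr : 0 < r) (hrR : r < R) :
    torusA n r R / r ^ (n - 1) + torusB n r R = -r⁻¹ := by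
  have hD := (sub_pow_pos hn hr hrR).ne'
  have hR : 0 < R := hr.trans hrR
  obtain ⟨k, rfl⟩ := Nat.exists_eq_add_of_le' hn
  rw [torusA, torusB]
  rw [show k + 3 - 1 = k + 2 by omega] at hD ⊢
  rw [show k + 3 - 2 = k + 1 by omega]
  generalize hD' : R ^ (k + 2) - r ^ (k + 2) = D at hD
  field_simp
  rw [← hD']
  ring

/-- s g(s) = a s^(2-n) + b s is increasing because a < 0 < b, and it runs from -1 at r to 1 at R. -/
theorem abs_torus_profile_mul_le {n : ℕ} (hn : 3 ≤ n) {r R s : ℝ} (hr : 0 < r) (hrR : r < R)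
    (h1 : r ≤ s) (h2 : s ≤ R) :
    |torusA n r R / s ^ (n - 1) + torusB n r R| * s ≤ 1 := by
  have hs : 0 < s := hr.trans_le h1
  have hR : 0 < R := hr.trans hrR
  have hA := torusA_neg hn hr hrR
  have hB := torusB_pos hn hr hrR
  have e1 := torus_profile_outer hn hr hrR
  have e2 := torus_profile_inner hn hr hrR
  have key : ∀ q : ℝ, 0 < q → (torusA n r R / q ^ (n - 1) + torusB n r R) * q =
      torusA n r R / q ^ (n - 2) + torusB n r R * q := fun q hq => by
    rw [show n - 1 = n - 2 + 1 by omega, pow_succ]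
    field_simp
  have f1 := key R hR
  have f2 := key r hr
  rw [e1, inv_mul_cancel₀ hR.ne'] at f1
  rw [e2, neg_mul, inv_mul_cancel₀ hr.ne'] at f2
  have mono : ∀ p q : ℝ, 0 < p → p ≤ q → torusA n r R / p ^ (n - 2) + torusB n r R * p ≤
      torusA n r R / q ^ (n - 2) + torusB n r R * q := fun p q hp hpq => by
    refine add_le_add ?_ (mul_le_mul_of_nonneg_left hpq hB.le)
    have h3 : -torusA n r R / q ^ (n - 2) ≤ -torusA n r R / p ^ (n - 2) :=
      div_le_div_of_nonneg_left (by linarith) (pow_pos hp _) (pow_le_pow_left₀ hp.le hpq _)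
    rw [neg_div, neg_div] at h3
    linarith
  nth_rewrite 2 [← abs_of_pos hs]
  rw [← abs_mul, key s hs, abs_le]
  constructor
  · rw [f2]; exact mono r s hr h1
  · rw [f1]; exact mono s R hs h2

variable {n : ℕ}

theorem finrank_horizontal (n : ℕ) : finrank ℝ (Horizontal n) = n - 1 := by
  rw [finrank_euclideanSpace, Fintype.card_fin]

variable {τ : Horizontal n → ℝ} (hτ : IsGauge τ) {r R h : ℝ}

/-- The derivative of the horizontal part of the explicit field. -/
def torusFieldHorizontalDeriv (τ : Horizontal n → ℝ) (r R : ℝ) (y : Horizontal n) :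
    Horizontal n →L[ℝ] Horizontal n :=
  (torusA n r R / polar τ y ^ (n - 1) + torusB n r R) • ContinuousLinearMap.id ℝ (Horizontal n) +
    ((-((n - 1 : ℕ) * torusA n r R / polar τ y ^ (n - 1 + 1))) •
      fderiv ℝ (polar τ) y).smulRight y

theorem hasDerivAt_torus_profile (n : ℕ) (a b : ℝ) {s : ℝ} (hs : 0 < s) :
    HasDerivAt (fun s : ℝ => a / s ^ (n - 1) + b) (-((n - 1 : ℕ) * a / s ^ (n - 1 + 1))) s := by
  have h1 := (((hasDerivAt_pow (n - 1) s).fun_inv (pow_pos hs _).ne').const_mul a).add_const b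
  refine h1.congr_deriv ?_
  rcases Nat.eq_zero_or_pos (n - 1) with h0 | h0
  · simp [h0]
  · obtain ⟨k, hk⟩ := Nat.exists_eq_add_one.2 h0
    rw [hk, add_tsub_cancel_right]
    field_simp
    ring

theorem hasFDerivAt_torusField_horizontal {y : Horizontal n}
    (hy : DifferentiableAt ℝ (polar τ) y) (hpos : 0 < polar τ y) :
    HasFDerivAt (fun y => (torusA n r R / polar τ y ^ (n - 1) + torusB n r R) • y)
      (torusFieldHorizontalDeriv τ r R y) y :=
  ((hasDerivAt_torus_profile n (torusA n r R) (torusB n r R) hpos).comp_hasFDerivAt y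
    hy.hasFDerivAt).smul (hasFDerivAt_id y)

theorem hasFDerivAt_torusField {x : Ambient n} (hx : DifferentiableAt ℝ (polar τ) x.fst)
    (hpos : 0 < polar τ x.fst) :
    HasFDerivAt (torusField τ r R h)
      (blockDiagonal (torusFieldHorizontalDeriv τ r R x.fst) h⁻¹) x :=
  hasFDerivAt_toLp_blockDiagonal (hasFDerivAt_torusField_horizontal hx hpos) h

include hτ

/-- Euler's identity gives the divergence (n-1) g + ρ g'(ρ), in which the terms with a cancel. -/
theorem trace_torusFieldHorizontalDeriv {y : Horizontal n}
    (hy : DifferentiableAt ℝ (polar τ) y) (hpos : 0 < polar τ y) :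
    LinearMap.trace ℝ _ (torusFieldHorizontalDeriv τ r R y : Horizontal n →ₗ[ℝ] Horizontal n) =
      (n - 1 : ℕ) * torusB n r R := by
  have h1 : fderiv ℝ (polar τ) y y = polar τ y := by
    rw [← inner_gradient_left, hτ.isGauge_polar.inner_gradient_self hy]
  have h2 : (torusFieldHorizontalDeriv τ r R y : Horizontal n →ₗ[ℝ] Horizontal n) =
      (torusA n r R / polar τ y ^ (n - 1) + torusB n r R) • LinearMap.id +
      LinearMap.smulRight (((-((n - 1 : ℕ) * torusA n r R / polar τ y ^ (n - 1 + 1))) •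
      fderiv ℝ (polar τ) y : Horizontal n →L[ℝ] ℝ) : Horizontal n →ₗ[ℝ] ℝ) y := rfl
  rw [h2, map_add, map_smul, LinearMap.trace_id, LinearMap.trace_smulRight, finrank_horizontal,
    ContinuousLinearMap.coe_coe, smul_apply, h1, smul_eq_mul, smul_eq_mul, pow_succ]
  field_simp
  ring

/-- Since ⟪∇ρ(y), y⟫ = ρ(y), the normal entry of the derivative is g + ρ g'(ρ). -/
theorem inner_lateralNormal_torusFieldDeriv {y : Horizontal n}
    (hy : DifferentiableAt ℝ (polar τ) y) (hpos : 0 < polar τ y) (c : ℝ) :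
    ⟪lateralNormal (polar τ) y, blockDiagonal (torusFieldHorizontalDeriv τ r R y) c
      (lateralNormal (polar τ) y)⟫ =
      torusA n r R / polar τ y ^ (n - 1) + torusB n r R -
        (n - 1 : ℕ) * (torusA n r R / polar τ y ^ (n - 1)) := by
  have hρ := hτ.isGauge_polar
  have hg : 0 < ‖gradient (polar τ) y‖ :=
    norm_pos_iff.2 (hρ.gradient_ne_zero hy (hρ.ne_zero_of_pos hpos))
  have h2 : (lateralNormal (polar τ) y).fst =
    ‖gradient (polar τ) y‖⁻¹ • gradient (polar τ) y := rfl
  have h3 : torusFieldHorizontalDeriv τ r R y (gradient (polar τ) y) =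
      (torusA n r R / polar τ y ^ (n - 1) + torusB n r R) • gradient (polar τ) y +
      (-((n - 1 : ℕ) * torusA n r R / polar τ y ^ (n - 1 + 1)) *
        ‖gradient (polar τ) y‖ ^ 2) • y := by
    rw [← real_inner_self_eq_norm_sq, inner_gradient_left]
    rfl
  rw [inner_lateralNormal, fst_blockDiagonal, h2, map_smul, inner_smul_right, h3, inner_add_right,
    inner_smul_right, inner_smul_right, hρ.inner_gradient_self hy, real_inner_self_eq_norm_sq,
    pow_succ]
  field_simp
  ring

end TorusField

/-! ### The explicit field is a minimal Cahn-Hoffman field. -/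

section TorusCahnHoffman

open Module
open scoped NNReal ENNReal

variable {n : ℕ} {τ : Horizontal n → ℝ} {r R h : ℝ}

theorem torusDivergence_flat {κ : ℝ} (hκ : κ = 1 ∨ κ = -1) (hh : 0 < h) {x : Ambient n}
    (hx : x ∈ flatFacet (polar τ) r R (κ * h)) :
    torusDivergence τ r R h x = ((n : ℝ) - 1) * torusB n r R := by
  have : |x.snd| = h := by
    rw [hx.2]
    rcases hκ with rfl | rfl <;> simp [abs_of_pos hh]
  rw [torusDivergence, if_pos this]

theorem torusDivergence_outer {x : Ambient n} (hx : x ∈ lateralSurface (polar τ) R h) :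
    torusDivergence τ r R h x = ((n : ℝ) - 2) / R + 1 / h := by
  rw [torusDivergence, if_neg hx.2.ne, if_pos hx.1]

theorem torusDivergence_inner (hrR : r < R) {x : Ambient n}
    (hx : x ∈ lateralSurface (polar τ) r h) :
    torusDivergence τ r R h x = -(((n : ℝ) - 2) / r) + 1 / h := by
  rw [torusDivergence, if_neg hx.2.ne, if_neg (by rw [hx.1]; exact hrR.ne)]

theorem measurable_torusDivergence (hτ : IsGauge τ) : Measurable (torusDivergence τ r R h) := by
  classical
  have h1 : MeasurableSet {x : Ambient n | |x.snd| = h} :=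
    (isClosed_eq (continuous_abs.comp (WithLp.continuous_snd 2 (Horizontal n) ℝ))
      continuous_const).measurableSet
  have h2 : MeasurableSet {x : Ambient n | polar τ x.fst = R} :=
    (isClosed_eq (hτ.isGauge_polar.continuous.comp (WithLp.continuous_fst 2 (Horizontal n) ℝ))
      continuous_const).measurableSet
  exact Measurable.ite h1 measurable_const (Measurable.ite h2 measurable_const measurable_const)

theorem abs_torusDivergence_le (x : Ambient n) : ‖torusDivergence τ r R h x‖ ≤
    |((n : ℝ) - 1) * torusB n r R| + |((n : ℝ) - 2) / R + 1 / h| +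
      |-(((n : ℝ) - 2) / r) + 1 / h| := by
  rw [Real.norm_eq_abs, torusDivergence]
  have h1 := abs_nonneg (((n : ℝ) - 1) * torusB n r R)
  have h2 := abs_nonneg (((n : ℝ) - 2) / R + 1 / h)
  have h3 := abs_nonneg (-(((n : ℝ) - 2) / r) + 1 / h)
  split_ifs <;> linarith

theorem abs_torus_profile_sub_le (n : ℕ) (a b : ℝ) {s t : ℝ} (hr : 0 < r) (hs : r ≤ s)
    (ht : r ≤ t) : |(a / t ^ (n - 1) + b) - (a / s ^ (n - 1) + b)| ≤
      (n - 1 : ℕ) * |a| / r ^ (n - 1 + 1) * |t - s| := by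
  refine (convex_Ici r).norm_image_sub_le_of_norm_hasDerivWithin_le
    (f := fun s : ℝ => a / s ^ (n - 1) + b)
    (fun q hq => (hasDerivAt_torus_profile n a b (hr.trans_le hq)).hasDerivWithinAt)
    (fun q hq => ?_) hs ht
  have hq' : r ≤ q := hq
  have hq0 : 0 < q := hr.trans_le hq'
  rw [norm_neg, Real.norm_eq_abs, abs_div, abs_mul, abs_of_pos (pow_pos hq0 _), Nat.abs_cast]
  gcongr

/-- On the boundary ρ stays in [r, R], away from the singularity of the profile, so both factors of
g(ρ) x' are bounded and Lipschitz. -/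
theorem exists_lipschitzOnWith_torusField (hn : 3 ≤ n) (hτ : IsGauge τ) (hr : 0 < r)
    (hrR : r < R) (hh : 0 < h) :
    ∃ K, LipschitzOnWith K (torusField τ r R h) (frontier (torus τ r R h)) := by
  have hρ := hτ.isGauge_polar
  obtain ⟨C₁, hC₁⟩ := hρ.exists_lipschitzWith
  obtain ⟨C₂, hC₂0, hC₂⟩ := hρ.exists_norm_le_mul
  set C₃ : ℝ := (n - 1 : ℕ) * |torusA n r R| / r ^ (n - 1 + 1) with hC₃
  have hC₃0 : 0 ≤ C₃ := by positivity
  have hR : 0 < R := hr.trans hrR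
  have key : ∀ x ∈ frontier (torus τ r R h), ∀ y ∈ frontier (torus τ r R h),
      ‖torusField τ r R h x - torusField τ r R h y‖ ≤
        (C₃ * C₁ * (C₂ * R) + r⁻¹ + h⁻¹) * ‖x - y‖ := by
    intro x hx y hy
    obtain ⟨⟨hx1, hx2, -⟩, -⟩ := (mem_frontier_hollowCylinder hρ hr hrR hh).1 hx
    obtain ⟨⟨hy1, hy2, -⟩, -⟩ := (mem_frontier_hollowCylinder hρ hr hrR hh).1 hy
    have hfst : ‖x.fst - y.fst‖ ≤ ‖x - y‖ := norm_fst_le_norm (x - y)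
    have hsnd : |x.snd - y.snd| ≤ ‖x - y‖ := abs_snd_le_norm (x - y)
    set gx := torusA n r R / polar τ x.fst ^ (n - 1) + torusB n r R with hgx
    set gy := torusA n r R / polar τ y.fst ^ (n - 1) + torusB n r R with hgy
    have h1 : torusField τ r R h x - torusField τ r R h y =
        WithLp.toLp 2 (gx • x.fst - gy • y.fst, x.snd / h - y.snd / h) := rfl
    have h2 : |gx - gy| ≤ C₃ * C₁ * ‖x - y‖ := by
      have h3 := abs_torus_profile_sub_le n (torusA n r R) (torusB n r R) hr hy1 hx1
      have h4 := hC₁.dist_le_mul x.fst y.fst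
      rw [Real.dist_eq, dist_eq_norm] at h4
      refine h3.trans ?_
      rw [mul_assoc]
      refine mul_le_mul_of_nonneg_left (h4.trans ?_) hC₃0
      exact mul_le_mul_of_nonneg_left hfst C₁.2
    have h5 : ‖x.fst‖ ≤ C₂ * R :=
      (hC₂ _).trans (mul_le_mul_of_nonneg_left hx2 C₂.2)
    have h6 : |gy| ≤ r⁻¹ := by
      have h7 := abs_torus_profile_mul_le hn hr hrR hy1 hy2
      rw [← hgy] at h7
      rw [← one_div, le_div_iff₀ hr]
      exact (mul_le_mul_of_nonneg_left hy1 (abs_nonneg _)).trans h7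
    have h8 : gx • x.fst - gy • y.fst = (gx - gy) • x.fst + gy • (x.fst - y.fst) := by
      rw [sub_smul, smul_sub]
      abel
    rw [h1]
    refine (norm_toLp_le _ _).trans ?_
    have h9 : ‖gx • x.fst - gy • y.fst‖ ≤ C₃ * C₁ * ‖x - y‖ * (C₂ * R) + r⁻¹ * ‖x - y‖ := by
      rw [h8]
      refine (norm_add_le _ _).trans (add_le_add ?_ ?_)
      · rw [norm_smul, Real.norm_eq_abs]
        exact mul_le_mul h2 h5 (norm_nonneg _) (by positivity)
      · rw [norm_smul, Real.norm_eq_abs]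
        exact mul_le_mul h6 hfst (norm_nonneg _) (by positivity)
    have h10 : |x.snd / h - y.snd / h| ≤ h⁻¹ * ‖x - y‖ := by
      rw [← sub_div, abs_div, abs_of_pos hh, div_eq_inv_mul]
      exact mul_le_mul_of_nonneg_left hsnd (by positivity)
    calc _ ≤ _ := add_le_add h9 h10
      _ = _ := by ring
  refine ⟨(C₃ * C₁ * (C₂ * R) + r⁻¹ + h⁻¹).toNNReal, LipschitzOnWith.of_dist_le_mul ?_⟩
  intro x hx y hy
  rw [dist_eq_norm, dist_eq_norm]
  exact (key x hx y hy).trans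
    (mul_le_mul_of_nonneg_right (Real.le_coe_toNNReal _) (norm_nonneg _))

variable (hτ : IsGauge τ) (hn : 3 ≤ n) (hr : 0 < r) (hrR : r < R) (hh : 0 < h)
include hτ hn hr hrR hh

theorem torusField_mem_outer {x : Ambient n} (hx : x ∈ lateralSurface (polar τ) R h)
    (hd : DifferentiableAt ℝ (polar τ) x.fst) :
    torusField τ r R h x ∈ subdifferential (verticalSum τ) (lateralNormal (polar τ) x.fst) := by
  have hρ := hτ.isGauge_polar
  have hR : 0 < R := hr.trans hrR
  have hx0 : x.fst ≠ 0 := hρ.ne_zero_of_pos (by rw [hx.1]; exact hR)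
  have h1 : (torusField τ r R h x).fst = R⁻¹ • x.fst := by
    rw [← torus_profile_outer hn hr hrR]
    simp only [torusField, hx.1]
    rfl
  have h2 : (torusField τ r R h x).snd = x.snd / h := rfl
  refine mem_subdifferential_verticalSum hτ ?_ ?_ ?_
  · rw [h1, hρ.smul_of_nonneg (by positivity), hx.1, inv_mul_cancel₀ hR.ne']
  · rw [h2, abs_div, abs_of_pos hh, div_le_one hh]
    exact hx.2.le
  · rw [verticalSum_lateralNormal hτ hd hx0, real_inner_comm, inner_lateralNormal, h1,
      inner_smul_right, hρ.inner_gradient_self hd, hx.1, inv_mul_cancel₀ hR.ne', mul_one]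

theorem torusField_mem_inner {x : Ambient n} (hx : x ∈ lateralSurface (polar τ) r h)
    (hd : DifferentiableAt ℝ (polar τ) x.fst) :
    torusField τ r R h x ∈
      subdifferential (verticalSum τ) (-lateralNormal (polar τ) x.fst) := by
  have hρ := hτ.isGauge_polar
  have hx0 : x.fst ≠ 0 := hρ.ne_zero_of_pos (by rw [hx.1]; exact hr)
  have h1 : (torusField τ r R h x).fst = (-r⁻¹) • x.fst := by
    rw [← torus_profile_inner hn hr hrR]
    simp only [torusField, hx.1]
    rfl
  have h2 : (torusField τ r R h x).snd = x.snd / h := rfl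
  refine mem_subdifferential_verticalSum hτ ?_ ?_ ?_
  · rw [h1, hρ.smul, abs_neg, abs_of_pos (inv_pos.2 hr), hx.1, inv_mul_cancel₀ hr.ne']
  · rw [h2, abs_div, abs_of_pos hh, div_le_one hh]
    exact hx.2.le
  · rw [hτ.verticalSum.map_neg, verticalSum_lateralNormal hτ hd hx0, inner_neg_right,
      real_inner_comm, inner_lateralNormal, h1, inner_smul_right, hρ.inner_gradient_self hd, hx.1,
      neg_mul, inv_mul_cancel₀ hr.ne', mul_neg, mul_one, neg_neg]

theorem torusField_mem_flat {κ : ℝ} (hκ : κ = 1 ∨ κ = -1) {x : Ambient n}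
    (hx : x ∈ flatFacet (polar τ) r R (κ * h)) :
    torusField τ r R h x ∈
      subdifferential (verticalSum τ) (κ • verticalUnit (Horizontal n)) := by
  have hρ := hτ.isGauge_polar
  have hκκ : κ * κ = 1 := by rcases hκ with rfl | rfl <;> norm_num
  have hκ1 : |κ| = 1 := by rcases hκ with rfl | rfl <;> norm_num
  have h2 : (torusField τ r R h x).snd = κ := by
    change x.snd / h = κ
    rw [hx.2, mul_div_cancel_right₀ _ hh.ne']
  refine mem_subdifferential_verticalSum hτ ?_ (by rw [h2, hκ1]) ?_
  · change polar τ (_ • x.fst) ≤ 1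
    rw [hρ.smul]
    exact abs_torus_profile_mul_le hn hr hrR hx.1.1.le hx.1.2.le
  · rw [hτ.verticalSum.smul, hκ1, real_inner_smul_right, real_inner_comm,
      inner_verticalUnit_left, h2, hκκ]
    simp [verticalSum, verticalUnit, hτ.map_zero]

/-- Subtracting the normal entry from the full trace leaves (n-2) g + 1/h, with g = 1/R here. On the
inner surface g = -1/r. -/
theorem hasSurfaceDivAt_torusField_outer {x : Ambient n}
    (hx : x ∈ lateralSurface (polar τ) R h) (hd : DifferentiableAt ℝ (polar τ) x.fst) :
    HasSurfaceDivAt (torus τ r R h) (torusField τ r R h) x (torusDivergence τ r R h x) := by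
  have hpos : 0 < polar τ x.fst := by rw [hx.1]; exact hr.trans hrR
  refine ⟨_, _, isOuterNormal_outer hτ.isGauge_polar hr hrR hh hx hd,
    (hasFDerivAt_torusField hd hpos).hasFDerivWithinAt, ?_⟩
  have h1 := torus_profile_outer hn hr hrR
  rw [torusDivergence_outer hx, trace_blockDiagonal, trace_torusFieldHorizontalDeriv hτ hd hpos,
    inner_lateralNormal_torusFieldDeriv hτ hd hpos, hx.1, h1, eq_sub_of_add_eq h1,
    Nat.cast_sub (by omega)]
  push_cast
  ring

theorem hasSurfaceDivAt_torusField_inner {x : Ambient n}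
    (hx : x ∈ lateralSurface (polar τ) r h) (hd : DifferentiableAt ℝ (polar τ) x.fst) :
    HasSurfaceDivAt (torus τ r R h) (torusField τ r R h) x (torusDivergence τ r R h x) := by
  have hpos : 0 < polar τ x.fst := by rw [hx.1]; exact hr
  refine ⟨_, _, isOuterNormal_inner hτ.isGauge_polar hr hrR hh hx hd,
    (hasFDerivAt_torusField hd hpos).hasFDerivWithinAt, ?_⟩
  have h1 := torus_profile_inner hn hr hrR
  rw [torusDivergence_inner hrR hx, trace_blockDiagonal,
    trace_torusFieldHorizontalDeriv hτ hd hpos, map_neg, inner_neg_neg,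
    inner_lateralNormal_torusFieldDeriv hτ hd hpos, hx.1, h1, eq_sub_of_add_eq h1,
    Nat.cast_sub (by omega)]
  push_cast
  ring

theorem hasSurfaceDivAt_torusField_flat {κ : ℝ} (hκ : κ = 1 ∨ κ = -1) {x : Ambient n}
    (hx : x ∈ flatFacet (polar τ) r R (κ * h)) (hd : DifferentiableAt ℝ (polar τ) x.fst) :
    HasSurfaceDivAt (torus τ r R h) (torusField τ r R h) x (torusDivergence τ r R h x) := by
  have hκκ : κ * κ = 1 := by rcases hκ with rfl | rfl <;> norm_num
  have hpos : 0 < polar τ x.fst := hr.trans hx.1.1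
  refine ⟨_, _, isOuterNormal_flat hτ.isGauge_polar hκ hr hrR hh hx,
    (hasFDerivAt_torusField hd hpos).hasFDerivWithinAt, ?_⟩
  rw [torusDivergence_flat hκ hh hx, trace_blockDiagonal,
    trace_torusFieldHorizontalDeriv hτ hd hpos, map_smul, real_inner_smul_left,
    real_inner_smul_right, ← mul_assoc, hκκ, inner_verticalUnit_left, snd_blockDiagonal,
    Nat.cast_sub (by omega)]
  simp [verticalUnit]

theorem isCahnHoffman_torusField :
    IsCahnHoffman (verticalSum τ) (hollowCylinder (polar τ) r R h)
      (torusField τ r R h) (torusDivergence τ r R h) := by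
  have hρ := hτ.isGauge_polar
  have hR : 0 < R := hr.trans hrR
  have htop := ae_flatFacet_differentiableAt hρ r R h
  have hbot := ae_flatFacet_differentiableAt hρ r R (-h)
  have hout := ae_lateralSurface_differentiableAt hρ hR hh
  have hinn := ae_lateralSurface_differentiableAt hρ hr hh
  refine ⟨exists_lipschitzOnWith_torusField hn hτ hr hrR hh, ?_, ?_, ?_⟩
  · rw [ae_surfaceMeasure_hollowCylinder_iff hρ hr hrR hh]
    refine ⟨?_, ?_, ?_, ?_⟩
    · filter_upwards [htop] with x hx
      have hx' : x ∈ flatFacet (polar τ) r R (1 * h) := by rw [one_mul]; exact hx.1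
      exact ⟨_, isOuterNormal_flat hρ (Or.inl rfl) hr hrR hh hx',
        torusField_mem_flat hτ hn hr hrR hh (Or.inl rfl) hx'⟩
    · filter_upwards [hbot] with x hx
      have hx' : x ∈ flatFacet (polar τ) r R (-1 * h) := by rw [neg_one_mul]; exact hx.1
      exact ⟨_, isOuterNormal_flat hρ (Or.inr rfl) hr hrR hh hx',
        torusField_mem_flat hτ hn hr hrR hh (Or.inr rfl) hx'⟩
    · filter_upwards [hout] with x hx
      exact ⟨_, isOuterNormal_outer hρ hr hrR hh hx.1 hx.2,
        torusField_mem_outer hτ hn hr hrR hh hx.1 hx.2⟩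
    · filter_upwards [hinn] with x hx
      exact ⟨_, isOuterNormal_inner hρ hr hrR hh hx.1 hx.2,
        torusField_mem_inner hτ hn hr hrR hh hx.1 hx.2⟩
  · rw [ae_surfaceMeasure_hollowCylinder_iff hρ hr hrR hh]
    refine ⟨?_, ?_, ?_, ?_⟩
    · filter_upwards [htop] with x hx
      exact hasSurfaceDivAt_torusField_flat hτ hn hr hrR hh (Or.inl rfl)
        (by rw [one_mul]; exact hx.1) hx.2
    · filter_upwards [hbot] with x hx
      exact hasSurfaceDivAt_torusField_flat hτ hn hr hrR hh (Or.inr rfl)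
        (by rw [neg_one_mul]; exact hx.1) hx.2
    · filter_upwards [hout] with x hx
      exact hasSurfaceDivAt_torusField_outer hτ hn hr hrR hh hx.1 hx.2
    · filter_upwards [hinn] with x hx
      exact hasSurfaceDivAt_torusField_inner hτ hn hr hrR hh hx.1 hx.2
  · have := isFiniteMeasure_surfaceMeasure_hollowCylinder hρ hr hrR hh
    exact MemLp.of_bound (measurable_torusDivergence hτ).aestronglyMeasurable _
      (Eventually.of_forall abs_torusDivergence_le)

theorem isMinimalCahnHoffman_torusField :
    IsMinimalCahnHoffman (cylindricalAnisotropy τ) (torus τ r R h)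
      (torusField τ r R h) (torusDivergence τ r R h) :=
  (isCahnHoffman_torusField hτ hn hr hrR hh).isMinimal hτ hr hrR hh
    (fun x hx => torusDivergence_flat (Or.inl rfl) hh (by rwa [one_mul]))
    (fun x hx => torusDivergence_flat (Or.inr rfl) hh (by rwa [neg_one_mul]))
    (fun x hx => torusDivergence_outer hx) (fun x hx => torusDivergence_inner hrR hx)

theorem IsMinimalCahnHoffman.ae_eq_torusDivergence {w : Ambient n → Ambient n}
    {e : Ambient n → ℝ}
    (hw : IsMinimalCahnHoffman (cylindricalAnisotropy τ) (torus τ r R h) w e) :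
    ∀ᵐ x ∂surfaceMeasure (torus τ r R h), e x = torusDivergence τ r R h x :=
  IsMinimalCahnHoffman.ae_eq hτ hr hrR hh hw (isCahnHoffman_torusField hτ hn hr hrR hh)
    (fun x hx => torusDivergence_flat (Or.inl rfl) hh (by rwa [one_mul]))
    (fun x hx => torusDivergence_flat (Or.inr rfl) hh (by rwa [neg_one_mul]))
    (fun x hx => torusDivergence_outer hx) (fun x hx => torusDivergence_inner hrR hx)

end TorusCahnHoffman

/-! ### The curvature flow of tori and the system of ordinary differential equations -/

section TorusFlow

open Module

variable {n : ℕ} {τ : Horizontal n → ℝ} (hτ : IsGauge τ) (hn : 3 ≤ n)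
include hτ

/-- As τ(∇ρ) = 1, the mobility is the same factor 1/‖∇ρ‖ that appears in the normal velocity of a
moving level of ρ. -/
theorem cylindricalMobility_lateralNormal (μ : ℝ) {x : Horizontal n}
    (hx : DifferentiableAt ℝ (polar τ) x) (h0 : x ≠ 0) :
    cylindricalMobility τ μ (lateralNormal (polar τ) x) = ‖gradient (polar τ) x‖⁻¹ := by
  have h1 := verticalSum_lateralNormal hτ hx h0
  have h2 : (lateralNormal (polar τ) x).snd = 0 := rfl
  rw [verticalSum, h2, abs_zero, add_zero] at h1
  rw [cylindricalMobility, h2, abs_zero, mul_zero, add_zero, h1]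

theorem cylindricalMobility_neg (μ : ℝ) (p : Ambient n) :
    cylindricalMobility τ μ (-p) = cylindricalMobility τ μ p := by
  rw [cylindricalMobility, cylindricalMobility, WithLp.neg_fst, WithLp.neg_snd, hτ.map_neg,
    abs_neg]

theorem cylindricalMobility_verticalUnit (μ : ℝ) :
    cylindricalMobility τ μ (verticalUnit (Horizontal n)) = μ := by
  simp [cylindricalMobility, verticalUnit, hτ.map_zero]

include hn

/-- At a fixed time, the velocity law for tori is a system of equations for the derivatives of
the parameters. -/
theorem torus_velocity_law_iff {μ : ℝ} {r R h : ℝ → ℝ} {r' R' h' : ℝ} {I : Set ℝ} {t : ℝ}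
    (ht : t ∈ I) (hI : ∀ δ > 0, ∃ s ∈ I, t < s ∧ s < t + δ) (hr : 0 < r t) (hrR : r t < R t)
    (hh : 0 < h t) (hrd : HasDerivWithinAt r r' I t) (hRd : HasDerivWithinAt R R' I t)
    (hhd : HasDerivWithinAt h h' I t) :
    (∃ κ : Ambient n → ℝ,
      IsCrystallineCurvature (cylindricalAnisotropy τ) (torus τ (r t) (R t) (h t)) κ ∧
      ∀ᵐ x ∂surfaceMeasure (torus τ (r t) (R t) (h t)), ∃ ν : Ambient n,
        HasNormalVelocity (fun t => torus τ (r t) (R t) (h t)) I t x ν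
          (cylindricalMobility τ μ ν * κ x)) ↔
    (R' = -(((n : ℝ) - 2) / R t) - 1 / h t ∧ r' = -(((n : ℝ) - 2) / r t) + 1 / h t ∧
      h' = -(((n : ℝ) - 1) * μ * torusB n (r t) (R t))) := by
  have hρ := hτ.isGauge_polar
  have hR : 0 < R t := hr.trans hrR
  have : Nontrivial (Horizontal n) :=
    nontrivial_of_finrank_pos (R := ℝ) (by rw [finrank_horizontal]; omega)
  have hout := ae_lateralSurface_differentiableAt hρ hR hh
  have hinn := ae_lateralSurface_differentiableAt hρ hr hh
  have hVout := fun {x : Ambient n} (hx : x ∈ lateralSurface (polar τ) (R t) (h t)) hd =>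
    hasNormalVelocity_outer hρ hr hrR hh hrd.continuousWithinAt hRd hhd.continuousWithinAt hx hd
  have hVinn := fun {x : Ambient n} (hx : x ∈ lateralSurface (polar τ) (r t) (h t)) hd =>
    hasNormalVelocity_inner hρ hr hrR hh hrd hRd.continuousWithinAt hhd.continuousWithinAt hx hd
  have hVflat := fun {κ : ℝ} (hκ : κ = 1 ∨ κ = -1) {x : Ambient n}
    (hx : x ∈ flatFacet (polar τ) (r t) (R t) (κ * h t)) =>
    hasNormalVelocity_flat hρ hκ hr hrR hh hrd.continuousWithinAt hRd.continuousWithinAt hhd hx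
  constructor
  · rintro ⟨κ, ⟨z, d, hmin, hκ⟩, hV⟩
    -- The given curvature may come from another minimal field; by uniqueness it is still minus the
    -- explicit divergence a.e.
    have hd := hmin.ae_eq_torusDivergence hτ hn hr hrR hh
    have hall : ∀ᵐ x ∂surfaceMeasure (torus τ (r t) (R t) (h t)), ∃ ν : Ambient n,
        HasNormalVelocity (fun t => torus τ (r t) (R t) (h t)) I t x ν
          (cylindricalMobility τ μ ν * -torusDivergence τ (r t) (R t) (h t) x) := by
      filter_upwards [hκ, hd, hV] with x h1 h2 h3
      rwa [h1, h2] at h3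
    obtain ⟨h1, -, h3, h4⟩ := (ae_surfaceMeasure_hollowCylinder_iff hρ hr hrR hh).1 hall
    refine ⟨?_, ?_, ?_⟩
    · have := ae_lateralSurface_neBot hρ hR hh
      -- Each facet has positive measure, so a single good point on it suffices to read off the
      -- corresponding equation.
      obtain ⟨x, ⟨ν, hν⟩, hx, hxd⟩ := (h3.and hout).exists
      have hx0 : x.fst ≠ 0 := hρ.ne_zero_of_pos (by rw [hx.1]; exact hR)
      have hg := norm_ne_zero_iff.2 (hρ.gradient_ne_zero hxd hx0)
      have h5 := hVout hx hxd
      rw [(hν.isOuterNormal ht).unique (h5.isOuterNormal ht),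
        cylindricalMobility_lateralNormal hτ μ hxd hx0, torusDivergence_outer hx] at hν
      have h6 := HasNormalVelocity.unique hI h5 hν
      rw [mul_right_inj' (inv_ne_zero hg)] at h6
      rw [h6]
      ring
    · have := ae_lateralSurface_neBot hρ hr hh
      obtain ⟨x, ⟨ν, hν⟩, hx, hxd⟩ := (h4.and hinn).exists
      have hx0 : x.fst ≠ 0 := hρ.ne_zero_of_pos (by rw [hx.1]; exact hr)
      have hg := norm_ne_zero_iff.2 (hρ.gradient_ne_zero hxd hx0)
      have h5 := hVinn hx hxd
      rw [(hν.isOuterNormal ht).unique (h5.isOuterNormal ht), cylindricalMobility_neg hτ,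
        cylindricalMobility_lateralNormal hτ μ hxd hx0, torusDivergence_inner hrR hx] at hν
      have h6 := HasNormalVelocity.unique hI h5 hν
      rw [← mul_neg, mul_right_inj' (inv_ne_zero hg), neg_inj] at h6
      exact h6
    · have := ae_flatFacet_neBot hρ hr.le hrR (h t)
      obtain ⟨x, ⟨ν, hν⟩, hx, -⟩ :=
        (h1.and (ae_flatFacet_differentiableAt hρ (r t) (R t) (h t))).exists
      rw [← one_mul (h t)] at hx
      have h5 := hVflat (Or.inl rfl) hx
      rw [(hν.isOuterNormal ht).unique (h5.isOuterNormal ht), one_smul,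
        cylindricalMobility_verticalUnit hτ, torusDivergence_flat (Or.inl rfl) hh hx] at hν
      rw [one_smul] at h5
      rw [HasNormalVelocity.unique hI h5 hν]
      ring
  · rintro ⟨hR', hr', hh'⟩
    refine ⟨fun x => -torusDivergence τ (r t) (R t) (h t) x,
      ⟨_, _, isMinimalCahnHoffman_torusField hτ hn hr hrR hh, Eventually.of_forall fun _ => rfl⟩, ?_⟩
    have hflat : ∀ {κ : ℝ}, (κ = 1 ∨ κ = -1) → ∀ {x : Ambient n},
        x ∈ flatFacet (polar τ) (r t) (R t) (κ * h t) → ∃ ν : Ambient n,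
        HasNormalVelocity (fun t => torus τ (r t) (R t) (h t)) I t x ν
          (cylindricalMobility τ μ ν * -torusDivergence τ (r t) (R t) (h t) x) := by
      intro κ hκ x hx
      refine ⟨κ • verticalUnit _, ?_⟩
      have h5 := hVflat hκ hx
      have h6 : cylindricalMobility τ μ (κ • verticalUnit (Horizontal n)) = μ := by
        rcases hκ with rfl | rfl
        · rw [one_smul, cylindricalMobility_verticalUnit hτ]
        · rw [neg_one_smul, cylindricalMobility_neg hτ, cylindricalMobility_verticalUnit hτ]
      rw [h6, torusDivergence_flat hκ hh hx,
        show μ * -(((n : ℝ) - 1) * torusB n (r t) (R t)) = h' by rw [hh']; ring]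
      exact h5
    refine (ae_surfaceMeasure_hollowCylinder_iff hρ hr hrR hh).2 ⟨?_, ?_, ?_, ?_⟩
    · filter_upwards [ae_flatFacet_differentiableAt hρ (r t) (R t) (h t)] with x hx
      exact hflat (Or.inl rfl) (by rw [one_mul]; exact hx.1)
    · filter_upwards [ae_flatFacet_differentiableAt hρ (r t) (R t) (-h t)] with x hx
      exact hflat (Or.inr rfl) (by rw [neg_one_mul]; exact hx.1)
    · filter_upwards [hout] with x hx
      have hx0 : x.fst ≠ 0 := hρ.ne_zero_of_pos (by rw [hx.1.1]; exact hR)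
      refine ⟨lateralNormal (polar τ) x.fst, ?_⟩
      rw [cylindricalMobility_lateralNormal hτ μ hx.2 hx0, torusDivergence_outer hx.1,
        show -(((n : ℝ) - 2) / R t + 1 / h t) = R' by rw [hR']; ring]
      exact hVout hx.1 hx.2
    · filter_upwards [hinn] with x hx
      have hx0 : x.fst ≠ 0 := hρ.ne_zero_of_pos (by rw [hx.1.1]; exact hr)
      refine ⟨-lateralNormal (polar τ) x.fst, ?_⟩
      rw [cylindricalMobility_neg hτ, cylindricalMobility_lateralNormal hτ μ hx.2 hx0,
        torusDivergence_inner hrR hx.1, ← hr', mul_neg]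
      exact hVinn hx.1 hx.2

/-- The law at each time is an equation between values of derivatives; uniqueness of derivatives
within [0, T) turns it into the differential system, the one-sided time 0 included. -/
theorem isCurvatureFlow_torus_iff {μ : ℝ} {r R h : ℝ → ℝ} {T : ℝ} (hdata : IsTorusData r R h T) :
    IsCurvatureFlow (cylindricalAnisotropy τ) (cylindricalMobility τ μ)
      (fun t => torus τ (r t) (R t) (h t)) (Ico 0 T) ↔ SolvesTorusODE n μ r R h T := by
  refine forall₂_congr fun t ht => ?_
  have hI : ∀ δ > 0, ∃ s ∈ Ico 0 T, t < s ∧ s < t + δ := fun δ hδ => by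
    obtain ⟨s, hs1, hs2⟩ := exists_between (lt_min ht.2 (lt_add_of_pos_right t hδ))
    exact ⟨s, ⟨ht.1.trans hs1.le, hs2.trans_le (min_le_left _ _)⟩, hs1,
      hs2.trans_le (min_le_right _ _)⟩
  have hrd := ((hdata.contDiff_r.differentiableOn one_ne_zero) t ht).hasDerivWithinAt
  have hRd := ((hdata.contDiff_R.differentiableOn one_ne_zero) t ht).hasDerivWithinAt
  have hhd := ((hdata.contDiff_h.differentiableOn one_ne_zero) t ht).hasDerivWithinAt
  have huniq : UniqueDiffWithinAt ℝ (Ico 0 T) t := uniqueDiffOn_Ico 0 T t ht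
  have hiff : ∀ (f : ℝ → ℝ) (a b : ℝ), HasDerivWithinAt f a (Ico 0 T) t →
      (a = b ↔ HasDerivWithinAt f b (Ico 0 T) t) := fun f a b hf =>
    ⟨fun hab => hab ▸ hf, fun hf' => huniq.eq_deriv _ hf hf'⟩
  rw [torus_velocity_law_iff hτ hn ht hI (hdata.r_pos t ht) (hdata.r_lt_R t ht)
    (hdata.h_pos t ht) hrd hRd hhd, hiff _ _ _ hRd, hiff _ _ _ hrd, hiff _ _ _ hhd]
  rfl

end TorusFlow

/-! ### Self-similar tori -/

section SelfSimilar

open Module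

variable {n : ℕ} {τ : Horizontal n → ℝ} (hτ : IsGauge τ) (hn : 3 ≤ n)
include hτ

theorem smul_torus {c : ℝ} (hc : 0 < c) (r R h : ℝ) :
    c • torus τ r R h = torus τ (c * r) (c * R) (c * h) := by
  have hρ := hτ.isGauge_polar
  ext x
  rw [mem_smul_set_iff_inv_smul_mem₀ hc.ne']
  change (r < polar τ (c⁻¹ • x.fst) ∧ polar τ (c⁻¹ • x.fst) < R ∧ |c⁻¹ * x.snd| < h) ↔
    (c * r < polar τ x.fst ∧ polar τ x.fst < c * R ∧ |x.snd| < c * h)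
  rw [hρ.smul_of_nonneg (inv_nonneg.2 hc.le), abs_mul, abs_of_pos (inv_pos.2 hc),
    lt_inv_mul_iff₀ hc, inv_mul_lt_iff₀ hc, inv_mul_lt_iff₀ hc]

include hn

theorem image_polar_torus {r R h : ℝ} (hr : 0 < r) (hh : 0 < h) :
    (fun x : Ambient n => polar τ x.fst) '' torus τ r R h = Ioo r R := by
  have hρ := hτ.isGauge_polar
  have : Nontrivial (Horizontal n) :=
    nontrivial_of_finrank_pos (R := ℝ) (by rw [finrank_horizontal]; omega)
  obtain ⟨v, hv⟩ := exists_ne (0 : Horizontal n)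
  have hv0 := hρ.pos v hv
  apply Subset.antisymm
  · rintro _ ⟨x, hx, rfl⟩
    exact ⟨hx.1, hx.2.1⟩
  · intro s hs
    have hs0 : 0 < s := hr.trans hs.1
    have h1 : polar τ ((s / polar τ v) • v) = s := by
      rw [hρ.smul_of_nonneg (by positivity), div_mul_cancel₀ _ hv0.ne']
    refine ⟨WithLp.toLp 2 ((s / polar τ v) • v, 0), ⟨?_, ?_, ?_⟩, h1⟩
    · exact hs.1.trans_eq h1.symm
    · exact h1.trans_lt hs.2
    · change |(0 : ℝ)| < h
      rwa [abs_zero]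

theorem image_snd_torus {r R h : ℝ} (hr : 0 < r) (hrR : r < R) :
    (fun x : Ambient n => x.snd) '' torus τ r R h = Ioo (-h) h := by
  have hρ := hτ.isGauge_polar
  have : Nontrivial (Horizontal n) :=
    nontrivial_of_finrank_pos (R := ℝ) (by rw [finrank_horizontal]; omega)
  obtain ⟨y, hy⟩ := hρ.annulus_nonempty hr.le hrR
  apply Subset.antisymm
  · rintro _ ⟨x, hx, rfl⟩
    exact abs_lt.1 hx.2.2
  · intro s hs
    exact ⟨WithLp.toLp 2 (y, s), ⟨hy.1, hy.2, abs_lt.2 hs⟩, rfl⟩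

/-- The parameters are recovered from the set: r and R bound the range of ρ, and h that of the
vertical coordinate. -/
theorem torus_injective {r R h r' R' h' : ℝ} (hr : 0 < r) (hrR : r < R) (hh : 0 < h)
    (hr' : 0 < r') (hrR' : r' < R') (hh' : 0 < h') (heq : torus τ r R h = torus τ r' R' h') :
    r = r' ∧ R = R' ∧ h = h' := by
  have h1 := image_polar_torus (R := R) hτ hn hr hh
  rw [heq, image_polar_torus hτ hn hr' hh'] at h1
  have h2 := image_snd_torus (h := h) hτ hn hr hrR
  rw [heq, image_snd_torus hτ hn hr' hrR'] at h2
  refine ⟨?_, ?_, ?_⟩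
  · rw [← csInf_Ioo hrR, ← h1, csInf_Ioo hrR']
  · rw [← csSup_Ioo hrR, ← h1, csSup_Ioo hrR']
  · rw [← csSup_Ioo (show -h < h by linarith), ← h2, csSup_Ioo (by linarith)]

/-- Dilations keep the ratios, so r = γR and h = lR at all times. Differentiating at time 0 and
inserting the system gives two relations between γ, l and μ. -/
theorem IsSelfSimilarTorusFlow.parameters {μ : ℝ} {r R h : ℝ → ℝ} {T : ℝ}
    (H : IsSelfSimilarTorusFlow τ μ r R h T) {R₀ γ l : ℝ} (hR₀ : 0 < R₀) (hγ : 0 < γ)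
    (hγ1 : γ < 1) (hl : 0 < l) (hr0 : r 0 = γ * R₀) (hR0 : R 0 = R₀) (hh0 : h 0 = l * R₀) :
    l = γ / (((n : ℝ) - 2) * (1 - γ)) ∧
      ∑ i ∈ Finset.range (n - 1), γ ^ i = ((n : ℝ) - 1) * μ * (1 + γ ^ (n - 2)) := by
  have hT := H.data.time_pos
  have h0 : (0 : ℝ) ∈ Ico 0 T := ⟨le_rfl, hT⟩
  have hpar : ∀ t ∈ Ico 0 T, r t = γ * R t ∧ h t = l * R t := fun t ht => by
    obtain ⟨c, hc, heq⟩ := H.selfSimilar t ht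
    rw [smul_torus hτ hc] at heq
    obtain ⟨h1, h2, h3⟩ := torus_injective hτ hn (H.data.r_pos t ht) (H.data.r_lt_R t ht)
      (H.data.h_pos t ht) (mul_pos hc (H.data.r_pos 0 h0))
      (mul_lt_mul_of_pos_left (H.data.r_lt_R 0 h0) hc) (mul_pos hc (H.data.h_pos 0 h0)) heq
    rw [h1, h2, h3, hr0, hR0, hh0]
    constructor <;> ring
  obtain ⟨hRd, hrd, hhd⟩ := (isCurvatureFlow_torus_iff hτ hn H.data).1 H.flow 0 h0
  have huniq : UniqueDiffWithinAt ℝ (Ico 0 T) 0 := uniqueDiffOn_Ico 0 T 0 h0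
  have e1 := huniq.eq_deriv _ hrd
    ((hRd.const_mul γ).congr (fun t ht => (hpar t ht).1) (hpar 0 h0).1)
  have e2 := huniq.eq_deriv _ hhd
    ((hRd.const_mul l).congr (fun t ht => (hpar t ht).2) (hpar 0 h0).2)
  rw [hr0, hR0, hh0] at e1 e2
  have hγ' : 0 < 1 - γ := sub_pos.2 hγ1
  have hn3 : (3 : ℝ) ≤ n := by exact_mod_cast hn
  have hn2 : 0 < (n : ℝ) - 2 := by linarith
  have hl' : l = γ / (((n : ℝ) - 2) * (1 - γ)) := by
    rw [eq_div_iff (by positivity)]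
    field_simp at e1
    -- The relation r' = γ R' has the factor 1/γ - γ; splitting off 1 + γ > 0 leaves the formula for
    -- l.
    have h1 : (1 + γ) * (l * (((n : ℝ) - 2) * (1 - γ)) - γ) = 0 := by
      linear_combination (-1) * e1
    rcases mul_eq_zero.1 h1 with h2 | h2
    · linarith
    · linarith
  refine ⟨hl', ?_⟩
  have hD : 0 < 1 - γ ^ (n - 1) := sub_pos.2 (pow_lt_one₀ hγ.le hγ1 (by omega))
  have hgeom : (∑ i ∈ Finset.range (n - 1), γ ^ i) * (1 - γ) = 1 - γ ^ (n - 1) :=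
    geom_sum_mul_neg γ (n - 1)
  have hB : (R₀ ^ (n - 2) + (γ * R₀) ^ (n - 2)) / (R₀ ^ (n - 1) - (γ * R₀) ^ (n - 1)) =
      (1 + γ ^ (n - 2)) / ((1 - γ ^ (n - 1)) * R₀) := by
    have h1 : R₀ ^ (n - 1) - (γ * R₀) ^ (n - 1) = (1 - γ ^ (n - 1)) * R₀ * R₀ ^ (n - 2) := by
      rw [mul_pow, show n - 1 = n - 2 + 1 by omega, pow_succ R₀]
      ring
    rw [h1, mul_pow]
    have hp : R₀ ^ (n - 2) ≠ 0 := (pow_pos hR₀ _).ne'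
    field_simp
  rw [hB] at e2
  -- With this l one has l (n-2) + 1 = 1/(1-γ), so comparing h' with l R' leaves a multiple of the
  -- geometric sum.
  have e3 : l * (-(((n : ℝ) - 2) / R₀) - 1 / (l * R₀)) = -(1 / ((1 - γ) * R₀)) := by
    have h1 : l * (-(((n : ℝ) - 2) / R₀) - 1 / (l * R₀)) = -((l * ((n : ℝ) - 2) + 1) / R₀) := by
      field_simp
      ring
    have h2 : l * ((n : ℝ) - 2) = γ / (1 - γ) := by
      rw [hl']
      field_simp
    rw [h1, h2]
    field_simp
    ring
  rw [e3] at e2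
  rw [← mul_left_inj' hγ'.ne', hgeom]
  generalize 1 - γ ^ (n - 1) = D at hD e2
  generalize γ ^ (n - 2) = q at e2
  field_simp at e2
  linear_combination e2

/-- For the prescribed l, the equation of R reduces to R R' = -(n-2)/γ, which the square root
solves; the condition on μ makes h = lR solve its own equation. -/
theorem isSelfSimilarTorusFlow_sqrt {μ R₀ γ l : ℝ} (hR₀ : 0 < R₀) (hγ : 0 < γ) (hγ1 : γ < 1)
    (hl : l = γ / (((n : ℝ) - 2) * (1 - γ)))
    (hsum : ∑ i ∈ Finset.range (n - 1), γ ^ i = ((n : ℝ) - 1) * μ * (1 + γ ^ (n - 2))) :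
    IsSelfSimilarTorusFlow τ μ (fun t => γ * √(R₀ ^ 2 - 2 * (((n : ℝ) - 2) / γ) * t))
      (fun t => √(R₀ ^ 2 - 2 * (((n : ℝ) - 2) / γ) * t))
      (fun t => l * √(R₀ ^ 2 - 2 * (((n : ℝ) - 2) / γ) * t))
      (R₀ ^ 2 / (2 * (((n : ℝ) - 2) / γ))) := by
  have hγ' : 0 < 1 - γ := sub_pos.2 hγ1
  have hn3 : (3 : ℝ) ≤ n := by exact_mod_cast hn
  have hn2 : 0 < (n : ℝ) - 2 := by linarith
  have hl0 : 0 < l := by rw [hl]; positivity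
  set C : ℝ := ((n : ℝ) - 2) / γ with hC
  have hC0 : 0 < C := by positivity
  set T : ℝ := R₀ ^ 2 / (2 * C) with hT
  have harg : ∀ t ∈ Ico 0 T, 0 < R₀ ^ 2 - 2 * C * t := fun t ht => by
    have := ht.2
    rw [hT, lt_div_iff₀ (by positivity)] at this
    linarith
  have hsmooth : ContDiffOn ℝ 1 (fun t => √(R₀ ^ 2 - 2 * C * t)) (Ico 0 T) := by
    refine ContDiffOn.sqrt ?_ fun t ht => (harg t ht).ne'
    fun_prop
  have hdata : IsTorusData (fun t => γ * √(R₀ ^ 2 - 2 * C * t))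
      (fun t => √(R₀ ^ 2 - 2 * C * t)) (fun t => l * √(R₀ ^ 2 - 2 * C * t)) T := by
    refine ⟨by positivity, contDiffOn_const.mul hsmooth, hsmooth, contDiffOn_const.mul hsmooth,
      fun t ht => ?_, fun t ht => ?_, fun t ht => ?_⟩
    · have := Real.sqrt_pos.2 (harg t ht)
      positivity
    · exact mul_lt_of_lt_one_left (Real.sqrt_pos.2 (harg t ht)) hγ1
    · have := Real.sqrt_pos.2 (harg t ht)
      positivity
  refine ⟨hdata, (isCurvatureFlow_torus_iff hτ hn hdata).2 fun t ht => ?_, fun t ht => ?_⟩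
  · have hs : 0 < √(R₀ ^ 2 - 2 * C * t) := Real.sqrt_pos.2 (harg t ht)
    have hd : HasDerivWithinAt (fun t => √(R₀ ^ 2 - 2 * C * t)) (-(C / √(R₀ ^ 2 - 2 * C * t)))
        (Ico 0 T) t := by
      have h1 : HasDerivAt (fun t : ℝ => R₀ ^ 2 - 2 * C * t) (-(2 * C)) t := by
        simpa using ((hasDerivAt_id t).const_mul (2 * C)).const_sub (R₀ ^ 2)
      refine ((h1.sqrt (harg t ht).ne').congr_deriv ?_).hasDerivWithinAt
      field_simp
    have hlinv : 1 / l = ((n : ℝ) - 2) * (1 - γ) / γ := by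
      rw [hl]
      field_simp
    -- This identifies the constant in R R' = -C with the one produced by the first equation of the
    -- system.
    have hCl : C = ((n : ℝ) - 2) + 1 / l := by
      rw [hlinv, hC]
      field_simp
      ring
    have hD : 0 < 1 - γ ^ (n - 1) := sub_pos.2 (pow_lt_one₀ hγ.le hγ1 (by omega))
    have hgeom : (∑ i ∈ Finset.range (n - 1), γ ^ i) * (1 - γ) = 1 - γ ^ (n - 1) :=
      geom_sum_mul_neg γ (n - 1)
    rw [hsum] at hgeom
    refine ⟨hd.congr_deriv ?_, (hd.const_mul γ).congr_deriv ?_, (hd.const_mul l).congr_deriv ?_⟩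
    all_goals
      beta_reduce
      generalize √(R₀ ^ 2 - 2 * C * t) = S at hs
    · rw [hCl]
      field_simp
      ring
    · rw [show (1 : ℝ) / (l * S) = 1 / l / S by field_simp, hlinv, hC]
      field_simp
      ring
    · have hB : (S ^ (n - 2) + (γ * S) ^ (n - 2)) / (S ^ (n - 1) - (γ * S) ^ (n - 1)) =
          (1 + γ ^ (n - 2)) / ((1 - γ ^ (n - 1)) * S) := by
        have h1 : S ^ (n - 1) - (γ * S) ^ (n - 1) = (1 - γ ^ (n - 1)) * S * S ^ (n - 2) := by
          rw [mul_pow, show n - 1 = n - 2 + 1 by omega, pow_succ S]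
          ring
        rw [h1, mul_pow]
        have hp : S ^ (n - 2) ≠ 0 := (pow_pos hs _).ne'
        field_simp
      rw [hB, hl, hC]
      generalize 1 - γ ^ (n - 1) = D at hD hgeom
      generalize γ ^ (n - 2) = q at hgeom
      field_simp
      linear_combination hgeom
  · have ht0 : (0 : ℝ) ∈ Ico 0 T := ⟨le_rfl, hdata.time_pos⟩
    have hs := Real.sqrt_pos.2 (harg t ht)
    have hs0 := Real.sqrt_pos.2 (harg 0 ht0)
    refine ⟨√(R₀ ^ 2 - 2 * C * t) / √(R₀ ^ 2 - 2 * C * 0), by positivity, ?_⟩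
    rw [smul_torus hτ (by positivity)]
    generalize √(R₀ ^ 2 - 2 * C * t) = S at hs
    generalize √(R₀ ^ 2 - 2 * C * 0) = S₀ at hs0
    congr 1 <;> field_simp

/-- The initial tori of self-similar flows. -/
theorem exists_isSelfSimilarTorusFlow_iff {μ R₀ γ l : ℝ} (hR₀ : 0 < R₀) (hγ : 0 < γ)
    (hγ1 : γ < 1) (hl : 0 < l) :
    (∃ (r R h : ℝ → ℝ) (T : ℝ), IsSelfSimilarTorusFlow τ μ r R h T ∧
      r 0 = γ * R₀ ∧ R 0 = R₀ ∧ h 0 = l * R₀) ↔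
    (l = γ / (((n : ℝ) - 2) * (1 - γ)) ∧
      ∑ i ∈ Finset.range (n - 1), γ ^ i = ((n : ℝ) - 1) * μ * (1 + γ ^ (n - 2))) := by
  constructor
  · rintro ⟨r, R, h, T, H, hr0, hR0, hh0⟩
    exact H.parameters hτ hn hR₀ hγ hγ1 hl hr0 hR0 hh0
  · rintro ⟨h1, h2⟩
    refine ⟨_, _, _, _, isSelfSimilarTorusFlow_sqrt hτ hn hR₀ hγ hγ1 h1 h2, ?_, ?_, ?_⟩ <;>
      simp only [mul_zero, sub_zero, Real.sqrt_sq hR₀.le]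

end SelfSimilar

/-! ### The three-dimensional case and the explicit shrinking solution. -/

section DimensionThree

variable {n : ℕ} {τ : Horizontal n → ℝ} (hτ : IsGauge τ) (hn : n = 3)
include hτ

theorem shrinkingDoughnut_eq_torus (t : ℝ) :
    shrinkingDoughnut τ t = torus τ (√(1 - 4 * t) / 2) (√(1 - 4 * t)) (√(1 - 4 * t)) := by
  rw [shrinkingDoughnut]
  split_ifs with h
  · rw [smul_torus hτ (Real.sqrt_pos.2 (by linarith))]
    congr 1 <;> ring
  -- For t ≥ 1/4 the real square root is 0 by convention, so both radii vanish and the torus is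
  -- empty; one formula covers all times.
  · rw [Real.sqrt_eq_zero_of_nonpos (by linarith)]
    refine (eq_empty_of_forall_notMem fun x hx => ?_).symm
    have h1 := hx.1
    have h2 := hx.2.1
    linarith

include hn

theorem isSelfSimilarTorusFlow_half :
    IsSelfSimilarTorusFlow τ (1 / 2) (fun t => √(1 - 4 * t) / 2) (fun t => √(1 - 4 * t))
      (fun t => √(1 - 4 * t)) (1 / 4) := by
  have h1 := isSelfSimilarTorusFlow_sqrt (μ := 1 / 2) (R₀ := 1) (γ := 1 / 2) (l := 1) hτ hn.ge
    one_pos (by norm_num) (by norm_num) (by rw [hn]; norm_num)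
    (by rw [hn]; norm_num [Finset.sum_range_succ])
  have hC : ∀ t : ℝ, (1 : ℝ) ^ 2 - 2 * (((n : ℝ) - 2) / (1 / 2)) * t = 1 - 4 * t := fun t => by
    rw [hn]; norm_num
  have hT : (1 : ℝ) ^ 2 / (2 * (((n : ℝ) - 2) / (1 / 2))) = 1 / 4 := by rw [hn]; norm_num
  have hr : ∀ t : ℝ, 1 / 2 * √(1 - 4 * t) = √(1 - 4 * t) / 2 := fun t => by ring
  simpa only [hC, hT, hr, one_mul] using h1

theorem exists_isSelfSimilarTorusFlow_iff_of_three {μ : ℝ} :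
    (∃ (r R h : ℝ → ℝ) (T : ℝ), IsSelfSimilarTorusFlow τ μ r R h T) ↔ μ = 1 / 2 := by
  constructor
  · rintro ⟨r, R, h, T, H⟩
    have h0 : (0 : ℝ) ∈ Ico 0 T := ⟨le_rfl, H.data.time_pos⟩
    have hr := H.data.r_pos 0 h0
    have hrR := H.data.r_lt_R 0 h0
    have hh := H.data.h_pos 0 h0
    have hR := hr.trans hrR
    obtain ⟨-, h2⟩ := H.parameters hτ hn.ge (R₀ := R 0) (γ := r 0 / R 0) (l := h 0 / R 0) hR
      (by positivity) ((div_lt_one hR).2 hrR) (by positivity) (by field_simp) rfl (by field_simp)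
    have hγ : 0 < r 0 / R 0 := by positivity
    generalize r 0 / R 0 = γ at h2 hγ
    rw [hn] at h2
    norm_num [Finset.sum_range_succ] at h2
    -- For n = 3 the geometric sum is 1 + γ, so γ drops out of the condition.
    have h3 : (1 + γ) * (1 - 2 * μ) = 0 := by linear_combination h2
    rcases mul_eq_zero.1 h3 with h4 | h4 <;> linarith
  · rintro rfl
    exact ⟨_, _, _, _, isSelfSimilarTorusFlow_half hτ hn⟩

omit hτ hn in
theorem isCrystallineCurvature_empty (σ : Ambient n → ℝ) :
    IsCrystallineCurvature σ (∅ : Set (Ambient n)) 0 := by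
  have hμ : surfaceMeasure (∅ : Set (Ambient n)) = 0 := by
    rw [surfaceMeasure, frontier_empty, Measure.restrict_empty]
  have hCH : IsCahnHoffman σ (∅ : Set (Ambient n)) 0 0 := by
    refine ⟨⟨0, by rw [frontier_empty]; exact LipschitzOnWith.of_dist_le_mul (by simp)⟩, ?_, ?_, ?_⟩ <;>
      rw [hμ]
    · simp
    · simp
    · exact MemLp.zero
  refine ⟨0, 0, ⟨hCH, fun w e _ => ?_⟩, ?_⟩ <;> rw [hμ] <;> simp

theorem isCurvatureFlow_shrinkingDoughnut :
    IsCurvatureFlow (cylindricalAnisotropy τ) (cylindricalMobility τ (1 / 2))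
      (shrinkingDoughnut τ) (Ici 0) := by
  have hfam : shrinkingDoughnut τ =
      fun t => torus τ (√(1 - 4 * t) / 2) (√(1 - 4 * t)) (√(1 - 4 * t)) :=
    funext (shrinkingDoughnut_eq_torus hτ)
  intro t ht
  rcases lt_or_ge t (1 / 4) with h | h
  · have hss := isSelfSimilarTorusFlow_half hτ hn
    have htI : t ∈ Ico (0 : ℝ) (1 / 4) := ⟨ht, h⟩
    obtain ⟨h1, h2, h3⟩ := (isCurvatureFlow_torus_iff hτ hn.ge hss.data).1 hss.flow t htI
    -- The time interval is now [0, ∞). Near t < 1/4 it agrees with [0, 1/4), so the one-sided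
    -- derivatives carry over.
    have hnhds : Ico (0 : ℝ) (1 / 4) ∈ 𝓝[Ici 0] t :=
      mem_nhdsWithin.2 ⟨Iio (1 / 4), isOpen_Iio, h, fun s hs => ⟨hs.2, hs.1⟩⟩
    rw [hfam]
    refine (torus_velocity_law_iff hτ hn.ge (r := fun t => √(1 - 4 * t) / 2)
      (R := fun t => √(1 - 4 * t)) (h := fun t => √(1 - 4 * t)) ht (fun δ hδ => ?_)
      (hss.data.r_pos t htI)
      (hss.data.r_lt_R t htI) (hss.data.h_pos t htI) (h2.mono_of_mem_nhdsWithin hnhds)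
      (h1.mono_of_mem_nhdsWithin hnhds) (h3.mono_of_mem_nhdsWithin hnhds)).2 ⟨rfl, rfl, rfl⟩
    have ht' : 0 ≤ t := ht
    exact ⟨t + δ / 2, show 0 ≤ t + δ / 2 by positivity, by linarith, by linarith⟩
  · have hempty : shrinkingDoughnut τ t = ∅ := if_neg (not_lt.2 h)
    rw [hempty]
    refine ⟨0, isCrystallineCurvature_empty _, ?_⟩
    rw [surfaceMeasure, frontier_empty, Measure.restrict_empty]
    simp

omit hn in
theorem eventually_shrinkingDoughnut_subset_ball {ε : ℝ} (hε : 0 < ε) :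
    ∀ᶠ t in 𝓝[<] (1 / 4 : ℝ), shrinkingDoughnut τ t ⊆ Metric.ball 0 ε := by
  obtain ⟨C, -, hC⟩ := hτ.isGauge_polar.exists_norm_le_mul
  have h1 : Tendsto (fun t : ℝ => (C + 1 : ℝ) * √(1 - 4 * t)) (𝓝[<] (1 / 4)) (𝓝 0) := by
    have h2 : Continuous fun t : ℝ => (C + 1 : ℝ) * √(1 - 4 * t) := by fun_prop
    have h3 := h2.tendsto (1 / 4)
    norm_num at h3
    norm_num
    exact h3.mono_left nhdsWithin_le_nhds
  filter_upwards [h1.eventually_lt_const hε] with t ht x hx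
  rw [shrinkingDoughnut_eq_torus hτ] at hx
  rw [mem_ball_zero_iff]
  have h4 : ‖x‖ ≤ ‖x.fst‖ + |x.snd| := norm_toLp_le x.fst x.snd
  have h5 := (hC x.fst).trans (mul_le_mul_of_nonneg_left hx.2.1.le C.2)
  have h6 := hx.2.2
  have h7 : (C : ℝ) * √(1 - 4 * t) + √(1 - 4 * t) < ε := by linarith
  exact (h4.trans (add_le_add h5 h6.le)).trans_lt h7

omit hn in
theorem shrinkingDoughnut_nonempty (hn : 3 ≤ n) {t : ℝ} (ht : t < 1 / 4) :
    (shrinkingDoughnut τ t).Nonempty := by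
  have hs : 0 < √(1 - 4 * t) := Real.sqrt_pos.2 (by linarith)
  rw [shrinkingDoughnut_eq_torus hτ]
  have h1 := image_snd_torus (h := √(1 - 4 * t)) hτ hn (half_pos hs) (half_lt_self hs)
  rw [← image_nonempty, h1]
  exact nonempty_Ioo.2 (by linarith)

end DimensionThree

end

theorem mainTheorem1 (n : ℕ) (hn : 3 ≤ n) (τ : Horizontal n → ℝ) (hτ : IsAnisotropy τ)
    (heven : ∀ p : Horizontal n, τ (-p) = τ p) (μ : ℝ) (hμ : 0 < μ) :
    -- the explicit field is a minimal Cahn-Hoffman field, with the stated divergence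
    (∀ r R h : ℝ, 0 < r → r < R → 0 < h →
      IsMinimalCahnHoffman (cylindricalAnisotropy τ) (torus τ r R h)
        (torusField τ r R h) (torusDivergence τ r R h)) ∧
    -- tori evolve by the velocity law exactly if the parameters solve the ODE system
    (∀ (r R h : ℝ → ℝ) (T : ℝ), IsTorusData r R h T →
      (IsCurvatureFlow (cylindricalAnisotropy τ) (cylindricalMobility τ μ)
          (fun t => torus τ (r t) (R t) (h t)) (Ico 0 T) ↔
        SolvesTorusODE n μ r R h T)) ∧
    -- the initial tori of self-similar solutions
    (∀ R₀ γ l : ℝ, 0 < R₀ → 0 < γ → γ < 1 → 0 < l →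
      ((∃ (r R h : ℝ → ℝ) (T : ℝ), IsSelfSimilarTorusFlow τ μ r R h T ∧
          r 0 = γ * R₀ ∧ R 0 = R₀ ∧ h 0 = l * R₀) ↔
        (l = γ / (((n : ℝ) - 2) * (1 - γ)) ∧
          ∑ i ∈ Finset.range (n - 1), γ ^ i = ((n : ℝ) - 1) * μ * (1 + γ ^ (n - 2))))) ∧
    -- dimension three: self-similar solutions exist exactly for `μ = 1/2`
    (n = 3 →
      ((∃ (r R h : ℝ → ℝ) (T : ℝ), IsSelfSimilarTorusFlow τ μ r R h T) ↔ μ = 1 / 2)) ∧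
    -- dimension three, `μ = 1/2`: the explicit solution and its extinction at time `1/4`
    (n = 3 → μ = 1 / 2 →
      shrinkingDoughnut τ 0 = torus τ (1 / 2) 1 1 ∧
      IsSelfSimilarTorusFlow τ μ (fun t => Real.sqrt (1 - 4 * t) / 2)
        (fun t => Real.sqrt (1 - 4 * t)) (fun t => Real.sqrt (1 - 4 * t)) (1 / 4) ∧
      (∀ t ∈ Ico (0 : ℝ) (1 / 4), (shrinkingDoughnut τ t).Nonempty ∧
        shrinkingDoughnut τ t = torus τ (Real.sqrt (1 - 4 * t) / 2)
          (Real.sqrt (1 - 4 * t)) (Real.sqrt (1 - 4 * t))) ∧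
      IsCurvatureFlow (cylindricalAnisotropy τ) (cylindricalMobility τ μ)
        (shrinkingDoughnut τ) (Ici 0) ∧
      (∀ ε > 0, ∀ᶠ t in 𝓝[<] (1 / 4 : ℝ), shrinkingDoughnut τ t ⊆ Metric.ball 0 ε) ∧
      (∀ t : ℝ, 1 / 4 ≤ t → shrinkingDoughnut τ t = ∅)) := by
  have hg : IsGauge τ := hτ.isGauge heven
  refine ⟨fun r R h hr hrR hh => isMinimalCahnHoffman_torusField hg hn hr hrR hh,
    fun r R h T hdata => isCurvatureFlow_torus_iff hg hn hdata,
    fun R₀ γ l hR₀ hγ hγ1 hl => exists_isSelfSimilarTorusFlow_iff hg hn hR₀ hγ hγ1 hl,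
    fun hn3 => exists_isSelfSimilarTorusFlow_iff_of_three hg hn3, ?_⟩
  rintro hn3 rfl
  refine ⟨?_, isSelfSimilarTorusFlow_half hg hn3, fun t ht =>
    ⟨shrinkingDoughnut_nonempty hg hn ht.2, shrinkingDoughnut_eq_torus hg t⟩,
    isCurvatureFlow_shrinkingDoughnut hg hn3,
    fun ε hε => eventually_shrinkingDoughnut_subset_ball hg hε,
    fun t ht => if_neg (not_lt.2 ht)⟩
  rw [shrinkingDoughnut_eq_torus hg, mul_zero, sub_zero, Real.sqrt_one]
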